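/- Fix an integer $n\ge 0$ and a path-connected space $X$ with base point $\ast$. Manifolds are compact, oriented and smooth. An ($n$-dimensional) $X$-manifold $(M,g)$ is a closed $n$-manifold $M$ with one base point in each connected component and a continuous map $g:M\to X$ sending all base points to $\ast$. An $X$-diffeomorphism $(M,g)\to(N,h)$ is an orientation-preserving diffeomorphism $\psi:M\to N$ that takes base points to base points and satisfies $h\circ\psi=g$. An $X$-cobordism $(W,F):(M,g)\to(N,h)$ is an $(n+1)$-manifold $W$ with an identification of its oriented boundary $\partial W=-M\amalg N$, and a homotopy class relative to $\partial W$ of maps $F:W\to X$ extending $g$ and $h$. An $X$-diffeomorphism $\Psi:(W,F)\to(V,G)$ of $X$-cobordisms is an orientation-preserving diffeomorphism $W\to V$ that restricts to $X$-diffeomorphisms $\Psi|_{\partial_-W}$, $\Psi|_{\partial_+W}$ of the incoming and outgoing boundaries and satisfies $F=G\circ\Psi$ as homotopy classes relative to the boundary. Compositions are written in diagrammatic order. $\mathrm{HCobord}(n,X)$ is the symmetric monoidal category whose objects are the $X$-manifolds, with $\otimes=\amalg$, unit $\emptyset$, and the associativity, unit and symmetry isomorphisms given by the obvious $X$-diffeomorphisms.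 Its morphisms are the formal composites and disjoint unions of $X$-diffeomorphisms and $X$-cobordisms, modulo the monoidal congruence generated by the axioms of a symmetric monoidal category (with these structure isomorphisms), the composition and the disjoint union of $X$-diffeomorphisms, the disjoint union of $X$-cobordisms, and the following relations: 1. $(W,F)\,\Psi|_{\partial_+W}=\Psi|_{\partial_-W}\,(V,G)$ for each $X$-diffeomorphism $\Psi:(W,F)\to(V,G)$ of $X$-cobordisms; 2. $(W,F)\amalg_\psi(V,G)=(W,F)\,\psi\,(V,G)$ for each gluing of $X$-cobordisms $(W,F):(M,g)\to(N,h)$ and $(V,G):(N',h')\to(P,j)$ along an $X$-diffeomorphism $\psi:(N,h)\to(N',h')$; 3. the cylinder $(I\times M,1_g):(M,g)\to(M,g)$, where $I=[0,1]$ and $1_g(t,x)=g(x)$, is the identity of $(M,g)$. Put $(M,g)^*=(-M,g)$, where $-M$ is $M$ with the opposite orientation. Let $\eta_{(M,g)}:\emptyset\to(M,g)\amalg(M,g)^*$ and $\varepsilon_{(M,g)}:(M,g)^*\amalg(M,g)\to\emptyset$ be the cylinder $(I\times M,1_g)$ viewed as an $X$-cobordism between the indicated objects. For a morphism $f:a\to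 b$ put $$f^*=(1_{b^*}\otimes\eta_a)(1_{b^*}\otimes f\otimes 1_{a^*})(\varepsilon_b\otimes 1_{a^*}):b^*\to a^*.$$ **Proposition.** With these $(\ )^*$, $\eta$, $\varepsilon$, $\mathrm{HCobord}(n,X)$ is a symmetric monoidal category with strict duals. This means that, the associativity and unit isomorphisms being suppressed, for all objects $a,b$: - $(\eta_a\otimes1_a)(1_a\otimes\varepsilon_a)=1_a$ and $(1_{a^*}\otimes\eta_a)(\varepsilon_a\otimes1_{a^*})=1_{a^*}$; - $a^{**}=a$, $(a\otimes b)^*=a^*\otimes b^*$, $\emptyset^*=\emptyset$, and the canonical isomorphisms $a^{**}\cong a$, $(a\otimes b)^*\cong a^*\otimes b^*$, $\emptyset^*\cong\emptyset$ determined by $\eta$, $\varepsilon$ and the symmetry $\sigma$ are identities; - $\eta_a=(\varepsilon_{a^*})^*\,\sigma_{a^*,a}$ and $\eta_a=(\varepsilon_a)^*$; - $\eta_{a\otimes b}=\eta_a(1_a\otimes\eta_b\otimes1_{a^*})(1_a\otimes1_b\otimes\sigma_{b^*,a^*})$ and $\varepsilon_{a\otimes b}=(\sigma_{a^*,b^*}\otimes1_a\otimes1_b)(1_{b^*}\otimes\varepsilon_a\otimes1_b)\,\varepsilon_b$.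 Moreover, for each $X$-cobordism $(W,F):(M,g)\to(N,h)$ the dual $(W,F)^*$ is the same $X$-cobordism $(W,F)$ viewed as an $X$-cobordism $(N,h)^*\to(M,g)^*$, and for each $X$-diffeomorphism $\psi:(M,g)\to(N,h)$ one has $\psi^*=\psi_-^{-1}$, where $\psi_-:(M,g)^*\to(N,h)^*$ is the $X$-diffeomorphism given by $\psi$. -/

import Mathlib

universe u v

noncomputable section

namespace HQFT

section Geometry

open scoped Manifold ContDiff Topology

/-! ### Oriented manifolds -/

section LinearAlgebra

variable {E F E' F' : Type*} [AddCommGroup E] [Module ℝ E] [AddCommGroup F] [Module ℝ F]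
  [AddCommGroup E'] [Module ℝ E'] [AddCommGroup F'] [Module ℝ F'] {k : ℕ}

/-- The alternating form `θ` is nonzero and represents the orientation `o`
(an orientation being a ray of alternating forms). For `k = 0` this says that the number `θ` has
the sign `o`. -/
def IsPositive (o : Orientation ℝ E (Fin k)) (θ : E [⋀^Fin k]→ₗ[ℝ] ℝ) : Prop :=
  ∃ h : θ ≠ 0, rayOfNeZero ℝ θ h = o

/-- The linear map `A` carries the orientation `a` to the orientation `b`: the pullback of each
form representing `b` represents `a` (in particular it is nonzero, so that `A` is injective when
`k` is the dimension of `E`). -/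
def LinPreserves (A : E →ₗ[ℝ] F) (a : Orientation ℝ E (Fin k)) (b : Orientation ℝ F (Fin k)) :
    Prop :=
  ∀ θ : F [⋀^Fin k]→ₗ[ℝ] ℝ, IsPositive b θ → IsPositive a (θ.compLinearMap A)

theorem IsPositive.exists (o : Orientation ℝ E (Fin k)) : ∃ θ, IsPositive o θ := by
  induction o using Module.Ray.ind with
  | h v hv => exact ⟨v, hv, rfl⟩

theorem IsPositive.smul {o : Orientation ℝ E (Fin k)} {θ : E [⋀^Fin k]→ₗ[ℝ] ℝ}
    (h : IsPositive o θ) {c : ℝ} (hc : 0 < c) : IsPositive o (c • θ) := by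
  obtain ⟨h0, rfl⟩ := h
  exact ⟨smul_ne_zero hc.ne' h0, (ray_eq_iff _ _).2 (SameRay.sameRay_pos_smul_left θ hc)⟩

theorem IsPositive.exists_smul {o : Orientation ℝ E (Fin k)} {θ θ' : E [⋀^Fin k]→ₗ[ℝ] ℝ}
    (h : IsPositive o θ) (h' : IsPositive o θ') : ∃ c : ℝ, 0 < c ∧ c • θ = θ' := by
  obtain ⟨h0, rfl⟩ := h
  obtain ⟨h1, h2⟩ := h'
  exact ((ray_eq_iff _ _).1 h2.symm).exists_pos_left h0 h1

theorem isPositive_neg {o : Orientation ℝ E (Fin k)} {θ : E [⋀^Fin k]→ₗ[ℝ] ℝ} :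
    IsPositive (-o) θ ↔ IsPositive o (-θ) := by
  constructor
  · rintro ⟨h0, h⟩
    exact ⟨neg_ne_zero.2 h0, (neg_rayOfNeZero ℝ θ h0).symm.trans (by rw [h]; exact neg_neg o)⟩
  · rintro ⟨h0, h⟩
    refine ⟨neg_ne_zero.1 h0, ?_⟩
    rw [← h, neg_rayOfNeZero]
    simp

theorem LinPreserves.id (a : Orientation ℝ E (Fin k)) : LinPreserves LinearMap.id a a := by
  intro θ h
  simpa using h

theorem LinPreserves.comp {A : E →ₗ[ℝ] F} {B : F →ₗ[ℝ] E'} {a : Orientation ℝ E (Fin k)}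
    {b : Orientation ℝ F (Fin k)} {c : Orientation ℝ E' (Fin k)} (hB : LinPreserves B b c)
    (hA : LinPreserves A a b) : LinPreserves (B ∘ₗ A) a c := by
  intro θ h
  exact hA _ (hB θ h)

theorem LinPreserves.neg {A : E →ₗ[ℝ] F} {a : Orientation ℝ E (Fin k)}
    {b : Orientation ℝ F (Fin k)} (h : LinPreserves A a b) : LinPreserves A (-a) (-b) := by
  intro θ hθ
  rw [isPositive_neg] at hθ ⊢
  exact h _ hθ

theorem LinPreserves.inv {A : E →ₗ[ℝ] F} {B : F →ₗ[ℝ] E} (hAB : A ∘ₗ B = LinearMap.id)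
    {a : Orientation ℝ E (Fin k)} {b : Orientation ℝ F (Fin k)} (h : LinPreserves A a b) :
    LinPreserves B b a := by
  intro θ hθ
  obtain ⟨η, hη⟩ := IsPositive.exists b
  obtain ⟨c, hc, rfl⟩ := (h η hη).exists_smul hθ
  have : (c • η.compLinearMap A).compLinearMap B = c • η := by
    ext w
    have h2 : ∀ x, A (B x) = x := fun x => congrArg (fun f : F →ₗ[ℝ] F => f x) hAB
    simp [h2]
  rw [this]
  exact hη.smul hc

/-- The exterior product of a linear form on `F` and an alternating form on `E`, as a form
on `F × E`. -/
def wedge (τ : F →ₗ[ℝ] ℝ) (θ : E [⋀^Fin k]→ₗ[ℝ] ℝ) : (F × E) [⋀^Fin (k + 1)]→ₗ[ℝ] ℝ :=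
  AlternatingMap.alternatizeUncurryFin
    ((τ ∘ₗ LinearMap.fst ℝ F E).smulRight (θ.compLinearMap (LinearMap.snd ℝ F E)))

theorem wedge_curryLeft_inr (τ : F →ₗ[ℝ] ℝ) (θ : E [⋀^Fin k]→ₗ[ℝ] ℝ) (z : F × E) :
    ((wedge τ θ).curryLeft z).compLinearMap (LinearMap.inr ℝ F E) = τ z.1 • θ := by
  ext w
  rw [AlternatingMap.compLinearMap_apply, AlternatingMap.curryLeft_apply_apply, wedge,
    AlternatingMap.alternatizeUncurryFin_apply, Fin.sum_univ_succ]
  simp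

theorem wedge_comp (τ : F →ₗ[ℝ] ℝ) (θ : E [⋀^Fin k]→ₗ[ℝ] ℝ) (B : F' →ₗ[ℝ] F)
    (A : E' →ₗ[ℝ] E) :
    (wedge τ θ).compLinearMap (B.prodMap A) = wedge (τ ∘ₗ B) (θ.compLinearMap A) := by
  ext w
  rw [AlternatingMap.compLinearMap_apply, wedge, wedge,
    AlternatingMap.alternatizeUncurryFin_apply, AlternatingMap.alternatizeUncurryFin_apply]
  refine Finset.sum_congr rfl fun i _ => ?_
  simp [Function.comp_def, Fin.removeNth]

theorem wedge_smul (τ : F →ₗ[ℝ] ℝ) (c : ℝ) (θ : E [⋀^Fin k]→ₗ[ℝ] ℝ) :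
    wedge τ (c • θ) = c • wedge τ θ := by
  ext w
  rw [AlternatingMap.smul_apply, wedge, wedge,
    AlternatingMap.alternatizeUncurryFin_apply, AlternatingMap.alternatizeUncurryFin_apply,
    Finset.smul_sum]
  refine Finset.sum_congr rfl fun i _ => ?_
  simp
  ring

theorem wedge_ne_zero {τ : F →ₗ[ℝ] ℝ} (hτ : τ ≠ 0) {θ : E [⋀^Fin k]→ₗ[ℝ] ℝ} (hθ : θ ≠ 0) :
    wedge τ θ ≠ 0 := by
  obtain ⟨f, hf⟩ : ∃ f, τ f ≠ 0 := by
    by_contra! h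
    exact hτ (LinearMap.ext h)
  intro h
  have := wedge_curryLeft_inr τ θ (f, 0)
  rw [h] at this
  have h3 : τ f • θ = 0 := by
    rw [← this]
    ext w
    simp
  exact (smul_ne_zero hf hθ) h3

/-- The product orientation on `F × E`, where the line `F` is oriented by the nonzero linear form
`τ` and comes first. -/
def prodOrientation (τ : F →ₗ[ℝ] ℝ) (hτ : τ ≠ 0) (o : Orientation ℝ E (Fin k)) :
    Orientation ℝ (F × E) (Fin (k + 1)) :=
  rayOfNeZero ℝ (wedge τ o.someVector) (wedge_ne_zero hτ o.someVector_ne_zero)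

theorem isPositive_prodOrientation_iff {τ : F →ₗ[ℝ] ℝ} (hτ : τ ≠ 0)
    {o : Orientation ℝ E (Fin k)} {Ω : (F × E) [⋀^Fin (k + 1)]→ₗ[ℝ] ℝ} :
    IsPositive (prodOrientation τ hτ o) Ω ↔ ∃ θ, IsPositive o θ ∧ Ω = wedge τ θ := by
  have h0 : IsPositive o o.someVector := ⟨o.someVector_ne_zero, o.someVector_ray⟩
  have h1 : IsPositive (prodOrientation τ hτ o) (wedge τ o.someVector) :=
    ⟨wedge_ne_zero hτ o.someVector_ne_zero, rfl⟩
  constructor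
  · intro h
    obtain ⟨c, hc, rfl⟩ := h1.exists_smul h
    exact ⟨c • o.someVector, h0.smul hc, (wedge_smul _ _ _).symm⟩
  · rintro ⟨θ, hθ, rfl⟩
    obtain ⟨c, hc, rfl⟩ := h0.exists_smul hθ
    rw [wedge_smul]
    exact h1.smul hc

theorem LinPreserves.prodMap {τ : F →ₗ[ℝ] ℝ} (hτ : τ ≠ 0) {τ' : F' →ₗ[ℝ] ℝ} (hτ' : τ' ≠ 0)
    {B : F' →ₗ[ℝ] F} (hB : τ ∘ₗ B = τ') {A : E' →ₗ[ℝ] E} {a : Orientation ℝ E' (Fin k)}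
    {b : Orientation ℝ E (Fin k)} (hA : LinPreserves A a b) :
    LinPreserves (B.prodMap A) (prodOrientation τ' hτ' a) (prodOrientation τ hτ b) := by
  intro Ω hΩ
  rw [isPositive_prodOrientation_iff] at hΩ ⊢
  obtain ⟨θ, hθ, rfl⟩ := hΩ
  exact ⟨_, hA θ hθ, by rw [wedge_comp, hB]⟩

end LinearAlgebra

section Manifold

variable {E : Type*} [NormedAddCommGroup E] [NormedSpace ℝ E] {H : Type*} [TopologicalSpace H]
  {I : ModelWithCorners ℝ E H} {M N P : Type*}
  [TopologicalSpace M] [ChartedSpace H M] [TopologicalSpace N] [ChartedSpace H N]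
  [TopologicalSpace P] [ChartedSpace H P] {k : ℕ}

/-- An orientation of the manifold `M` of dimension `k`: an orientation of each tangent space,
constant in a chart around each point. -/
@[ext]
structure ManifoldOrientation (I : ModelWithCorners ℝ E H) (M : Type*) [TopologicalSpace M]
    [ChartedSpace H M] (k : ℕ) where
  /-- the orientation of the tangent space at a point -/
  at' : ∀ x : M, Orientation ℝ (TangentSpace I x) (Fin k)
  locallyConstant : ∀ x₀ : M, ∃ b : Orientation ℝ E (Fin k), ∀ᶠ x in 𝓝 x₀,
    LinPreserves (mfderiv I 𝓘(ℝ, E) (extChartAt I x₀) x : E →L[ℝ] E).toLinearMap (at' x) b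

/-- The opposite orientation. -/
instance : Neg (ManifoldOrientation I M k) where
  neg o :=
    { at' := fun x => -o.at' x
      locallyConstant := fun x₀ => by
        obtain ⟨b, hb⟩ := o.locallyConstant x₀
        exact ⟨-b, hb.mono fun x hx => hx.neg⟩ }

theorem ManifoldOrientation.neg_at (o : ManifoldOrientation I M k) (x : M) :
    (-o).at' x = -o.at' x := rfl

theorem ManifoldOrientation.neg_neg (o : ManifoldOrientation I M k) : - -o = o := by
  ext x : 2
  exact _root_.neg_neg (o.at' x)

/-- The (smooth) map `f` between oriented manifolds of the same dimension preserves
orientations. -/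
def PreservesOrientation (oM : ManifoldOrientation I M k) (oN : ManifoldOrientation I N k)
    (f : M → N) : Prop :=
  ∀ x : M, LinPreserves (mfderiv I I f x : E →L[ℝ] E).toLinearMap
    (oM.at' x) (oN.at' (f x))

theorem PreservesOrientation.id (oM : ManifoldOrientation I M k) :
    PreservesOrientation oM oM id := by
  intro x
  rw [mfderiv_id]
  exact LinPreserves.id _

theorem PreservesOrientation.comp {oM : ManifoldOrientation I M k}
    {oN : ManifoldOrientation I N k} {oP : ManifoldOrientation I P k} {f : M → N} {g : N → P}
    (hg : PreservesOrientation oN oP g) (hf : PreservesOrientation oM oN f)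
    (hg' : ContMDiff I I ∞ g) (hf' : ContMDiff I I ∞ f) :
    PreservesOrientation oM oP (g ∘ f) := by
  intro x
  rw [mfderiv_comp x (hg'.mdifferentiable (by simp) _) (hf'.mdifferentiable (by simp) _)]
  exact (hg (f x)).comp (hf x)

theorem PreservesOrientation.symm {oM : ManifoldOrientation I M k}
    {oN : ManifoldOrientation I N k} {f : M ≃ₘ^∞⟮I, I⟯ N}
    (hf : PreservesOrientation oM oN f) : PreservesOrientation oN oM f.symm := by
  intro y
  obtain ⟨x, rfl⟩ := f.surjective y
  have h := hf x
  have key : ∀ x', x' = x →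
      LinPreserves (mfderiv I I f.symm (f x) : E →L[ℝ] E).toLinearMap
        (oN.at' (f x)) (oM.at' x') := by
    rintro x' rfl
    refine LinPreserves.inv (A := (mfderiv I I f x' : E →L[ℝ] E).toLinearMap) ?_ h
    have h1 : mfderiv I I (f ∘ f.symm) (f x') = ContinuousLinearMap.id ℝ _ := by
      have : (f ∘ f.symm : N → N) = _root_.id := by ext; simp
      rw [this, mfderiv_id]
    rw [mfderiv_comp (f x') (f.contMDiff.mdifferentiable (by simp) _)
      (f.symm.contMDiff.mdifferentiable (by simp) _)] at h1
    have h2 : mfderiv I I f (f.symm (f x')) = (mfderiv I I f x' : E →L[ℝ] E) := by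
      rw [f.symm_apply_apply]
    rw [h2] at h1
    exact congrArg (fun L : E →L[ℝ] E => L.toLinearMap) h1
  exact key _ (f.symm_apply_apply x)

theorem PreservesOrientation.neg {oM : ManifoldOrientation I M k}
    {oN : ManifoldOrientation I N k} {f : M → N}
    (hf : PreservesOrientation oM oN f) : PreservesOrientation (-oM) (-oN) f :=
  fun x => (hf x).neg

theorem mfderiv_comp_inl {E' H' : Type*} [NormedAddCommGroup E'] [NormedSpace ℝ E']
    [TopologicalSpace H'] {J : ModelWithCorners ℝ E' H'} {Q : Type*} [TopologicalSpace Q]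
    [ChartedSpace H' Q] (f : M ⊕ N → Q) (x : M) (hf : MDifferentiableAt I J f (Sum.inl x)) :
    (mfderiv I J (f ∘ Sum.inl) x : E →L[ℝ] E') = mfderiv I J f (Sum.inl x) := by
  rw [mfderiv_comp x hf (hasMFDerivAt_inl (p := Sum.inl x)).mdifferentiableAt,
    (hasMFDerivAt_inl (p := Sum.inl x)).mfderiv]
  rfl

theorem mfderiv_comp_inr {E' H' : Type*} [NormedAddCommGroup E'] [NormedSpace ℝ E']
    [TopologicalSpace H'] {J : ModelWithCorners ℝ E' H'} {Q : Type*} [TopologicalSpace Q]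
    [ChartedSpace H' Q] (f : M ⊕ N → Q) (x : N) (hf : MDifferentiableAt I J f (Sum.inr x)) :
    (mfderiv I J (f ∘ Sum.inr) x : E →L[ℝ] E') = mfderiv I J f (Sum.inr x) := by
  rw [mfderiv_comp x hf (hasMFDerivAt_inr (p := Sum.inr x)).mdifferentiableAt,
    (hasMFDerivAt_inr (p := Sum.inr x)).mfderiv]
  rfl

theorem mfderiv_extChartAt_inl [IsManifold I 1 M] [IsManifold I 1 N] {x₀ x : M}
    (hx : x ∈ (chartAt H x₀).source) :
    (mfderiv I 𝓘(ℝ, E) (extChartAt I x₀) x : E →L[ℝ] E) =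
      mfderiv I 𝓘(ℝ, E) (extChartAt I (Sum.inl x₀ : M ⊕ N)) (Sum.inl x) := by
  rw [← mfderiv_comp_inl]
  · congr 1
    ext y
    simp
  · apply mdifferentiableAt_extChartAt
    simpa [ChartedSpace.sum_chartAt_inl] using hx

theorem mfderiv_extChartAt_inr [IsManifold I 1 M] [IsManifold I 1 N] {x₀ x : N}
    (hx : x ∈ (chartAt H x₀).source) :
    (mfderiv I 𝓘(ℝ, E) (extChartAt I x₀) x : E →L[ℝ] E) =
      mfderiv I 𝓘(ℝ, E) (extChartAt I (Sum.inr x₀ : M ⊕ N)) (Sum.inr x) := by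
  rw [← mfderiv_comp_inr]
  · congr 1
    ext y
    simp
  · apply mdifferentiableAt_extChartAt
    simpa [ChartedSpace.sum_chartAt_inr] using hx

/-- The orientation of a disjoint union. -/
def ManifoldOrientation.sum [IsManifold I 1 M] [IsManifold I 1 N]
    (oM : ManifoldOrientation I M k) (oN : ManifoldOrientation I N k) :
    ManifoldOrientation I (M ⊕ N) k where
  at' := fun p => Sum.rec (motive := fun p => Orientation ℝ (TangentSpace I p) (Fin k))
    (fun x => oM.at' x) (fun y => oN.at' y) p
  locallyConstant := by
    rintro (x₀ | x₀)
    · obtain ⟨b, hb⟩ := oM.locallyConstant x₀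
      refine ⟨b, ?_⟩
      rw [← Topology.IsOpenEmbedding.inl.map_nhds_eq, Filter.eventually_map]
      filter_upwards [hb, (chartAt H x₀).open_source.mem_nhds (mem_chart_source H x₀)]
        with x hx hx'
      have := mfderiv_extChartAt_inl (I := I) (N := N) hx'
      change LinPreserves (mfderiv I 𝓘(ℝ, E) (extChartAt I x₀) x : E →L[ℝ] E).toLinearMap
        _ _ at hx
      rw [this] at hx
      exact hx
    · obtain ⟨b, hb⟩ := oN.locallyConstant x₀
      refine ⟨b, ?_⟩
      rw [← Topology.IsOpenEmbedding.inr.map_nhds_eq, Filter.eventually_map]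
      filter_upwards [hb, (chartAt H x₀).open_source.mem_nhds (mem_chart_source H x₀)]
        with x hx hx'
      have := mfderiv_extChartAt_inr (I := I) (M := M) hx'
      change LinPreserves (mfderiv I 𝓘(ℝ, E) (extChartAt I x₀) x : E →L[ℝ] E).toLinearMap
        _ _ at hx
      rw [this] at hx
      exact hx

/-- The orientation of an empty manifold. -/
def ManifoldOrientation.empty [IsEmpty M] : ManifoldOrientation I M k where
  at' := fun x => isEmptyElim x
  locallyConstant := fun x => isEmptyElim x

theorem ManifoldOrientation.eq_of_isEmpty [IsEmpty M] (o o' : ManifoldOrientation I M k) :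
    o = o' := by
  ext x : 2
  exact isEmptyElim x

theorem ManifoldOrientation.neg_sum [IsManifold I 1 M] [IsManifold I 1 N]
    (oM : ManifoldOrientation I M k) (oN : ManifoldOrientation I N k) :
    -(oM.sum oN) = (-oM).sum (-oN) := by
  ext p : 2
  rcases p with p | p <;> rfl

theorem PreservesOrientation.inl [IsManifold I 1 M] [IsManifold I 1 N]
    (oM : ManifoldOrientation I M k) (oN : ManifoldOrientation I N k) :
    PreservesOrientation oM (oM.sum oN) Sum.inl := by
  intro x
  rw [(hasMFDerivAt_inl (p := Sum.inl x)).mfderiv]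
  exact LinPreserves.id (oM.at' x)

theorem PreservesOrientation.inr [IsManifold I 1 M] [IsManifold I 1 N]
    (oM : ManifoldOrientation I M k) (oN : ManifoldOrientation I N k) :
    PreservesOrientation oN (oM.sum oN) Sum.inr := by
  intro x
  rw [(hasMFDerivAt_inr (p := Sum.inr x)).mfderiv]
  exact LinPreserves.id (oN.at' x)

theorem PreservesOrientation.of_inl_inr [IsManifold I 1 M] [IsManifold I 1 N]
    {oM : ManifoldOrientation I M k} {oN : ManifoldOrientation I N k}
    {oP : ManifoldOrientation I P k} {f : M ⊕ N → P} (hf : ContMDiff I I ∞ f)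
    (hl : PreservesOrientation oM oP (f ∘ Sum.inl))
    (hr : PreservesOrientation oN oP (f ∘ Sum.inr)) :
    PreservesOrientation (oM.sum oN) oP f := by
  rintro (x | x)
  · have h := hl x
    have e := mfderiv_comp_inl (I := I) (J := I) f x (hf.mdifferentiable (by simp) _)
    change LinPreserves (mfderiv I I (f ∘ Sum.inl) x : E →L[ℝ] E).toLinearMap _ _ at h
    rw [e] at h
    exact h
  · have h := hr x
    have e := mfderiv_comp_inr (I := I) (J := I) f x (hf.mdifferentiable (by simp) _)
    change LinPreserves (mfderiv I I (f ∘ Sum.inr) x : E →L[ℝ] E).toLinearMap _ _ at h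
    rw [e] at h
    exact h

theorem PreservesOrientation.sumMap {M' N' : Type*} [TopologicalSpace M'] [ChartedSpace H M']
    [TopologicalSpace N'] [ChartedSpace H N'] [IsManifold I 1 M] [IsManifold I 1 N]
    [IsManifold I 1 M'] [IsManifold I 1 N']
    {oM : ManifoldOrientation I M k} {oN : ManifoldOrientation I N k}
    {oM' : ManifoldOrientation I M' k} {oN' : ManifoldOrientation I N' k}
    {f : M → M'} {g : N → N'} (hf : ContMDiff I I ∞ f) (hg : ContMDiff I I ∞ g)
    (hf' : PreservesOrientation oM oM' f) (hg' : PreservesOrientation oN oN' g) :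
    PreservesOrientation (oM.sum oN) (oM'.sum oN') (Sum.map f g) :=
  .of_inl_inr (hf.sumMap hg)
    ((PreservesOrientation.inl oM' oN').comp hf' ContMDiff.inl hf)
    ((PreservesOrientation.inr oM' oN').comp hg' ContMDiff.inr hg)

end Manifold

/-! ### Boundary orientation and the cylinder -/

/-- The model `[0, ∞) × ℝⁿ` of an `(n + 1)`-dimensional manifold with boundary. -/
abbrev BdSpace (n : ℕ) := ModelProd (EuclideanHalfSpace 1) (EuclideanSpace ℝ (Fin n))

/-- The vector space `ℝ × ℝⁿ` containing the half space `[0, ∞) × ℝⁿ`. -/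
abbrev BdVec (n : ℕ) := EuclideanSpace ℝ (Fin 1) × EuclideanSpace ℝ (Fin n)

/-- The half space `[0, ∞) × ℝⁿ` in `ℝ × ℝⁿ`. -/
abbrev bdModel (n : ℕ) : ModelWithCorners ℝ (BdVec n) (BdSpace n) := (𝓡∂ 1).prod (𝓡 n)

section Boundary

variable {n : ℕ} {M N W V : Type*}
  [TopologicalSpace M] [ChartedSpace (EuclideanSpace ℝ (Fin n)) M]
  [TopologicalSpace N] [ChartedSpace (EuclideanSpace ℝ (Fin n)) N]
  [TopologicalSpace W] [ChartedSpace (BdSpace n) W]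
  [TopologicalSpace V] [ChartedSpace (BdSpace n) V]

/-- The tangent vector `e` at the boundary point `p` points strictly out of `W`: in the chart at
`p`, its first coordinate is negative. -/
def IsOutward (p : W) (e : TangentSpace (bdModel n) p) : Prop :=
  (mfderiv (bdModel n) 𝓘(ℝ, BdVec n) (extChartAt (bdModel n) p) p e : BdVec n).1 0 < 0

/-- `f` is a smooth embedding of the closed oriented manifold `M` into the boundary of the oriented
manifold `W`, and the orientation of `M` is the one induced from `W` by the rule
`outward normal first`. (The last condition implies that the derivative of `f` is injective.) -/
structure IsBoundaryEmbedding (oM : ManifoldOrientation (𝓡 n) M n)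
    (oW : ManifoldOrientation (bdModel n) W (n + 1)) (f : M → W) : Prop where
  contMDiff : ContMDiff (𝓡 n) (bdModel n) ∞ f
  injective : Function.Injective f
  mem_boundary : ∀ x, f x ∈ (bdModel n).boundary W
  orientation : ∀ (x : M) (θ : BdVec n [⋀^Fin (n + 1)]→ₗ[ℝ] ℝ), IsPositive (oW.at' (f x)) θ →
    ∀ e : BdVec n, IsOutward (f x) e →
      IsPositive (oM.at' x) ((θ.curryLeft e).compLinearMap
        (mfderiv (𝓡 n) (bdModel n) f x : EuclideanSpace ℝ (Fin n) →L[ℝ] BdVec n).toLinearMap)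

variable {oM : ManifoldOrientation (𝓡 n) M n} {oN : ManifoldOrientation (𝓡 n) N n}
  {oW : ManifoldOrientation (bdModel n) W (n + 1)}
  {oV : ManifoldOrientation (bdModel n) V (n + 1)}

theorem IsBoundaryEmbedding.of_isEmpty [IsEmpty M] (f : M → W) : IsBoundaryEmbedding oM oW f where
  contMDiff := fun x => isEmptyElim x
  injective := fun x => isEmptyElim x
  mem_boundary := fun x => isEmptyElim x
  orientation := fun x => isEmptyElim x

theorem IsBoundaryEmbedding.sumElim [IsManifold (𝓡 n) 1 M] [IsManifold (𝓡 n) 1 N]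
    {f : M → W} {g : N → W} (hf : IsBoundaryEmbedding oM oW f) (hg : IsBoundaryEmbedding oN oW g)
    (hfg : ∀ x y, f x ≠ g y) : IsBoundaryEmbedding (oM.sum oN) oW (Sum.elim f g) where
  contMDiff := hf.contMDiff.sumElim hg.contMDiff
  injective := hf.injective.sumElim hg.injective hfg
  mem_boundary := by
    rintro (x | x)
    exacts [hf.mem_boundary x, hg.mem_boundary x]
  orientation := by
    have hs := hf.contMDiff.sumElim hg.contMDiff
    rintro (x | x) θ hθ e he
    · have h := hf.orientation x θ hθ e he
      have e1 := mfderiv_comp_inl (I := 𝓡 n) (J := bdModel n) (Sum.elim f g) x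
        (hs.mdifferentiable (by simp) _)
      rw [Sum.elim_comp_inl] at e1
      rw [e1] at h
      exact h
    · have h := hg.orientation x θ hθ e he
      have e1 := mfderiv_comp_inr (I := 𝓡 n) (J := bdModel n) (Sum.elim f g) x
        (hs.mdifferentiable (by simp) _)
      rw [Sum.elim_comp_inr] at e1
      rw [e1] at h
      exact h

theorem isOutward_inl [IsManifold (bdModel n) 1 W] [IsManifold (bdModel n) 1 V] (p : W)
    (e : BdVec n) : IsOutward (Sum.inl p : W ⊕ V) e ↔ IsOutward p e := by
  have h := mfderiv_extChartAt_inl (I := bdModel n) (N := V) (mem_chart_source (BdSpace n) p)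
  exact iff_of_eq (congrArg (fun L : BdVec n →L[ℝ] BdVec n => (L e).1 0 < 0) h.symm)

theorem isOutward_inr [IsManifold (bdModel n) 1 W] [IsManifold (bdModel n) 1 V] (p : V)
    (e : BdVec n) : IsOutward (Sum.inr p : W ⊕ V) e ↔ IsOutward p e := by
  have h := mfderiv_extChartAt_inr (I := bdModel n) (M := W) (mem_chart_source (BdSpace n) p)
  exact iff_of_eq (congrArg (fun L : BdVec n →L[ℝ] BdVec n => (L e).1 0 < 0) h.symm)

theorem IsBoundaryEmbedding.inl [IsManifold (bdModel n) 1 W] [IsManifold (bdModel n) 1 V]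
    {f : M → W} (hf : IsBoundaryEmbedding oM oW f) :
    IsBoundaryEmbedding oM (oW.sum oV) (Sum.inl ∘ f) where
  contMDiff := ContMDiff.inl.comp hf.contMDiff
  injective := Sum.inl_injective.comp hf.injective
  mem_boundary x := by
    rw [ModelWithCorners.boundary_disjointUnion]
    exact Or.inl ⟨f x, hf.mem_boundary x, rfl⟩
  orientation x θ hθ e he := by
    have h := hf.orientation x θ hθ e ((isOutward_inl (f x) e).1 he)
    have e1 : (mfderiv (𝓡 n) (bdModel n) f x : EuclideanSpace ℝ (Fin n) →L[ℝ] BdVec n) =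
        mfderiv (𝓡 n) (bdModel n) (Sum.inl ∘ f : M → W ⊕ V) x := by
      rw [mfderiv_comp x (hasMFDerivAt_inl (p := Sum.inl (f x))).mdifferentiableAt
        (hf.contMDiff.mdifferentiable (by simp) _),
        (hasMFDerivAt_inl (p := Sum.inl (f x))).mfderiv]
      rfl
    rw [e1] at h
    exact h

theorem IsBoundaryEmbedding.inr [IsManifold (bdModel n) 1 W] [IsManifold (bdModel n) 1 V]
    {f : M → V} (hf : IsBoundaryEmbedding oM oV f) :
    IsBoundaryEmbedding oM (oW.sum oV) (Sum.inr ∘ f) where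
  contMDiff := ContMDiff.inr.comp hf.contMDiff
  injective := Sum.inr_injective.comp hf.injective
  mem_boundary x := by
    rw [ModelWithCorners.boundary_disjointUnion]
    exact Or.inr ⟨f x, hf.mem_boundary x, rfl⟩
  orientation x θ hθ e he := by
    have h := hf.orientation x θ hθ e ((isOutward_inr (f x) e).1 he)
    have e1 : (mfderiv (𝓡 n) (bdModel n) f x : EuclideanSpace ℝ (Fin n) →L[ℝ] BdVec n) =
        mfderiv (𝓡 n) (bdModel n) (Sum.inr ∘ f : M → W ⊕ V) x := by
      rw [mfderiv_comp x (hasMFDerivAt_inr (p := Sum.inr (f x))).mdifferentiableAt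
        (hf.contMDiff.mdifferentiable (by simp) _),
        (hasMFDerivAt_inr (p := Sum.inr (f x))).mfderiv]
      rfl
    rw [e1] at h
    exact h

end Boundary

section Cylinder

/-- The unit interval. -/
abbrev Itv : Type := Set.Icc (0 : ℝ) 1

/-- The derivative of the coordinate `[0, 1] → ℝ`, a linear form on the tangent line at `t`. -/
def dt (t : Itv) : EuclideanSpace ℝ (Fin 1) →ₗ[ℝ] ℝ :=
  (mfderiv (𝓡∂ 1) 𝓘(ℝ, ℝ) (Subtype.val : Itv → ℝ) t :
    EuclideanSpace ℝ (Fin 1) →L[ℝ] ℝ).toLinearMap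

theorem dt_ne_zero (t : Itv) : dt t ≠ 0 := by
  intro h
  have h1 := mfderiv_subtypeVal_Icc_one t
  have h2 : dt t (1 : TangentSpace (𝓡∂ 1) t) = (1 : ℝ) := h1
  rw [h] at h2
  exact zero_ne_one h2

/-- The sign relating the coordinate `t` to the coordinate of the preferred chart at `t₀`. -/
def chartSign (t₀ : Itv) : ℝ := if t₀.1 < 1 then 1 else -1

/-- The linear form `dt` in the preferred chart at `t₀`. -/
def chartForm (t₀ : Itv) : EuclideanSpace ℝ (Fin 1) →L[ℝ] ℝ :=
  chartSign t₀ • EuclideanSpace.proj 0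

theorem chartForm_ne_zero (t₀ : Itv) : (chartForm t₀).toLinearMap ≠ 0 := by
  intro h
  have := congrArg (fun L : EuclideanSpace ℝ (Fin 1) →ₗ[ℝ] ℝ => L (EuclideanSpace.single 0 1)) h
  simp only [chartForm, chartSign] at this
  split_ifs at this <;> simp at this

theorem dt_eq {t₀ t : Itv} (ht : t ∈ (chartAt (EuclideanHalfSpace 1) t₀).source) :
    dt t = (chartForm t₀).toLinearMap ∘ₗ
      (mfderiv (𝓡∂ 1) 𝓘(ℝ, EuclideanSpace ℝ (Fin 1)) (extChartAt (𝓡∂ 1) t₀) t :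
        EuclideanSpace ℝ (Fin 1) →L[ℝ] EuclideanSpace ℝ (Fin 1)).toLinearMap := by
  let c : ℝ := if t₀.1 < 1 then 0 else 1
  have h1 : (Subtype.val : Itv → ℝ) =
      (fun z => c + chartForm t₀ z) ∘ (extChartAt (𝓡∂ 1) t₀ : Itv → EuclideanSpace ℝ (Fin 1)) := by
    ext s
    by_cases h : t₀.1 < 1
    · have e : extChartAt (𝓡∂ 1) t₀ s 0 = s.1 - 0 := by
        rw [extChartAt, Icc_chartedSpaceChartAt_of_le_top h]
        rfl
      change s.1 = c + chartSign t₀ * extChartAt (𝓡∂ 1) t₀ s 0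
      simp only [c, chartSign, h, e, if_true]
      ring
    · have e : extChartAt (𝓡∂ 1) t₀ s 0 = 1 - s.1 := by
        rw [extChartAt, Icc_chartedSpaceChartAt_of_top_le (not_lt.1 h)]
        rfl
      change s.1 = c + chartSign t₀ * extChartAt (𝓡∂ 1) t₀ s 0
      simp only [c, chartSign, h, e, if_false]
      ring
  have h2 : HasMFDerivAt 𝓘(ℝ, EuclideanSpace ℝ (Fin 1)) 𝓘(ℝ, ℝ) (fun z => c + chartForm t₀ z)
      (extChartAt (𝓡∂ 1) t₀ t) (chartForm t₀) :=
    ((chartForm t₀).hasFDerivAt.const_add c).hasMFDerivAt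
  have h3 := (h2.comp t (mdifferentiableAt_extChartAt ht).hasMFDerivAt).mfderiv
  rw [← h1] at h3
  unfold dt
  rw [h3]
  rfl

variable {n : ℕ} {M : Type*} [TopologicalSpace M] [ChartedSpace (EuclideanSpace ℝ (Fin n)) M]

theorem mfderiv_extChartAt_prod [IsManifold (𝓡 n) 1 M] {p₀ p : Itv × M}
    (h1 : p.1 ∈ (chartAt (EuclideanHalfSpace 1) p₀.1).source)
    (h2 : p.2 ∈ (chartAt (EuclideanSpace ℝ (Fin n)) p₀.2).source) :
    (mfderiv (bdModel n) 𝓘(ℝ, BdVec n) (extChartAt (bdModel n) p₀) p : BdVec n →L[ℝ] BdVec n) =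
      (mfderiv (𝓡∂ 1) 𝓘(ℝ, EuclideanSpace ℝ (Fin 1)) (extChartAt (𝓡∂ 1) p₀.1) p.1 :
        EuclideanSpace ℝ (Fin 1) →L[ℝ] EuclideanSpace ℝ (Fin 1)).prodMap
      (mfderiv (𝓡 n) 𝓘(ℝ, EuclideanSpace ℝ (Fin n)) (extChartAt (𝓡 n) p₀.2) p.2 :
        EuclideanSpace ℝ (Fin n) →L[ℝ] EuclideanSpace ℝ (Fin n)) := by
  have h := mfderiv_prodMap (mdifferentiableAt_extChartAt (I := 𝓡∂ 1) h1)
    (mdifferentiableAt_extChartAt (I := 𝓡 n) h2)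
  rw [extChartAt_prod]
  rw [← modelWithCornersSelf_prod, chartedSpaceSelf_prod] at h
  exact h

/-- The product orientation of the cylinder `[0, 1] × M`, the interval coming first. -/
def ManifoldOrientation.cylinder [IsManifold (𝓡 n) 1 M] (o : ManifoldOrientation (𝓡 n) M n) :
    ManifoldOrientation (bdModel n) (Itv × M) (n + 1) where
  at' := fun p => prodOrientation (dt p.1) (dt_ne_zero p.1) (o.at' p.2)
  locallyConstant := by
    rintro ⟨t₀, x₀⟩
    obtain ⟨b, hb⟩ := o.locallyConstant x₀
    refine ⟨prodOrientation (chartForm t₀).toLinearMap (chartForm_ne_zero t₀) b, ?_⟩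
    have h1 := (chartAt (EuclideanHalfSpace 1) t₀).open_source.mem_nhds (mem_chart_source _ t₀)
    have h2 := (chartAt (EuclideanSpace ℝ (Fin n)) x₀).open_source.mem_nhds (mem_chart_source _ x₀)
    have h3 := Filter.prod_mem_prod h1 (Filter.inter_mem hb h2)
    rw [← nhds_prod_eq] at h3
    filter_upwards [h3] with p hp
    rw [mfderiv_extChartAt_prod hp.1 hp.2.2]
    exact LinPreserves.prodMap _ _ (dt_eq hp.1).symm hp.2.1

theorem dt_pos_of_isOutward_one [IsManifold (𝓡 n) 1 M] (x : M) (e : BdVec n)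
    (he : IsOutward ((1, x) : Itv × M) e) : 0 < dt 1 e.1 := by
  unfold IsOutward at he
  have h1 := mfderiv_extChartAt_prod (n := n) (p₀ := ((1, x) : Itv × M)) (p := (1, x))
    (mem_chart_source _ _) (mem_chart_source _ _)
  have h2 := congrArg (fun L : BdVec n →L[ℝ] BdVec n => (L e).1 0) h1
  have h3 : (EuclideanSpace.proj 0 : EuclideanSpace ℝ (Fin 1) →L[ℝ] ℝ)
    (mfderiv (𝓡∂ 1) 𝓘(ℝ, EuclideanSpace ℝ (Fin 1)) (extChartAt (𝓡∂ 1) (1 : Itv)) 1 e.1) < 0 := lt_of_eq_of_lt h2.symm he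
  have h4 : chartSign 1 = -1 := by simp [chartSign]
  rw [dt_eq (mem_chart_source _ _)]
  change 0 < chartSign 1 * _
  rw [h4]
  exact mul_pos_of_neg_of_neg (by norm_num) h3

theorem dt_neg_of_isOutward_zero [IsManifold (𝓡 n) 1 M] (x : M) (e : BdVec n)
    (he : IsOutward ((0, x) : Itv × M) e) : dt 0 e.1 < 0 := by
  unfold IsOutward at he
  have h1 := mfderiv_extChartAt_prod (n := n) (p₀ := ((0, x) : Itv × M)) (p := (0, x))
    (mem_chart_source _ _) (mem_chart_source _ _)
  have h2 := congrArg (fun L : BdVec n →L[ℝ] BdVec n => (L e).1 0) h1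
  have h3 : (EuclideanSpace.proj 0 : EuclideanSpace ℝ (Fin 1) →L[ℝ] ℝ)
    (mfderiv (𝓡∂ 1) 𝓘(ℝ, EuclideanSpace ℝ (Fin 1)) (extChartAt (𝓡∂ 1) (0 : Itv)) 0 e.1) < 0 := lt_of_eq_of_lt h2.symm he
  have h4 : chartSign 0 = 1 := by simp [chartSign]
  rw [dt_eq (mem_chart_source _ _)]
  change chartSign 0 * _ < 0
  rw [h4]
  exact mul_neg_of_pos_of_neg one_pos h3

theorem boundary_cylinder : (bdModel n).boundary (Itv × M) = {p | p.1 = 0 ∨ p.1 = 1} := by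
  rw [ModelWithCorners.boundary_of_boundaryless_right, boundary_Icc]
  ext p
  exact ⟨fun h => h.1, fun h => ⟨h, trivial⟩⟩

theorem cylinder_curryLeft {o : ManifoldOrientation (𝓡 n) M n} [IsManifold (𝓡 n) 1 M] (t : Itv)
    (x : M) (θ : BdVec n [⋀^Fin (n + 1)]→ₗ[ℝ] ℝ) (hθ : IsPositive (o.cylinder.at' (t, x)) θ)
    (e : BdVec n) : ∃ η, IsPositive (o.at' x) η ∧ (θ.curryLeft e).compLinearMap
      (mfderiv (𝓡 n) (bdModel n) (fun y : M => ((t, y) : Itv × M)) x :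
        EuclideanSpace ℝ (Fin n) →L[ℝ] BdVec n).toLinearMap = dt t e.1 • η := by
  obtain ⟨η, hη, rfl⟩ := (isPositive_prodOrientation_iff (dt_ne_zero t)).1 hθ
  refine ⟨η, hη, ?_⟩
  rw [mfderiv_prod_right]
  exact wedge_curryLeft_inr _ _ _

theorem IsBoundaryEmbedding.one [IsManifold (𝓡 n) 1 M] (o : ManifoldOrientation (𝓡 n) M n) :
    IsBoundaryEmbedding o o.cylinder (fun x : M => ((1, x) : Itv × M)) where
  contMDiff := contMDiff_const.prodMk contMDiff_id
  injective := fun x y h => congrArg Prod.snd h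
  mem_boundary x := by
    rw [boundary_cylinder]
    exact Or.inr rfl
  orientation x θ hθ e he := by
    obtain ⟨η, hη, h⟩ := cylinder_curryLeft 1 x θ hθ e
    rw [h]
    exact hη.smul (dt_pos_of_isOutward_one x e he)

theorem IsBoundaryEmbedding.zero [IsManifold (𝓡 n) 1 M] (o : ManifoldOrientation (𝓡 n) M n) :
    IsBoundaryEmbedding (-o) o.cylinder (fun x : M => ((0, x) : Itv × M)) where
  contMDiff := contMDiff_const.prodMk contMDiff_id
  injective := fun x y h => congrArg Prod.snd h
  mem_boundary x := by
    rw [boundary_cylinder]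
    exact Or.inl rfl
  orientation x θ hθ e he := by
    obtain ⟨η, hη, h⟩ := cylinder_curryLeft 0 x θ hθ e
    rw [h, ManifoldOrientation.neg_at, isPositive_neg]
    refine Eq.subst (motive := IsPositive (o.at' x)) (neg_smul (dt 0 e.1) η) ?_
    exact hη.smul (neg_pos.2 (dt_neg_of_isOutward_zero x e he))

end Cylinder

/-! ### `X`-manifolds and `X`-diffeomorphisms -/

/-- An `n`-dimensional `X`-manifold: a closed oriented smooth manifold with one base point in each
connected component, and a continuous map to `X` sending the base points to `pt`. -/
structure XManifold (n : ℕ) (X : Type v) [TopologicalSpace X] (pt : X) where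
  carrier : Type u
  [top : TopologicalSpace carrier]
  [t2 : T2Space carrier]
  [compact : CompactSpace carrier]
  [charted : ChartedSpace (EuclideanSpace ℝ (Fin n)) carrier]
  [smooth : IsManifold (𝓡 n) ∞ carrier]
  orientation : ManifoldOrientation (𝓡 n) carrier n
  basePoints : Set carrier
  existsUnique_basePoint : ∀ x, ∃! b, b ∈ basePoints ∧ b ∈ connectedComponent x
  charMap : C(carrier, X)
  charMap_basePoint : ∀ b ∈ basePoints, charMap b = pt

attribute [instance] XManifold.top XManifold.t2 XManifold.compact XManifold.charted
  XManifold.smooth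

section Objects

variable {n : ℕ} {X : Type v} [TopologicalSpace X] {pt : X}

theorem existsUnique_basePoint_inl {A B : Type*} [TopologicalSpace A] [TopologicalSpace B]
    {S : Set A} {T : Set B} {x : A} (h : ∃! b, b ∈ S ∧ b ∈ connectedComponent x) :
    ∃! b, b ∈ (Sum.inl '' S ∪ Sum.inr '' T : Set (A ⊕ B)) ∧
      b ∈ connectedComponent (Sum.inl x : A ⊕ B) := by
  obtain ⟨b, ⟨hb, hb'⟩, hu⟩ := h
  have hsub : connectedComponent (Sum.inl x : A ⊕ B) ⊆ Set.range Sum.inl :=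
    isClopen_range_inl.connectedComponent_subset ⟨x, rfl⟩
  refine ⟨Sum.inl b, ⟨Or.inl ⟨b, hb, rfl⟩,
    continuous_inl.image_connectedComponent_subset x ⟨b, hb', rfl⟩⟩, ?_⟩
  rintro c ⟨hc, hc'⟩
  obtain ⟨a, rfl⟩ := hsub hc'
  have ha : a ∈ S := by simpa using hc
  have hpre : IsPreconnected (Sum.inl ⁻¹' connectedComponent (Sum.inl x : A ⊕ B)) :=
    isPreconnected_connectedComponent.preimage_of_isOpenMap Sum.inl_injective isOpenMap_inl hsub
  rw [hu a ⟨ha, hpre.subset_connectedComponent mem_connectedComponent hc'⟩]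

theorem existsUnique_basePoint_inr {A B : Type*} [TopologicalSpace A] [TopologicalSpace B]
    {S : Set A} {T : Set B} {x : B} (h : ∃! b, b ∈ T ∧ b ∈ connectedComponent x) :
    ∃! b, b ∈ (Sum.inl '' S ∪ Sum.inr '' T : Set (A ⊕ B)) ∧
      b ∈ connectedComponent (Sum.inr x : A ⊕ B) := by
  obtain ⟨b, ⟨hb, hb'⟩, hu⟩ := h
  have hsub : connectedComponent (Sum.inr x : A ⊕ B) ⊆ Set.range Sum.inr :=
    isClopen_range_inr.connectedComponent_subset ⟨x, rfl⟩
  refine ⟨Sum.inr b, ⟨Or.inr ⟨b, hb, rfl⟩,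
    continuous_inr.image_connectedComponent_subset x ⟨b, hb', rfl⟩⟩, ?_⟩
  rintro c ⟨hc, hc'⟩
  obtain ⟨a, rfl⟩ := hsub hc'
  have ha : a ∈ T := by simpa using hc
  have hpre : IsPreconnected (Sum.inr ⁻¹' connectedComponent (Sum.inr x : A ⊕ B)) :=
    isPreconnected_connectedComponent.preimage_of_isOpenMap Sum.inr_injective isOpenMap_inr hsub
  rw [hu a ⟨ha, hpre.subset_connectedComponent mem_connectedComponent hc'⟩]

namespace XManifold

/-- The map `g ⨿ h` on a disjoint union. -/
def sumMap {A B : Type*} [TopologicalSpace A] [TopologicalSpace B] (f : C(A, X)) (g : C(B, X)) :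
    C(A ⊕ B, X) :=
  ⟨Sum.elim f g, f.continuous.sumElim g.continuous⟩

/-- The disjoint union of `X`-manifolds. -/
def sum (M N : XManifold.{u} n X pt) : XManifold.{u} n X pt where
  carrier := M.carrier ⊕ N.carrier
  orientation := M.orientation.sum N.orientation
  basePoints := Sum.inl '' M.basePoints ∪ Sum.inr '' N.basePoints
  existsUnique_basePoint := by
    rintro (x | x)
    exacts [existsUnique_basePoint_inl (M.existsUnique_basePoint x),
      existsUnique_basePoint_inr (N.existsUnique_basePoint x)]
  charMap := sumMap M.charMap N.charMap
  charMap_basePoint := by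
    rintro b (⟨b, hb, rfl⟩ | ⟨b, hb, rfl⟩)
    exacts [M.charMap_basePoint b hb, N.charMap_basePoint b hb]

/-- The empty `X`-manifold. -/
def empty (n : ℕ) (X : Type v) [TopologicalSpace X] (pt : X) : XManifold.{u} n X pt :=
  letI : ChartedSpace (EuclideanSpace ℝ (Fin n)) PEmpty.{u + 1} := ChartedSpace.empty _ _
  { carrier := PEmpty.{u + 1}
    smooth := IsManifold.empty _
    orientation := ManifoldOrientation.empty
    basePoints := ∅
    existsUnique_basePoint := fun x => isEmptyElim x
    charMap := ⟨fun x => isEmptyElim x, continuous_of_discreteTopology⟩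
    charMap_basePoint := fun b => isEmptyElim b }

instance : IsEmpty (empty.{u} n X pt).carrier := inferInstanceAs (IsEmpty PEmpty.{u + 1})

/-- The dual `(-M, g)` of the `X`-manifold `(M, g)`: the orientation is reversed. -/
def dual (M : XManifold.{u} n X pt) : XManifold.{u} n X pt :=
  { M with orientation := -M.orientation }

theorem dual_dual (M : XManifold.{u} n X pt) : M.dual.dual = M := by
  unfold dual
  cases M
  simp [ManifoldOrientation.neg_neg]

theorem dual_sum (M N : XManifold.{u} n X pt) : (M.sum N).dual = M.dual.sum N.dual := by
  unfold dual sum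
  congr 1
  exact ManifoldOrientation.neg_sum _ _

theorem dual_eq_of_isEmpty (M : XManifold.{u} n X pt) [IsEmpty M.carrier] : M.dual = M := by
  have h := ManifoldOrientation.eq_of_isEmpty (-M.orientation) M.orientation
  unfold dual
  rw [h]

theorem dual_empty : (empty.{u} n X pt).dual = empty n X pt :=
  dual_eq_of_isEmpty _

end XManifold

/-- An `X`-diffeomorphism `(M, g) → (N, h)`: an orientation preserving diffeomorphism taking base
points to base points and compatible with the maps to `X`. -/
structure XDiffeo (M N : XManifold.{u} n X pt) where
  toDiffeo : M.carrier ≃ₘ^∞⟮𝓡 n, 𝓡 n⟯ N.carrier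
  orientation : PreservesOrientation M.orientation N.orientation toDiffeo
  basePoints : ∀ b ∈ M.basePoints, toDiffeo b ∈ N.basePoints
  charMap : ∀ x, N.charMap (toDiffeo x) = M.charMap x

namespace XDiffeo

variable {M N P Q M' N' : XManifold.{u} n X pt}

theorem ext {φ ψ : XDiffeo M N} (h : ∀ x, φ.toDiffeo x = ψ.toDiffeo x) : φ = ψ := by
  cases φ
  cases ψ
  congr
  exact Diffeomorph.ext h

/-- The identity. -/
def refl (M : XManifold.{u} n X pt) : XDiffeo M M where
  toDiffeo := Diffeomorph.refl _ _ _
  orientation := PreservesOrientation.id _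
  basePoints := fun _ hb => hb
  charMap := fun _ => rfl

/-- Composition, in diagrammatic order. -/
def trans (φ : XDiffeo M N) (ψ : XDiffeo N P) : XDiffeo M P where
  toDiffeo := φ.toDiffeo.trans ψ.toDiffeo
  orientation := ψ.orientation.comp φ.orientation ψ.toDiffeo.contMDiff φ.toDiffeo.contMDiff
  basePoints := fun b hb => ψ.basePoints _ (φ.basePoints b hb)
  charMap := fun x => (ψ.charMap _).trans (φ.charMap x)

/-- The inverse. -/
def symm (φ : XDiffeo M N) : XDiffeo N M where
  toDiffeo := φ.toDiffeo.symm
  orientation := φ.orientation.symm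
  basePoints := by
    intro c hc
    obtain ⟨b, ⟨hb, hb'⟩, -⟩ := M.existsUnique_basePoint (φ.toDiffeo.symm c)
    have h1 : φ.toDiffeo b ∈ connectedComponent c := by
      have := φ.toDiffeo.continuous.image_connectedComponent_subset _ ⟨b, hb', rfl⟩
      rwa [φ.toDiffeo.apply_symm_apply] at this
    have h2 : φ.toDiffeo b = c :=
      (N.existsUnique_basePoint c).unique ⟨φ.basePoints b hb, h1⟩ ⟨hc, mem_connectedComponent⟩
    rw [← h2, φ.toDiffeo.symm_apply_apply]
    exact hb
  charMap := fun y => by rw [← φ.charMap, φ.toDiffeo.apply_symm_apply]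

/-- The disjoint union. -/
def sum (φ : XDiffeo M N) (ψ : XDiffeo M' N') : XDiffeo (M.sum M') (N.sum N') where
  toDiffeo := φ.toDiffeo.sumCongr ψ.toDiffeo
  orientation := φ.orientation.sumMap φ.toDiffeo.contMDiff ψ.toDiffeo.contMDiff ψ.orientation
  basePoints := by
    rintro b (⟨b, hb, rfl⟩ | ⟨b, hb, rfl⟩)
    exacts [Or.inl ⟨_, φ.basePoints b hb, rfl⟩, Or.inr ⟨_, ψ.basePoints b hb, rfl⟩]
  charMap := by
    rintro (x | x)
    exacts [φ.charMap x, ψ.charMap x]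

/-- The diffeomorphism `ψ₋ : -M → -N` given by `ψ : M → N`. -/
def neg (φ : XDiffeo M N) : XDiffeo M.dual N.dual where
  toDiffeo := φ.toDiffeo
  orientation := φ.orientation.neg
  basePoints := φ.basePoints
  charMap := φ.charMap

/-- The associator of the disjoint union. -/
def assoc (M N P : XManifold.{u} n X pt) : XDiffeo ((M.sum N).sum P) (M.sum (N.sum P)) where
  toDiffeo := Diffeomorph.sumAssoc (𝓡 n) M.carrier ∞ N.carrier P.carrier
  orientation := by
    have hc := (Diffeomorph.sumAssoc (𝓡 n) M.carrier ∞ N.carrier P.carrier).contMDiff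
    refine .of_inl_inr (oM := M.orientation.sum N.orientation) (oN := P.orientation) hc
      (.of_inl_inr (hc.comp ContMDiff.inl) ?_ ?_) ?_
    · exact PreservesOrientation.inl _ _
    · exact (PreservesOrientation.inr M.orientation (N.orientation.sum P.orientation)).comp
        (PreservesOrientation.inl _ _) ContMDiff.inr ContMDiff.inl
    · exact (PreservesOrientation.inr M.orientation (N.orientation.sum P.orientation)).comp
        (PreservesOrientation.inr _ _) ContMDiff.inr ContMDiff.inr
  basePoints := by
    rintro b (⟨b, (⟨b, hb, rfl⟩ | ⟨b, hb, rfl⟩), rfl⟩ | ⟨b, hb, rfl⟩)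
    exacts [Or.inl ⟨b, hb, rfl⟩, Or.inr ⟨_, Or.inl ⟨b, hb, rfl⟩, rfl⟩,
      Or.inr ⟨_, Or.inr ⟨b, hb, rfl⟩, rfl⟩]
  charMap := by rintro ((x | x) | x) <;> rfl

/-- The symmetry of the disjoint union. -/
def swap (M N : XManifold.{u} n X pt) : XDiffeo (M.sum N) (N.sum M) where
  toDiffeo := Diffeomorph.sumComm (𝓡 n) M.carrier ∞ N.carrier
  orientation := .of_inl_inr (Diffeomorph.contMDiff _) (PreservesOrientation.inr _ _)
    (PreservesOrientation.inl _ _)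
  basePoints := by
    rintro b (⟨b, hb, rfl⟩ | ⟨b, hb, rfl⟩)
    exacts [Or.inr ⟨b, hb, rfl⟩, Or.inl ⟨b, hb, rfl⟩]
  charMap := by rintro (x | x) <;> rfl

/-- The right unit isomorphism `M ⨿ ∅ → M`. -/
def sumEmpty (M : XManifold.{u} n X pt) : XDiffeo (M.sum (XManifold.empty n X pt)) M where
  toDiffeo := Diffeomorph.sumEmpty (𝓡 n) M.carrier ∞
  orientation := .of_inl_inr (Diffeomorph.contMDiff _) (PreservesOrientation.id _)
    (fun x => isEmptyElim x)
  basePoints := by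
    rintro b (⟨b, hb, rfl⟩ | ⟨b, hb, rfl⟩)
    exacts [hb, isEmptyElim b]
  charMap := by
    rintro (x | x)
    exacts [rfl, isEmptyElim x]

/-- The left unit isomorphism `∅ ⨿ M → M`. -/
def emptySum (M : XManifold.{u} n X pt) : XDiffeo ((XManifold.empty n X pt).sum M) M :=
  (swap _ _).trans (sumEmpty M)

end XDiffeo

/-! ### `X`-cobordisms -/

/-- An `X`-cobordism `(W, F) : (M, g) → (N, h)`: a compact oriented smooth manifold `W` of dimension
`n + 1` whose oriented boundary is identified with `-M ⨿ N`, and a continuous map `F : W → X`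
extending `g` and `h`. Only the homotopy class of `F` relative to the boundary matters: maps in the
same class are identified by `XCobordism.Diffeo` below. -/
structure XCobordism (M N : XManifold.{u} n X pt) where
  carrier : Type u
  [top : TopologicalSpace carrier]
  [t2 : T2Space carrier]
  [compact : CompactSpace carrier]
  [charted : ChartedSpace (BdSpace n) carrier]
  [smooth : IsManifold (bdModel n) ∞ carrier]
  orientation : ManifoldOrientation (bdModel n) carrier (n + 1)
  inMap : M.carrier → carrier
  outMap : N.carrier → carrier
  inMap_embedding : IsBoundaryEmbedding (-M.orientation) orientation inMap
  outMap_embedding : IsBoundaryEmbedding N.orientation orientation outMap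
  inMap_ne_outMap : ∀ x y, inMap x ≠ outMap y
  boundary_subset : (bdModel n).boundary carrier ⊆ Set.range inMap ∪ Set.range outMap
  charMap : C(carrier, X)
  charMap_inMap : ∀ x, charMap (inMap x) = M.charMap x
  charMap_outMap : ∀ y, charMap (outMap y) = N.charMap y

attribute [instance] XCobordism.top XCobordism.t2 XCobordism.compact XCobordism.charted
  XCobordism.smooth

namespace XCobordism

variable {M N P M' N' : XManifold.{u} n X pt}

/-- The disjoint union of `X`-cobordisms. -/
def sum (W : XCobordism M N) (V : XCobordism M' N') : XCobordism (M.sum M') (N.sum N') where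
  carrier := W.carrier ⊕ V.carrier
  orientation := W.orientation.sum V.orientation
  inMap := Sum.map W.inMap V.inMap
  outMap := Sum.map W.outMap V.outMap
  inMap_embedding := by
    have h := IsBoundaryEmbedding.sumElim (W.inMap_embedding.inl (oV := V.orientation))
      (V.inMap_embedding.inr (oW := W.orientation)) (by simp)
    rw [← ManifoldOrientation.neg_sum] at h
    exact h
  outMap_embedding := IsBoundaryEmbedding.sumElim (W.outMap_embedding.inl (oV := V.orientation))
      (V.outMap_embedding.inr (oW := W.orientation)) (by simp)
  inMap_ne_outMap := by
    rintro (x | x) (y | y) h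
    · exact W.inMap_ne_outMap x y (Sum.inl_injective h)
    · cases h
    · cases h
    · exact V.inMap_ne_outMap x y (Sum.inr_injective h)
  boundary_subset := by
    rw [ModelWithCorners.boundary_disjointUnion]
    rintro p (⟨p, hp, rfl⟩ | ⟨p, hp, rfl⟩)
    · rcases W.boundary_subset hp with ⟨x, rfl⟩ | ⟨x, rfl⟩
      exacts [Or.inl ⟨Sum.inl x, rfl⟩, Or.inr ⟨Sum.inl x, rfl⟩]
    · rcases V.boundary_subset hp with ⟨x, rfl⟩ | ⟨x, rfl⟩
      exacts [Or.inl ⟨Sum.inr x, rfl⟩, Or.inr ⟨Sum.inr x, rfl⟩]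
  charMap := XManifold.sumMap W.charMap V.charMap
  charMap_inMap := by
    rintro (x | x)
    exacts [W.charMap_inMap x, V.charMap_inMap x]
  charMap_outMap := by
    rintro (x | x)
    exacts [W.charMap_outMap x, V.charMap_outMap x]

/-- The map `(t, x) ↦ g x` on a cylinder. -/
def cylinderMap (M : XManifold.{u} n X pt) : C(Itv × M.carrier, X) :=
  ⟨fun p => M.charMap p.2, M.charMap.continuous.comp continuous_snd⟩

/-- The identity `X`-cobordism `([0, 1] × M, 1_g) : (M, g) → (M, g)`. -/
def cylinder (M : XManifold.{u} n X pt) : XCobordism M M where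
  carrier := Itv × M.carrier
  orientation := M.orientation.cylinder
  inMap := fun x => (0, x)
  outMap := fun x => (1, x)
  inMap_embedding := .zero _
  outMap_embedding := .one _
  inMap_ne_outMap := fun _ _ h => zero_ne_one (congrArg Prod.fst h)
  boundary_subset := by
    rw [boundary_cylinder]
    rintro ⟨t, x⟩ (h | h)
    exacts [Or.inl ⟨x, Prod.ext h.symm rfl⟩, Or.inr ⟨x, Prod.ext h.symm rfl⟩]
  charMap := cylinderMap M
  charMap_inMap := fun _ => rfl
  charMap_outMap := fun _ => rfl

/-- The cylinder `([0, 1] × M, 1_g)` as an `X`-cobordism `∅ → (M, g) ⨿ (M, g)^*`. -/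
def unit (M : XManifold.{u} n X pt) : XCobordism (XManifold.empty n X pt) (M.sum M.dual) where
  carrier := Itv × M.carrier
  orientation := M.orientation.cylinder
  inMap := fun x => isEmptyElim x
  outMap := Sum.elim (fun x => (1, x)) (fun x => (0, x))
  inMap_embedding := .of_isEmpty _
  outMap_embedding := IsBoundaryEmbedding.sumElim (oN := -M.orientation) (.one _) (.zero _)
    (fun _ _ h => one_ne_zero (congrArg Prod.fst h))
  inMap_ne_outMap := fun x => isEmptyElim x
  boundary_subset := by
    rw [boundary_cylinder]
    rintro ⟨t, x⟩ (h | h)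
    exacts [Or.inr ⟨Sum.inr x, Prod.ext h.symm rfl⟩, Or.inr ⟨Sum.inl x, Prod.ext h.symm rfl⟩]
  charMap := cylinderMap M
  charMap_inMap := fun x => isEmptyElim x
  charMap_outMap := by rintro (x | x) <;> rfl

/-- The cylinder `([0, 1] × M, 1_g)` as an `X`-cobordism `(M, g)^* ⨿ (M, g) → ∅`. -/
def counit (M : XManifold.{u} n X pt) : XCobordism (M.dual.sum M) (XManifold.empty n X pt) where
  carrier := Itv × M.carrier
  orientation := M.orientation.cylinder
  inMap := Sum.elim (fun x => (1, x)) (fun x => (0, x))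
  outMap := fun x => isEmptyElim x
  inMap_embedding := by
    have h := IsBoundaryEmbedding.sumElim (IsBoundaryEmbedding.one M.orientation)
      (IsBoundaryEmbedding.zero M.orientation) (fun _ _ h => one_ne_zero (congrArg Prod.fst h))
    have e : -((M.dual.sum M).orientation) = M.orientation.sum (-M.orientation) := by
      refine (ManifoldOrientation.neg_sum (-M.orientation) M.orientation).trans ?_
      rw [ManifoldOrientation.neg_neg]
    exact e ▸ h
  outMap_embedding := .of_isEmpty _
  inMap_ne_outMap := fun _ y => isEmptyElim y
  boundary_subset := by
    rw [boundary_cylinder]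
    rintro ⟨t, x⟩ (h | h)
    exacts [Or.inl ⟨Sum.inr x, Prod.ext h.symm rfl⟩, Or.inl ⟨Sum.inl x, Prod.ext h.symm rfl⟩]
  charMap := cylinderMap M
  charMap_inMap := by rintro (x | x) <;> rfl
  charMap_outMap := fun x => isEmptyElim x

/-- The same `X`-cobordism `(W, F) : M → N`, viewed as an `X`-cobordism `N^* → M^*`. -/
def reverse (W : XCobordism M N) : XCobordism N.dual M.dual where
  carrier := W.carrier
  orientation := W.orientation
  inMap := W.outMap
  outMap := W.inMap
  inMap_embedding := by
    have h : -N.dual.orientation = N.orientation := ManifoldOrientation.neg_neg _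
    exact h ▸ W.outMap_embedding
  outMap_embedding := W.inMap_embedding
  inMap_ne_outMap := fun x y h => W.inMap_ne_outMap y x h.symm
  boundary_subset := fun p hp => (W.boundary_subset hp).symm
  charMap := W.charMap
  charMap_inMap := W.charMap_outMap
  charMap_outMap := W.charMap_inMap

/-- An `X`-diffeomorphism `(W, F) → (V, G)` of `X`-cobordisms: an orientation preserving
diffeomorphism `Ψ` of `W` onto `V` which restricts to `X`-diffeomorphisms of the incoming and of the
outgoing boundary, such that `F` and `G ∘ Ψ` are homotopic relative to the boundary. -/
structure Diffeo (W : XCobordism M N) (V : XCobordism M' N') where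
  toDiffeo : W.carrier ≃ₘ^∞⟮bdModel n, bdModel n⟯ V.carrier
  orientation : PreservesOrientation W.orientation V.orientation toDiffeo
  inDiffeo : XDiffeo M M'
  outDiffeo : XDiffeo N N'
  comm_in : ∀ x, toDiffeo (W.inMap x) = V.inMap (inDiffeo.toDiffeo x)
  comm_out : ∀ y, toDiffeo (W.outMap y) = V.outMap (outDiffeo.toDiffeo y)
  homotopic : W.charMap.HomotopicRel (V.charMap.comp ⟨toDiffeo, toDiffeo.continuous⟩)
    ((bdModel n).boundary W.carrier)

/-- `U` is a gluing `(W, F) ⨿_ψ (V, G)` of `(W, F) : M → N` and `(V, G) : N' → P` along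
`ψ : N → N'`: it is the union of a copy of `W` and of a copy of `V`, smoothly embedded with their
orientations, which meet exactly in the points of `N` and `N'` identified by `ψ`, and its map to `X`
is `F` on `W` and `G` on `V`. (The smooth structure of a gluing is only determined up to
diffeomorphism.) -/
structure Gluing (W : XCobordism M N) (ψ : XDiffeo N N') (V : XCobordism N' P)
    (U : XCobordism M P) where
  left : W.carrier → U.carrier
  right : V.carrier → U.carrier
  contMDiff_left : ContMDiff (bdModel n) (bdModel n) ∞ left
  contMDiff_right : ContMDiff (bdModel n) (bdModel n) ∞ right
  injective_left : Function.Injective left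
  injective_right : Function.Injective right
  orientation_left : PreservesOrientation W.orientation U.orientation left
  orientation_right : PreservesOrientation V.orientation U.orientation right
  cover : ∀ p, p ∈ Set.range left ∨ p ∈ Set.range right
  left_eq_right_iff : ∀ w v, left w = right v ↔
    ∃ y, w = W.outMap y ∧ v = V.inMap (ψ.toDiffeo y)
  left_inMap : ∀ x, left (W.inMap x) = U.inMap x
  right_outMap : ∀ z, right (V.outMap z) = U.outMap z
  charMap_left : ∀ w, U.charMap (left w) = W.charMap w
  charMap_right : ∀ v, U.charMap (right v) = V.charMap v

end XCobordism

end Objects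

end Geometry

open CategoryTheory MonoidalCategory

/-! ### The category of homotopy cobordisms -/

section Category

variable {n : ℕ} {X : Type v} [TopologicalSpace X] {pt : X}

/-- Formal composites and disjoint unions of `X`-diffeomorphisms and `X`-cobordisms. -/
inductive FormalMor : XManifold.{u} n X pt → XManifold.{u} n X pt → Type (max (u + 1) v)
  | diffeo {M N : XManifold.{u} n X pt} (ψ : XDiffeo M N) : FormalMor M N
  | cob {M N : XManifold.{u} n X pt} (W : XCobordism M N) : FormalMor M N
  | comp {M N P : XManifold.{u} n X pt} (f : FormalMor M N) (g : FormalMor N P) : FormalMor M P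
  | tensor {M N M' N' : XManifold.{u} n X pt} (f : FormalMor M N) (g : FormalMor M' N') :
      FormalMor (M.sum M') (N.sum N')

open FormalMor in
/-- The monoidal congruence on formal composites generated by: the axioms of a category; the
functoriality of composition and disjoint union of `X`-diffeomorphisms; the disjoint union of
`X`-cobordisms; the naturality of the associativity, unit and symmetry `X`-diffeomorphisms; and the
three geometric relations `cob_diffeo`, `gluing` and `cylinder`. -/
inductive FormalRel : ∀ {M N : XManifold.{u} n X pt}, FormalMor M N → FormalMor M N → Prop
  | refl {M N : XManifold.{u} n X pt} (f : FormalMor M N) : FormalRel f f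
  | symm {M N : XManifold.{u} n X pt} {f g : FormalMor M N} :
      FormalRel f g → FormalRel g f
  | trans {M N : XManifold.{u} n X pt} {f g h : FormalMor M N} :
      FormalRel f g → FormalRel g h → FormalRel f h
  | comp_congr {M N P : XManifold.{u} n X pt} {f f' : FormalMor M N} {g g' : FormalMor N P} :
      FormalRel f f' → FormalRel g g' → FormalRel (comp f g) (comp f' g')
  | tensor_congr {M N M' N' : XManifold.{u} n X pt} {f f' : FormalMor M N}
      {g g' : FormalMor M' N'} :
      FormalRel f f' → FormalRel g g' → FormalRel (tensor f g) (tensor f' g')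
  | assoc {M N P Q : XManifold.{u} n X pt} (f : FormalMor M N) (g : FormalMor N P)
      (h : FormalMor P Q) : FormalRel (comp (comp f g) h) (comp f (comp g h))
  | id_comp {M N : XManifold.{u} n X pt} (f : FormalMor M N) :
      FormalRel (comp (diffeo (XDiffeo.refl M)) f) f
  | comp_id {M N : XManifold.{u} n X pt} (f : FormalMor M N) :
      FormalRel (comp f (diffeo (XDiffeo.refl N))) f
  | interchange {M N P M' N' P' : XManifold.{u} n X pt} (f : FormalMor M N) (g : FormalMor N P)
      (f' : FormalMor M' N') (g' : FormalMor N' P') :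
      FormalRel (comp (tensor f f') (tensor g g')) (tensor (comp f g) (comp f' g'))
  | diffeo_comp {M N P : XManifold.{u} n X pt} (ψ : XDiffeo M N) (φ : XDiffeo N P) :
      FormalRel (comp (diffeo ψ) (diffeo φ)) (diffeo (ψ.trans φ))
  | diffeo_tensor {M N M' N' : XManifold.{u} n X pt} (ψ : XDiffeo M N) (φ : XDiffeo M' N') :
      FormalRel (tensor (diffeo ψ) (diffeo φ)) (diffeo (ψ.sum φ))
  | cob_tensor {M N M' N' : XManifold.{u} n X pt} (W : XCobordism M N) (V : XCobordism M' N') :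
      FormalRel (tensor (cob W) (cob V)) (cob (W.sum V))
  | assoc_naturality {M N M' N' M'' N'' : XManifold.{u} n X pt} (f : FormalMor M N)
      (f' : FormalMor M' N') (f'' : FormalMor M'' N'') :
      FormalRel (comp (tensor (tensor f f') f'') (diffeo (XDiffeo.assoc N N' N'')))
        (comp (diffeo (XDiffeo.assoc M M' M'')) (tensor f (tensor f' f'')))
  | emptySum_naturality {M N : XManifold.{u} n X pt} (f : FormalMor M N) :
      FormalRel (comp (tensor (diffeo (XDiffeo.refl (XManifold.empty n X pt))) f)
        (diffeo (XDiffeo.emptySum N))) (comp (diffeo (XDiffeo.emptySum M)) f)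
  | sumEmpty_naturality {M N : XManifold.{u} n X pt} (f : FormalMor M N) :
      FormalRel (comp (tensor f (diffeo (XDiffeo.refl (XManifold.empty n X pt))))
        (diffeo (XDiffeo.sumEmpty N))) (comp (diffeo (XDiffeo.sumEmpty M)) f)
  | swap_naturality {M N M' N' : XManifold.{u} n X pt} (f : FormalMor M N)
      (f' : FormalMor M' N') :
      FormalRel (comp (tensor f f') (diffeo (XDiffeo.swap N N')))
        (comp (diffeo (XDiffeo.swap M M')) (tensor f' f))
  | cob_diffeo {M N M' N' : XManifold.{u} n X pt} {W : XCobordism M N} {V : XCobordism M' N'}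
      (Ψ : W.Diffeo V) :
      FormalRel (comp (cob W) (diffeo Ψ.outDiffeo)) (comp (diffeo Ψ.inDiffeo) (cob V))
  | gluing {M N N' P : XManifold.{u} n X pt} {W : XCobordism M N} {ψ : XDiffeo N N'}
      {V : XCobordism N' P} {U : XCobordism M P} (G : W.Gluing ψ V U) :
      FormalRel (cob U) (comp (cob W) (comp (diffeo ψ) (cob V)))
  | cylinder (M : XManifold.{u} n X pt) :
      FormalRel (cob (XCobordism.cylinder M)) (diffeo (XDiffeo.refl M))

/-- The congruence as a setoid. -/
def formalSetoid (M N : XManifold.{u} n X pt) : Setoid (FormalMor M N) where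
  r := FormalRel
  iseqv := ⟨.refl, .symm, .trans⟩

variable (n X pt) in
/-- The category of homotopy cobordisms `HCobord(n, X)`: its objects are the `X`-manifolds and its
morphisms are the formal composites of `X`-diffeomorphisms and `X`-cobordisms, modulo the
congruence above. Composition is written in diagrammatic order. -/
abbrev HCobord : Type (max (u + 1) v) := XManifold.{u} n X pt

namespace HCobord

instance category : Category.{max (u + 1) v} (HCobord.{u} n X pt) where
  Hom M N := Quotient (formalSetoid M N)
  id M := Quotient.mk _ (.diffeo (XDiffeo.refl M))
  comp f g := Quotient.map₂ FormalMor.comp (fun _ _ h _ _ h' => FormalRel.comp_congr h h') f g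
  id_comp f := by
    induction f using Quotient.inductionOn with
    | h f => exact Quotient.sound (FormalRel.id_comp f)
  comp_id f := by
    induction f using Quotient.inductionOn with
    | h f => exact Quotient.sound (FormalRel.comp_id f)
  assoc f g h := by
    induction f using Quotient.inductionOn with
    | h f =>
    induction g using Quotient.inductionOn with
    | h g =>
    induction h using Quotient.inductionOn with
    | h h => exact Quotient.sound (FormalRel.assoc f g h)

/-- The morphism given by an `X`-diffeomorphism. -/
def diffeo {M N : XManifold.{u} n X pt} (ψ : XDiffeo M N) :
    (M : HCobord.{u} n X pt) ⟶ (N : HCobord.{u} n X pt) :=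
  Quotient.mk (formalSetoid M N) (.diffeo ψ)

/-- The morphism given by an `X`-cobordism. -/
def cob {M N : XManifold.{u} n X pt} (W : XCobordism M N) :
    (M : HCobord.{u} n X pt) ⟶ (N : HCobord.{u} n X pt) :=
  Quotient.mk (formalSetoid M N) (.cob W)

theorem diffeo_comp {M N P : XManifold.{u} n X pt} (ψ : XDiffeo M N) (φ : XDiffeo N P) :
    diffeo ψ ≫ diffeo φ = diffeo (ψ.trans φ) :=
  Quotient.sound (FormalRel.diffeo_comp ψ φ)

theorem diffeo_refl (M : XManifold.{u} n X pt) :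
    diffeo (XDiffeo.refl M) = 𝟙 (M : HCobord.{u} n X pt) := rfl

/-- The isomorphism given by an `X`-diffeomorphism. -/
def diffeoIso {M N : XManifold.{u} n X pt} (ψ : XDiffeo M N) :
    (M : HCobord.{u} n X pt) ≅ (N : HCobord.{u} n X pt) where
  hom := diffeo ψ
  inv := diffeo ψ.symm
  hom_inv_id := by
    rw [diffeo_comp, ← diffeo_refl]
    exact congrArg diffeo (XDiffeo.ext fun x => ψ.toDiffeo.symm_apply_apply x)
  inv_hom_id := by
    rw [diffeo_comp, ← diffeo_refl]
    exact congrArg diffeo (XDiffeo.ext fun x => ψ.toDiffeo.apply_symm_apply x)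

/-- The disjoint union of morphisms. -/
def tensor {M N M' N' : HCobord.{u} n X pt} (f : M ⟶ N) (g : M' ⟶ N') :
    (XManifold.sum M M' : HCobord.{u} n X pt) ⟶
      (XManifold.sum N N' : HCobord.{u} n X pt) :=
  Quotient.map₂ FormalMor.tensor (fun _ _ h _ _ h' => FormalRel.tensor_congr h h') f g

theorem diffeo_tensor {M N M' N' : XManifold.{u} n X pt} (ψ : XDiffeo M N) (φ : XDiffeo M' N') :
    tensor (diffeo ψ) (diffeo φ) = diffeo (ψ.sum φ) :=
  Quotient.sound (FormalRel.diffeo_tensor ψ φ)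

/-- The monoidal structure: the tensor product is the disjoint union and the unit is the empty
manifold. -/
instance monoidalStruct : MonoidalCategoryStruct (HCobord.{u} n X pt) where
  tensorObj M N := XManifold.sum M N
  tensorUnit := XManifold.empty n X pt
  tensorHom f g := tensor f g
  whiskerLeft M _ _ f := tensor (𝟙 M) f
  whiskerRight f M := tensor f (𝟙 M)
  associator M N P := diffeoIso (XDiffeo.assoc M N P)
  leftUnitor M := diffeoIso (XDiffeo.emptySum M)
  rightUnitor M := diffeoIso (XDiffeo.sumEmpty M)

theorem tensor_comp {M N P M' N' P' : HCobord.{u} n X pt} (f : M ⟶ N) (f' : M' ⟶ N')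
    (g : N ⟶ P) (g' : N' ⟶ P') : tensor f f' ≫ tensor g g' = tensor (f ≫ g) (f' ≫ g') := by
  induction f using Quotient.inductionOn with
  | h f =>
  induction f' using Quotient.inductionOn with
  | h f' =>
  induction g using Quotient.inductionOn with
  | h g =>
  induction g' using Quotient.inductionOn with
  | h g' => exact Quotient.sound (FormalRel.interchange f g f' g')

theorem tensor_id (M N : HCobord.{u} n X pt) :
    tensor (𝟙 M) (𝟙 N) = 𝟙 (XManifold.sum M N : HCobord.{u} n X pt) :=
  (diffeo_tensor (XDiffeo.refl M) (XDiffeo.refl N)).trans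
    (congrArg diffeo (XDiffeo.ext (by rintro (x | x) <;> rfl)))

instance monoidal : MonoidalCategory (HCobord.{u} n X pt) :=
  MonoidalCategory.ofTensorHom
    (id_tensorHom_id := tensor_id)
    (id_tensorHom := fun _ _ _ _ => rfl)
    (tensorHom_id := fun _ _ => rfl)
    (tensorHom_comp_tensorHom := fun f f' g g' => tensor_comp f f' g g')
    (associator_naturality := fun f f' f'' => by
      induction f using Quotient.inductionOn with
      | h f =>
      induction f' using Quotient.inductionOn with
      | h f' =>
      induction f'' using Quotient.inductionOn with
      | h f'' => exact Quotient.sound (FormalRel.assoc_naturality f f' f''))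
    (leftUnitor_naturality := fun f => by
      induction f using Quotient.inductionOn with
      | h f => exact Quotient.sound (FormalRel.emptySum_naturality f))
    (rightUnitor_naturality := fun f => by
      induction f using Quotient.inductionOn with
      | h f => exact Quotient.sound (FormalRel.sumEmpty_naturality f))
    (pentagon := fun M N P Q => by
      change tensor (diffeo _) (diffeo (XDiffeo.refl _)) ≫ diffeo _ ≫
        tensor (diffeo (XDiffeo.refl _)) (diffeo _) = diffeo _ ≫ diffeo _
      rw [diffeo_tensor, diffeo_tensor, diffeo_comp, diffeo_comp, diffeo_comp]
      exact congrArg diffeo (XDiffeo.ext (by rintro (((x | x) | x) | x) <;> rfl)))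
    (triangle := fun M N => by
      change diffeo _ ≫ tensor (diffeo (XDiffeo.refl _)) (diffeo _) =
        tensor (diffeo _) (diffeo (XDiffeo.refl _))
      rw [diffeo_tensor, diffeo_tensor, diffeo_comp]
      refine congrArg diffeo (XDiffeo.ext ?_)
      rintro ((x | x) | x)
      exacts [rfl, PEmpty.elim x, rfl])

instance braided : BraidedCategory (HCobord.{u} n X pt) where
  braiding M N := diffeoIso (XDiffeo.swap M N)
  braiding_naturality_right M _ _ f := by
    induction f using Quotient.inductionOn with
    | h f => exact Quotient.sound (FormalRel.swap_naturality (.diffeo (XDiffeo.refl M)) f)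
  braiding_naturality_left f M := by
    induction f using Quotient.inductionOn with
    | h f => exact Quotient.sound (FormalRel.swap_naturality f (.diffeo (XDiffeo.refl M)))
  hexagon_forward M N P := by
    change diffeo _ ≫ diffeo _ ≫ diffeo _ = tensor (diffeo _) (diffeo (XDiffeo.refl _)) ≫
      diffeo _ ≫ tensor (diffeo (XDiffeo.refl _)) (diffeo _)
    rw [diffeo_tensor, diffeo_tensor, diffeo_comp, diffeo_comp, diffeo_comp, diffeo_comp]
    exact congrArg diffeo (XDiffeo.ext (by rintro ((x | x) | x) <;> rfl))
  hexagon_reverse M N P := by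
    change diffeo _ ≫ diffeo _ ≫ diffeo _ = tensor (diffeo (XDiffeo.refl _)) (diffeo _) ≫
      diffeo _ ≫ tensor (diffeo _) (diffeo (XDiffeo.refl _))
    rw [diffeo_tensor, diffeo_tensor, diffeo_comp, diffeo_comp, diffeo_comp, diffeo_comp]
    exact congrArg diffeo (XDiffeo.ext (by rintro (x | (x | x)) <;> rfl))

instance symmetric : SymmetricCategory (HCobord.{u} n X pt) where
  symmetry M N := by
    change diffeo _ ≫ diffeo _ = _
    rw [diffeo_comp]
    exact congrArg diffeo (XDiffeo.ext (by rintro (x | x) <;> rfl))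

end HCobord

end Category

/-! ### Monoidal categories with strict duals -/

section Duality

/-- A choice, for each object `a` of a monoidal category, of an object `a^*` and of morphisms
`η a : 𝟙 ⟶ a ⊗ a^*` and `ε a : a^* ⊗ a ⟶ 𝟙`. -/
structure DualityData (C : Type*) [Category C] [MonoidalCategory C] where
  dual : C → C
  η : ∀ a : C, 𝟙_ C ⟶ a ⊗ dual a
  ε : ∀ a : C, dual a ⊗ a ⟶ 𝟙_ C

/-- The canonical morphism `x ⟶ y` obtained from a pairing of `x` with `a` and a copairing of `a`
with `y`; it is the canonical comparison of `x` and `y` when both are duals of `a`. -/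
def compareDuals {C : Type*} [Category C] [MonoidalCategory C] {a x y : C}
    (e : x ⊗ a ⟶ 𝟙_ C) (c : 𝟙_ C ⟶ a ⊗ y) : x ⟶ y :=
  (ρ_ x).inv ≫ x ◁ c ≫ (α_ x a y).inv ≫ e ▷ y ≫ (λ_ y).hom

namespace DualityData

section Monoidal

variable {C : Type*} [Category C] [MonoidalCategory C] (D : DualityData C)

/-- The dual `f^* : b^* ⟶ a^*` of a morphism `f : a ⟶ b`, that is
`(1 ⊗ η_a) (1 ⊗ f ⊗ 1) (ε_b ⊗ 1)`. -/
def dualMap {a b : C} (f : a ⟶ b) : D.dual b ⟶ D.dual a :=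
  (ρ_ (D.dual b)).inv ≫ D.dual b ◁ D.η a ≫ D.dual b ◁ (f ▷ D.dual a) ≫
    (α_ (D.dual b) b (D.dual a)).inv ≫ D.ε b ▷ D.dual a ≫ (λ_ (D.dual a)).hom

/-- The triangular identities: `D` is a duality structure. -/
structure IsDuality : Prop where
  triangle : ∀ a : C,
    (λ_ a).inv ≫ D.η a ▷ a ≫ (α_ a (D.dual a) a).hom ≫ a ◁ D.ε a ≫ (ρ_ a).hom = 𝟙 a
  triangle_dual : ∀ a : C,
    (ρ_ (D.dual a)).inv ≫ D.dual a ◁ D.η a ≫ (α_ (D.dual a) a (D.dual a)).inv ≫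
      D.ε a ▷ D.dual a ≫ (λ_ (D.dual a)).hom = 𝟙 (D.dual a)

end Monoidal

section Symmetric

variable {C : Type*} [Category C] [MonoidalCategory C] [SymmetricCategory C] (D : DualityData C)

/-- `η_a (1_a ⊗ η_b ⊗ 1_{a^*}) (1_a ⊗ 1_b ⊗ σ) : 𝟙 ⟶ (a ⊗ b) ⊗ (a^* ⊗ b^*)`. -/
def tensorη (a b : C) : 𝟙_ C ⟶ (a ⊗ b) ⊗ (D.dual a ⊗ D.dual b) :=
  D.η a ≫ a ◁ (λ_ (D.dual a)).inv ≫ a ◁ (D.η b ▷ D.dual a) ≫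
    a ◁ (α_ b (D.dual b) (D.dual a)).hom ≫ a ◁ (b ◁ (β_ (D.dual b) (D.dual a)).hom) ≫
      (α_ a b (D.dual a ⊗ D.dual b)).inv

/-- `(σ ⊗ 1_a ⊗ 1_b) (1_{b^*} ⊗ ε_a ⊗ 1_b) ε_b : (a^* ⊗ b^*) ⊗ (a ⊗ b) ⟶ 𝟙`. -/
def tensorε (a b : C) : (D.dual a ⊗ D.dual b) ⊗ (a ⊗ b) ⟶ 𝟙_ C :=
  (β_ (D.dual a) (D.dual b)).hom ▷ (a ⊗ b) ≫ (α_ (D.dual b) (D.dual a) (a ⊗ b)).hom ≫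
    D.dual b ◁ (α_ (D.dual a) a b).inv ≫ D.dual b ◁ (D.ε a ▷ b) ≫ D.dual b ◁ (λ_ b).hom ≫ D.ε b

/-- `D` makes the symmetric monoidal category `C` a category with strict duals: it is a duality
structure, the canonical isomorphisms `a^** ≅ a`, `(a ⊗ b)^* ≅ a^* ⊗ b^*` and `𝟙^* ≅ 𝟙` are
identities, `η_a` is the dual of `ε_{a^*}` (up to the symmetry, since `(a ⊗ b)^*` is `a^* ⊗ b^*`)
and of `ε_a`, and `η` and `ε` of a tensor product are given by the usual formulas. -/
structure IsStrict : Prop extends D.IsDuality where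
  dual_dual : ∀ a : C, D.dual (D.dual a) = a
  dual_tensor : ∀ a b : C, D.dual (a ⊗ b) = D.dual a ⊗ D.dual b
  dual_unit : D.dual (𝟙_ C) = 𝟙_ C
  dual_dual_iso : ∀ a : C,
    compareDuals (D.ε (D.dual a)) (D.η a ≫ (β_ a (D.dual a)).hom) = eqToHom (dual_dual a)
  dual_tensor_iso : ∀ a b : C,
    compareDuals (D.ε (a ⊗ b)) (D.tensorη a b) = eqToHom (dual_tensor a b)
  dual_unit_iso : compareDuals (D.ε (𝟙_ C)) (λ_ (𝟙_ C)).inv = eqToHom dual_unit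
  η_eq_dual_ε_dual : ∀ a : C,
    D.η a = eqToHom dual_unit.symm ≫ D.dualMap (D.ε (D.dual a)) ≫
      eqToHom (by rw [dual_tensor, dual_dual, dual_dual]) ≫ (β_ (D.dual a) a).hom
  η_eq_dual_ε : ∀ a : C,
    D.η a = eqToHom dual_unit.symm ≫ D.dualMap (D.ε a) ≫
      eqToHom (by rw [dual_tensor, dual_dual])
  η_tensor : ∀ a b : C,
    D.η (a ⊗ b) ≫ (a ⊗ b) ◁ eqToHom (dual_tensor a b) = D.tensorη a b
  ε_tensor : ∀ a b : C,
    D.ε (a ⊗ b) = eqToHom (dual_tensor a b) ▷ (a ⊗ b) ≫ D.tensorε a b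

end Symmetric

end DualityData

/-- The duality of `HCobord(n, X)`: the dual of `(M, g)` is `(-M, g)`, and the unit and the counit
are given by cylinders. -/
def cylinderDuality (n : ℕ) (X : Type v) [TopologicalSpace X] (pt : X) :
    DualityData (HCobord.{u} n X pt) where
  dual M := XManifold.dual M
  η M := HCobord.cob (XCobordism.unit M)
  ε M := HCobord.cob (XCobordism.counit M)

end Duality

end HQFT

end

/-! Every identity is an equality between classes of cylinders, or of one cobordism seen in several
ways, and follows from relations 1–3. The triangular identities hold because a cylinder can be cut
into four quarters and read as a zigzag (`triangleGluing`, `triangleDualGluing`); relation 2 makes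
the zigzag equal to the cylinder, and relation 3 makes the cylinder an identity. The other
identities about units and counits come from explicit `X`-diffeomorphisms of cylinders: the
reflection `t ↦ 1 - t`, the product with an `X`-diffeomorphism, and the splitting of the cylinder of
a disjoint union.

The statement about the dual of a cobordism has geometric content. In any category with duals, `f^*`
is the only `g` with `η_a (f ⊗ 1) = η_b (1 ⊗ g)` (`IsDuality.dualMap_eq`). For `f = (W, F) : M → N`,
the left side should be `W` itself, with both boundary parts regarded as outgoing; this is
`cob_bend`. The same lemma for the reversed cobordism, together with the symmetry, shows that the
right side with `g = W.reverse` is also this bent `W`, whence `W^*` is `W` reversed (`dualMap_cob`).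

To prove `cob_bend`, `W` must be exhibited as a gluing of the unit of `M` and of `W ⨿ (I × M^*)`. A
collar of the incoming boundary does this: half of the collar is the unit, the other half, read
backwards, is `I × M^*`, and what remains is a copy of `W` obtained by stretching the collar. The
map to `X` which is `g` on the collar and `F` on the copy is homotopic to `F` relative to the
boundary, through the stretching isotopy, and so gives the same morphism.

The collar is constructed from local data. Starting from the constant extension of the boundary
inclusion, finitely many small pushes along the inner normal of charts give a smooth map on `I × M`
whose curves all point strictly inward (`exists_isInward`). The convention `outward normal first`
makes it orientation preserving along `{0} × M` (`linPreserves_of_isInward`), hence near it;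
compactness makes it injective on some `[0, b] × M` (`exists_isCollar`). The image of the half-open
collar is open (`IsCollar.isOpen_image`), the inverse is smooth (`contMDiffOn_of_rightInverse`), and
so the stretching is smooth on all of `W`.

Strictness is a matter of orientations only: `M^**` and `M`, or `(M ⨿ N)^*` and `M^* ⨿ N^*`, differ
by equal orientations on the same underlying data. The equality morphisms between them are therefore
classes of identity diffeomorphisms (`eqToHom_withOrientation`), and these are the canonical
isomorphisms. -/

noncomputable section

namespace HQFT

open scoped Manifold ContDiff Topology

/-! ### Inverse maps and local injectivity on domains with unique derivatives, such as half spaces.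
-/

section Calculus

open Set Filter

variable {E F : Type*} [NormedAddCommGroup E] [NormedSpace ℝ E] [NormedAddCommGroup F]
  [NormedSpace ℝ F]

/-- A continuous right inverse of a smooth map with invertible derivative is smooth; the domains
are only assumed to have unique derivatives. -/
theorem contDiffOn_of_rightInverse [CompleteSpace E] {f : E → F} {g : F → E} {S : Set E}
    {T : Set F} (hS : UniqueDiffOn ℝ S) (hT : UniqueDiffOn ℝ T) (hf : ContDiffOn ℝ ∞ f S)
    (hg : ContinuousOn g T) (hgT : MapsTo g T S) (hfg : ∀ y ∈ T, f (g y) = y)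
    (hinv : ∀ x ∈ S, (fderivWithin ℝ f S x).IsInvertible) : ContDiffOn ℝ ∞ g T := by
  have hderiv : ∀ y ∈ T, HasFDerivWithinAt g (fderivWithin ℝ f S (g y)).inverse T y := by
    intro y hy
    obtain ⟨e, he⟩ := hinv (g y) (hgT hy)
    have h1 : HasFDerivWithinAt f (e : E →L[ℝ] F) S (g y) := by
      rw [he]
      exact (hf.differentiableOn (by simp) _ (hgT hy)).hasFDerivWithinAt
    rw [← he, ContinuousLinearMap.inverse_equiv]
    refine HasFDerivWithinAt.of_local_left_inverse ?_ h1 hy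
      (eventually_nhdsWithin_of_forall hfg)
    exact (hg y hy).tendsto_nhdsWithin hgT
  -- Bootstrap: the derivative of `g` at `y` is the inverse of the derivative of `f` at `g y`, so if
  -- `g` is of class `C^m` its derivative is too, and `g` is of class `C^(m+1)`.
  rw [contDiffOn_infty]
  intro m
  induction m with
  | zero => simpa using hg
  | succ m ih =>
    push_cast
    rw [contDiffOn_succ_iff_fderivWithin hT]
    refine ⟨fun y hy => (hderiv y hy).differentiableWithinAt, by simp, ?_⟩
    have h2 : ContDiffOn ℝ m (fun y => (fderivWithin ℝ f S (g y)).inverse) T := by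
      intro y hy
      have h3 : ContDiffOn ℝ m (fderivWithin ℝ f S) S := hf.fderivWithin hS (by exact_mod_cast le_top)
      exact ((hinv (g y) (hgT hy)).contDiffAt_map_inverse).comp_contDiffWithinAt y
        ((h3 _ (hgT hy)).comp y (ih y hy) hgT)
    exact h2.congr fun y hy => (hderiv y hy).fderivWithin (hT y hy)

/-- A `C^1` map on a convex set is injective near a point at which its derivative is invertible. -/
theorem exists_injOn_of_contDiffWithinAt {f : E → F} {s : Set E} {x : E}
    (hs : Convex ℝ s) (hu : UniqueDiffWithinAt ℝ s x) (hx : x ∈ s) (hf : ContDiffWithinAt ℝ 1 f s x)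
    (hinv : (fderivWithin ℝ f s x).IsInvertible) : ∃ t ∈ 𝓝[s] x, InjOn f t := by
  obtain ⟨e, he⟩ := hinv
  rcases hf 1 le_rfl with ⟨t, hst, p, hp⟩
  rw [insert_eq_of_mem hx] at hst
  have hxt : x ∈ t := mem_of_mem_nhdsWithin hx hst
  let f' : E → E →L[ℝ] F := fun y => (continuousMultilinearCurryFin1 ℝ E F) (p y 1)
  have hd : ∀ y ∈ t, HasFDerivWithinAt f (f' y) t y := fun y hy =>
    hp.hasFDerivWithinAt one_ne_zero hy
  have hc : ContinuousOn f' t :=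
    (continuousMultilinearCurryFin1 ℝ E F).continuous.comp_continuousOn (hp.cont 1 le_rfl)
  have hfx : f' x = e := by
    rw [he]
    exact ((hd x hxt).mono_of_mem_nhdsWithin hst |>.fderivWithin hu).symm
  -- `2 C` is the reciprocal of the norm of `e.symm`; the factor two leaves room for the derivative
  -- to vary by `C` near `x`. The zero space is separate because `e.symm` then has norm zero.
  obtain ⟨C, hC, hCe⟩ : ∃ C : ℝ, 0 < C ∧ ∀ v, 2 * C * ‖v‖ ≤ ‖e v‖ := by
    rcases subsingleton_or_nontrivial E with hE | hE
    · exact ⟨1, one_pos, fun v => by rw [Subsingleton.elim v 0]; simp⟩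
    · have h0 := e.norm_symm_pos
      refine ⟨‖(e.symm : F →L[ℝ] E)‖⁻¹ / 2, by positivity, fun v => ?_⟩
      have h1 := (e.symm : F →L[ℝ] E).le_opNorm (e v)
      simp only [ContinuousLinearEquiv.coe_coe, ContinuousLinearEquiv.symm_apply_apply] at h1
      rw [mul_div_cancel₀ _ two_ne_zero, inv_mul_le_iff₀ h0]
      exact h1
  have h1 : ∀ᶠ y in 𝓝[s] x, ‖f' y - e‖ ≤ C := by
    have h2 : Tendsto f' (𝓝[s] x) (𝓝 (f' x)) := (hc x hxt).mono_left (nhdsWithin_le_iff.2 hst)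
    rw [hfx] at h2
    filter_upwards [h2 (Metric.closedBall_mem_nhds _ hC)] with y hy
    simpa [dist_eq_norm] using hy
  obtain ⟨r, hr, hsub⟩ := Metric.mem_nhdsWithin_iff.1 (inter_mem hst h1)
  refine ⟨Metric.ball x r ∩ s, inter_mem (mem_nhdsWithin_of_mem_nhds (Metric.ball_mem_nhds _ hr))
    self_mem_nhdsWithin, fun y hy z hz hyz => ?_⟩
  -- The mean value inequality bounds `f z - f y - e (z - y)` by `C ‖z - y‖`. When `f z = f y` this
  -- contradicts `2 C ‖z - y‖ ≤ ‖e (z - y)‖` unless `z = y`.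
  have h3 := ((convex_ball x r).inter hs).norm_image_sub_le_of_norm_hasFDerivWithin_le'
    (fun w hw => (hd w (hsub hw).1).mono fun a ha => (hsub ha).1) (fun w hw => (hsub hw).2) hy hz
  rw [hyz, sub_self, zero_sub, norm_neg] at h3
  have h4 := hCe (z - y)
  have h5 : ‖z - y‖ ≤ 0 := by
    have : (e : E →L[ℝ] F) (z - y) = e (z - y) := rfl
    rw [this] at h3
    nlinarith [norm_nonneg (z - y)]
  exact (sub_eq_zero.1 (norm_le_zero_iff.1 h5)).symm

end Calculus

/-! ### The same results on manifolds, possibly with boundary. -/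

section ManifoldInverse

open Set Filter

variable {E : Type*} [NormedAddCommGroup E] [NormedSpace ℝ E] {H : Type*} [TopologicalSpace H]
  {I : ModelWithCorners ℝ E H} {X Y : Type*} [TopologicalSpace X] [ChartedSpace H X]
  [IsManifold I ∞ X] [TopologicalSpace Y] [ChartedSpace H Y] [IsManifold I ∞ Y]

theorem isInvertible_mfderiv_extChartAt' {x₀ x : X} (hx : x ∈ (chartAt H x₀).source) :
    (mfderiv I 𝓘(ℝ, E) (extChartAt I x₀) x : E →L[ℝ] E).IsInvertible := by
  have : IsManifold I 1 X := .of_le (n := ∞) (by simp)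
  exact isInvertible_mfderiv_extChartAt (by rwa [extChartAt_source])

/-- The derivative of the coordinate representation of `c` in the charts at `x₀` and `y₀`. -/
theorem isInvertible_fderivWithin_writtenInExtChart {c : X → Y} {x₀ x : X} {y₀ : Y} {S : Set E}
    (hx : x ∈ (chartAt H x₀).source) (hy : c x ∈ (chartAt H y₀).source)
    (hc : MDifferentiableAt I I c x)
    (hinv : (mfderiv I I c x : E →L[ℝ] E).IsInvertible)
    (hS : UniqueDiffWithinAt ℝ S (extChartAt I x₀ x)) (hST : S ⊆ (extChartAt I x₀).target) :
    (fderivWithin ℝ (extChartAt I y₀ ∘ c ∘ (extChartAt I x₀).symm) S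
      (extChartAt I x₀ x)).IsInvertible := by
  have : IsManifold I 1 X := .of_le (n := ∞) (by simp)
  have : IsManifold I 1 Y := .of_le (n := ∞) (by simp)
  have hxs : x ∈ (extChartAt I x₀).source := by rwa [extChartAt_source]
  have hz : extChartAt I x₀ x ∈ (extChartAt I x₀).target := (extChartAt I x₀).map_source hxs
  have e1 : (extChartAt I x₀).symm (extChartAt I x₀ x) = x := (extChartAt I x₀).left_inv hxs
  have h1 : MDifferentiableWithinAt 𝓘(ℝ, E) I (extChartAt I x₀).symm (range I)
      (extChartAt I x₀ x) := mdifferentiableWithinAt_extChartAt_symm hz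
  have hST' : S ⊆ range I := hST.trans (extChartAt_target_subset_range _)
  have h1' := h1.hasMFDerivWithinAt.mono hST'
  have h2 : HasMFDerivAt I 𝓘(ℝ, E) (extChartAt I y₀) (c x)
      (mfderiv I 𝓘(ℝ, E) (extChartAt I y₀) (c x)) := (mdifferentiableAt_extChartAt hy).hasMFDerivAt
  have h3 := (h2.comp x hc.hasMFDerivAt)
  -- The chain rule needs the base point as the image of its coordinates under the inverse chart;
  -- `e1` makes the replacement here and undoes it at the end.
  rw [← e1] at h3
  set x' := (extChartAt I x₀).symm (extChartAt I x₀ x) with hx'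
  have h4 : HasFDerivWithinAt (E := E) (F := E) (extChartAt I y₀ ∘ c ∘ (extChartAt I x₀).symm)
      (((mfderiv I 𝓘(ℝ, E) (extChartAt I y₀) (c x') : E →L[ℝ] E).comp
        (mfderiv I I c x' : E →L[ℝ] E)).comp (mfderivWithin 𝓘(ℝ, E) I (extChartAt I x₀).symm
          (range I) (extChartAt I x₀ x) : E →L[ℝ] E)) S (extChartAt I x₀ x) :=
    (HasMFDerivAt.comp_hasMFDerivWithinAt (extChartAt I x₀ x) h3 h1').hasFDerivWithinAt
  have h5 := HasFDerivWithinAt.fderivWithin (𝕜 := ℝ) (E := E) (F := E) h4 hS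
  rw [h5]
  have i2 : (mfderiv I 𝓘(ℝ, E) (extChartAt I y₀) (c x) : E →L[ℝ] E).IsInvertible :=
    isInvertible_mfderiv_extChartAt' hy
  have i1 : (mfderivWithin 𝓘(ℝ, E) I (extChartAt I x₀).symm (range I)
      (extChartAt I x₀ x) : E →L[ℝ] E).IsInvertible :=
    isInvertible_mfderivWithin_extChartAt_symm hz
  rw [e1]
  exact (i2.comp hinv).comp i1

/-- A smooth map is injective near a point at which its derivative is invertible. -/
theorem exists_injOn_of_isInvertible_mfderiv {c : X → Y} {x : X} (hc : ContMDiffAt I I ∞ c x)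
    (hinv : (mfderiv I I c x : E →L[ℝ] E).IsInvertible) : ∃ u ∈ 𝓝 x, InjOn c u := by
  have h1 := (contMDiffAt_iff.1 hc).2
  have hx : extChartAt I x x ∈ range I := extChartAt_target_subset_range x (mem_extChartAt_target x)
  have hT : (extChartAt I x).target ∈ 𝓝[range I] (extChartAt I x x) :=
    extChartAt_target_mem_nhdsWithin x
  have h2 := isInvertible_fderivWithin_writtenInExtChart (mem_chart_source H x)
    (mem_chart_source H (c x)) (hc.mdifferentiableAt (by simp)) hinv
    (uniqueDiffOn_extChartAt_target x _ (mem_extChartAt_target x)) subset_rfl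
  -- The mean value argument needs a convex set. The target of the chart need not be convex, but
  -- `range I` is, and the two agree near the point.
  have h3 : fderivWithin ℝ (extChartAt I (c x) ∘ c ∘ (extChartAt I x).symm)
      (extChartAt I x).target (extChartAt I x x) =
      fderivWithin ℝ (extChartAt I (c x) ∘ c ∘ (extChartAt I x).symm)
      (range I) (extChartAt I x x) := by
    apply fderivWithin_congr_set
    rw [Filter.eventuallyEq_set]
    rw [mem_nhdsWithin_iff_eventually] at hT
    filter_upwards [hT] with y hy
    exact ⟨fun h => extChartAt_target_subset_range x h, hy⟩
  rw [h3] at h2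
  obtain ⟨t, ht, hinj⟩ := exists_injOn_of_contDiffWithinAt I.convex_range
    (I.uniqueDiffOn _ hx) hx (h1.of_le (by simp)) h2
  refine ⟨(extChartAt I x) ⁻¹' t ∩ (extChartAt I x).source ∩ c ⁻¹' (extChartAt I (c x)).source,
    inter_mem (inter_mem ?_ (extChartAt_source_mem_nhds x))
      (hc.continuousAt.preimage_mem_nhds (extChartAt_source_mem_nhds _)), ?_⟩
  · have : Tendsto (extChartAt I x) (𝓝 x) (𝓝[range I] (extChartAt I x x)) := by
      refine tendsto_nhdsWithin_iff.2 ⟨continuousAt_extChartAt x, .of_forall fun y => ?_⟩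
      exact mem_range_self _
    exact this ht
  · rintro y ⟨⟨hy1, hy2⟩, hy3⟩ z ⟨⟨hz1, hz2⟩, hz3⟩ hyz
    refine (extChartAt I x).injOn hy2 hz2 (hinj hy1 hz1 ?_)
    simp only [Function.comp_apply]
    rw [(extChartAt I x).left_inv hy2, (extChartAt I x).left_inv hz2, hyz]

/-- A continuous right inverse, with values in an open set, of a smooth map with invertible
derivative is smooth. -/
theorem contMDiffOn_of_rightInverse [CompleteSpace E] {c : X → Y} {g : Y → X} {U : Set X}
    {V : Set Y} (hU : IsOpen U) (hV : IsOpen V) (hc : ContMDiffOn I I ∞ c U)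
    (hgV : MapsTo g V U) (hg : ContinuousOn g V) (hcg : ∀ y ∈ V, c (g y) = y)
    (hinv : ∀ x ∈ U, (mfderiv I I c x : E →L[ℝ] E).IsInvertible) : ContMDiffOn I I ∞ g V := by
  have : IsManifold I 1 X := .of_le (n := ∞) (by simp)
  have : IsManifold I 1 Y := .of_le (n := ∞) (by simp)
  intro y₀ hy₀
  refine ContMDiffAt.contMDiffWithinAt ?_
  set x₀ := g y₀ with hx₀
  -- `V'` and `U'` are the parts of `V` and `U` seen by both charts; on their coordinate images the
  -- inverse theorem for normed spaces applies.
  set V' := V ∩ g ⁻¹' (extChartAt I x₀).source ∩ (extChartAt I y₀).source with hV'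
  have hV'o : IsOpen V' := (hg.isOpen_inter_preimage hV (isOpen_extChartAt_source x₀)).inter
    (isOpen_extChartAt_source y₀)
  have hy₀' : y₀ ∈ V' := ⟨⟨hy₀, mem_extChartAt_source _⟩, mem_extChartAt_source _⟩
  set U' := U ∩ c ⁻¹' (extChartAt I y₀).source ∩ (extChartAt I x₀).source with hU'
  have hU'o : IsOpen U' := (hc.continuousOn.isOpen_inter_preimage hU
    (isOpen_extChartAt_source y₀)).inter (isOpen_extChartAt_source x₀)
  have hUd := hU'o.uniqueMDiffOn (I := I) |>.uniqueDiffOn_target_inter x₀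
  have hVd := hV'o.uniqueMDiffOn (I := I) |>.uniqueDiffOn_target_inter y₀
  have imgU : (extChartAt I x₀).target ∩ (extChartAt I x₀).symm ⁻¹' U' = extChartAt I x₀ '' U' :=
    ((extChartAt I x₀).image_eq_target_inter_inv_preimage fun x hx => hx.2).symm
  have imgV : (extChartAt I y₀).target ∩ (extChartAt I y₀).symm ⁻¹' V' = extChartAt I y₀ '' V' :=
    ((extChartAt I y₀).image_eq_target_inter_inv_preimage fun x hx => hx.2).symm
  have hc' : ContDiffOn ℝ ∞ (extChartAt I y₀ ∘ c ∘ (extChartAt I x₀).symm)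
      (extChartAt I x₀ '' U') :=
    (contMDiffOn_iff_of_subset_source' (fun x hx => hx.2) (fun x hx => hx.1.2)).1
      (hc.mono fun x hx => hx.1.1)
  rw [← imgU] at hc'
  have hgc : ContinuousOn (extChartAt I x₀ ∘ g ∘ (extChartAt I y₀).symm)
      ((extChartAt I y₀).target ∩ (extChartAt I y₀).symm ⁻¹' V') := by
    refine (continuousOn_extChartAt x₀).comp (hg.comp
      ((continuousOn_extChartAt_symm y₀).mono inter_subset_left) fun z hz => hz.2.1.1) ?_
    exact fun z hz => hz.2.1.2
  have key := contDiffOn_of_rightInverse (f := extChartAt I y₀ ∘ c ∘ (extChartAt I x₀).symm)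
    (g := extChartAt I x₀ ∘ g ∘ (extChartAt I y₀).symm) hUd hVd hc' hgc ?_ ?_ ?_
  · have h : ContMDiffOn I I ∞ g V' :=
      (contMDiffOn_iff_of_subset_source' (fun x hx => hx.2) (fun x hx => hx.1.2)).2 (imgV ▸ key)
    exact h.contMDiffAt (hV'o.mem_nhds hy₀')
  · rintro z ⟨hz, ⟨hz1, hz2⟩, hz3⟩
    refine ⟨(extChartAt I x₀).map_source hz2, ?_⟩
    simp only [mem_preimage, Function.comp_apply]
    rw [(extChartAt I x₀).left_inv hz2]
    refine ⟨⟨hgV hz1, ?_⟩, hz2⟩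
    rw [mem_preimage, hcg _ hz1]
    exact hz3
  · rintro z ⟨hz, ⟨hz1, hz2⟩, hz3⟩
    simp only [Function.comp_apply]
    rw [(extChartAt I x₀).left_inv hz2, hcg _ hz1, (extChartAt I y₀).right_inv hz]
  · rintro z ⟨hz, ⟨hz1, hz2⟩, hz3⟩
    have e1 := (extChartAt I x₀).right_inv hz
    have := isInvertible_fderivWithin_writtenInExtChart (c := c) (x₀ := x₀) (y₀ := y₀)
      (S := (extChartAt I x₀).target ∩ (extChartAt I x₀).symm ⁻¹' U')
      (x := (extChartAt I x₀).symm z) (by rw [← extChartAt_source I]; exact hz3)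
      (by rw [← extChartAt_source I]; exact hz2)
      ((hc.contMDiffAt (hU.mem_nhds hz1)).mdifferentiableAt (by simp)) (hinv _ hz1)
      (by rw [e1]; exact hUd z ⟨hz, ⟨hz1, hz2⟩, hz3⟩) inter_subset_left
    rwa [e1] at this

end ManifoldInverse

end HQFT

end

noncomputable section

namespace HQFT

open scoped Manifold ContDiff Topology

/-! ### Orientations as signs of determinants, and top forms on a product with a line. -/

section OrientationAlgebra

variable {E F : Type*} [AddCommGroup E] [Module ℝ E] [AddCommGroup F] [Module ℝ F] {k : ℕ}

theorem compLinearMap_eq_det_smul [FiniteDimensional ℝ E] (hk : Module.finrank ℝ E = k)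
    (θ : E [⋀^Fin k]→ₗ[ℝ] ℝ) (A : E →ₗ[ℝ] E) :
    θ.compLinearMap A = LinearMap.det A • θ := by
  let b : Module.Basis (Fin k) ℝ E := Module.finBasisOfFinrankEq ℝ E hk
  rw [θ.eq_smul_basis_det b]
  ext w
  simp only [AlternatingMap.compLinearMap_apply, AlternatingMap.smul_apply]
  have := b.det_comp A w
  simp only [Function.comp_def] at this
  rw [this]
  simp only [smul_eq_mul]
  ring

theorem IsPositive.smul_iff {o : Orientation ℝ E (Fin k)} {θ : E [⋀^Fin k]→ₗ[ℝ] ℝ}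
    (h : IsPositive o θ) {c : ℝ} : IsPositive o (c • θ) ↔ 0 < c := by
  refine ⟨fun h' => ?_, fun hc => h.smul hc⟩
  obtain ⟨d, hd, e⟩ := h.exists_smul h'
  rwa [← smul_left_injective ℝ h.1 e]

/-- The pullback of a top form by `A` is `det A` times the form. Conditions on orientations thus
become signs of determinants, which are open conditions and force invertibility. -/
theorem linPreserves_self_iff [FiniteDimensional ℝ E] (hk : Module.finrank ℝ E = k)
    {a : Orientation ℝ E (Fin k)} {A : E →ₗ[ℝ] E} :
    LinPreserves A a a ↔ 0 < LinearMap.det A := by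
  constructor
  · intro h
    obtain ⟨θ, hθ⟩ := IsPositive.exists a
    have := h θ hθ
    rw [compLinearMap_eq_det_smul hk] at this
    exact hθ.smul_iff.1 this
  · intro h θ hθ
    rw [compLinearMap_eq_det_smul hk]
    exact hθ.smul h

theorem linPreserves_neg_iff [FiniteDimensional ℝ E] (hk : Module.finrank ℝ E = k)
    {a : Orientation ℝ E (Fin k)} {A : E →ₗ[ℝ] E} :
    LinPreserves A a (-a) ↔ LinearMap.det A < 0 := by
  constructor
  · intro h
    obtain ⟨θ, hθ⟩ := IsPositive.exists a
    have h1 : IsPositive (-a) (-θ) := by rwa [isPositive_neg, neg_neg]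
    have := h _ h1
    rw [compLinearMap_eq_det_smul hk, smul_neg, ← neg_smul] at this
    exact neg_pos.1 (hθ.smul_iff.1 this)
  · intro h θ hθ
    rw [isPositive_neg] at hθ
    have := hθ.smul (neg_pos.2 h)
    rw [compLinearMap_eq_det_smul hk]
    rwa [neg_smul_neg] at this

theorem LinPreserves.det_ne_zero [FiniteDimensional ℝ E] (hk : Module.finrank ℝ E = k)
    {a b : Orientation ℝ E (Fin k)} {A : E →ₗ[ℝ] E} (h : LinPreserves A a b) :
    LinearMap.det A ≠ 0 := by
  rcases b.eq_or_eq_neg a (by simpa using hk.symm) with rfl | rfl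
  · exact ((linPreserves_self_iff hk).1 h).ne'
  · exact ((linPreserves_neg_iff hk).1 h).ne

theorem LinPreserves.cancel {E' : Type*} [AddCommGroup E'] [Module ℝ E']
    {A : E →ₗ[ℝ] F} {B : F →ₗ[ℝ] E} (hAB : A ∘ₗ B = LinearMap.id)
    {C : E →ₗ[ℝ] E'} {a : Orientation ℝ E (Fin k)} {b : Orientation ℝ F (Fin k)}
    {c : Orientation ℝ E' (Fin k)} (h : LinPreserves A a b) (hC : LinPreserves C a c) :
    LinPreserves (C ∘ₗ B) b c :=
  hC.comp (h.inv hAB)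

/-- Top forms on `F × E` form a line, so it suffices to compare both sides on one basis, namely `e`
followed by a basis of `E`. This puts a pulled back form into the shape required by the product
orientation of a cylinder. -/
theorem eq_wedge [FiniteDimensional ℝ E] (hk : Module.finrank ℝ E = k)
    (Ω : (F × E) [⋀^Fin (k + 1)]→ₗ[ℝ] ℝ) {τ : F →ₗ[ℝ] ℝ} {e : F} (he : τ e = 1)
    (hF : ∀ f, τ f • e = f) :
    Ω = wedge τ ((Ω.curryLeft (e, 0)).compLinearMap (LinearMap.inr ℝ F E)) := by
  have he0 : e ≠ 0 := by
    rintro rfl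
    simp at he
  have hF1 : Module.finrank ℝ F = 1 := finrank_eq_one e he0 fun w => ⟨τ w, hF w⟩
  have : FiniteDimensional ℝ F := FiniteDimensional.of_finrank_eq_succ hF1
  let b : Module.Basis (Fin k) ℝ E := Module.finBasisOfFinrankEq ℝ E hk
  have hli : LinearIndependent ℝ (Fin.cons (e, 0) (LinearMap.inr ℝ F E ∘ b) : Fin (k + 1) → F × E) := by
    rw [linearIndependent_finCons]
    refine ⟨b.linearIndependent.map' _ (LinearMap.ker_eq_bot.2 LinearMap.inr_injective), ?_⟩
    intro h
    have h2 : Submodule.span ℝ (Set.range (LinearMap.inr ℝ F E ∘ b)) ≤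
        LinearMap.ker (LinearMap.fst ℝ F E) := by
      rw [Submodule.span_le]
      rintro _ ⟨i, rfl⟩
      simp
    exact he0 (h2 h)
  let B := basisOfLinearIndependentOfCardEqFinrank hli (by simp [hF1, hk, add_comm])
  have hB : (B : Fin (k + 1) → F × E) = Fin.cons (e, 0) (LinearMap.inr ℝ F E ∘ b) := by
    simp [B]
  refine (Ω.eq_smul_basis_det B).trans (.trans ?_ (AlternatingMap.eq_smul_basis_det B _).symm)
  congr 1
  have h3 : ∀ Ω' : (F × E) [⋀^Fin (k + 1)]→ₗ[ℝ] ℝ, Ω' B =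
      ((Ω'.curryLeft (e, 0)).compLinearMap (LinearMap.inr ℝ F E)) b := by
    intro Ω'
    rw [hB, AlternatingMap.compLinearMap_apply, AlternatingMap.curryLeft_apply_apply]
    rfl
  rw [h3, h3, wedge_curryLeft_inr]
  simp [he]

end OrientationAlgebra

/-! ### Preservation of orientation is an open condition. -/

section OrientationTopology

open Set Filter

variable {E : Type*} [NormedAddCommGroup E] [NormedSpace ℝ E] [FiniteDimensional ℝ E] {k : ℕ}

theorem isOpen_linPreserves (hk : Module.finrank ℝ E = k) (a b : Orientation ℝ E (Fin k)) :
    IsOpen {A : E →L[ℝ] E | LinPreserves A.toLinearMap a b} := by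
  have hc : Continuous fun A : E →L[ℝ] E => A.det := ContinuousLinearMap.continuous_det
  rcases b.eq_or_eq_neg a (by simpa using hk.symm) with rfl | rfl
  · simp only [linPreserves_self_iff hk]
    exact isOpen_lt continuous_const hc
  · simp only [linPreserves_neg_iff hk]
    exact isOpen_lt hc continuous_const

theorem LinPreserves.isInvertible (hk : Module.finrank ℝ E = k) {a b : Orientation ℝ E (Fin k)}
    {A : E →L[ℝ] E} (h : LinPreserves A.toLinearMap a b) : A.IsInvertible := by
  have h1 := h.det_ne_zero hk
  exact ⟨A.toContinuousLinearEquivOfDetNeZero h1, A.coe_toContinuousLinearEquivOfDetNeZero h1⟩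

variable {H : Type*} [TopologicalSpace H]
  {I : ModelWithCorners ℝ E H} {X Y : Type*} [TopologicalSpace X] [ChartedSpace H X]
  [IsManifold I ∞ X] [TopologicalSpace Y] [ChartedSpace H Y] [IsManifold I ∞ Y]

/-- The set of points at which the derivative of a smooth map preserves orientations is open. -/
theorem eventually_linPreserves_mfderiv (hk : Module.finrank ℝ E = k)
    {oX : ManifoldOrientation I X k} {oY : ManifoldOrientation I Y k} {c : X → Y}
    {x₀ : X} (hc : ContMDiff I I ∞ c)
    (h : LinPreserves (mfderiv I I c x₀ : E →L[ℝ] E).toLinearMap (oX.at' x₀) (oY.at' (c x₀))) :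
    ∀ᶠ x in 𝓝 x₀, LinPreserves (mfderiv I I c x : E →L[ℝ] E).toLinearMap
      (oX.at' x) (oY.at' (c x)) := by
  have : IsManifold I 1 X := .of_le (n := ∞) (by simp)
  have : IsManifold I 1 Y := .of_le (n := ∞) (by simp)
  obtain ⟨a, ha⟩ := oX.locallyConstant x₀
  obtain ⟨b, hb⟩ := oY.locallyConstant (c x₀)
  set D₁ : X → E →L[ℝ] E := fun x => mfderiv I 𝓘(ℝ, E) (extChartAt I x₀) x with hD₁
  set D₂ : Y → E →L[ℝ] E := fun y => mfderiv I 𝓘(ℝ, E) (extChartAt I (c x₀)) y with hD₂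
  set U := c ⁻¹' (extChartAt I (c x₀)).source ∩ (extChartAt I x₀).source with hU
  have hUo : IsOpen U := ((isOpen_extChartAt_source _).preimage hc.continuous).inter
    (isOpen_extChartAt_source _)
  have hx₀ : x₀ ∈ U := ⟨mem_extChartAt_source (c x₀), mem_extChartAt_source x₀⟩
  set S := (extChartAt I x₀).target ∩ (extChartAt I x₀).symm ⁻¹' U with hS
  have hSU : S = extChartAt I x₀ '' U :=
    ((extChartAt I x₀).image_eq_target_inter_inv_preimage fun x hx => hx.2).symm
  have hSd : UniqueDiffOn ℝ S := hUo.uniqueMDiffOn (I := I) |>.uniqueDiffOn_target_inter x₀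
  set f := extChartAt I (c x₀) ∘ c ∘ (extChartAt I x₀).symm with hf
  have hfS : ContDiffOn ℝ ∞ f S := hSU ▸ (contMDiffOn_iff_of_subset_source'
    (fun x hx => hx.2) (fun x hx => hx.1)).1 hc.contMDiffOn
  -- `J x` is the derivative of `c` at `x` in the fixed charts at `x₀` and `c x₀`. Unlike `mfderiv`,
  -- whose charts vary with the point, it depends continuously on `x`.
  set J : X → E →L[ℝ] E := fun x => fderivWithin ℝ f S (extChartAt I x₀ x) with hJ
  have hJc : ContinuousOn J U := by
    refine (hfS.continuousOn_fderivWithin hSd (by simp)).comp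
      ((continuousOn_extChartAt x₀).mono fun x hx => hx.2) fun x hx => ?_
    rw [hSU]
    exact mem_image_of_mem _ hx
  have hchain : ∀ x ∈ U, (J x).comp (D₁ x) = (D₂ (c x)).comp (mfderiv I I c x : E →L[ℝ] E) := by
    intro x hx
    have hxc : x ∈ (chartAt H x₀).source := by rw [← extChartAt_source I]; exact hx.2
    have hyc : c x ∈ (chartAt H (c x₀)).source := by rw [← extChartAt_source I]; exact hx.1
    have h1 : HasMFDerivAt I 𝓘(ℝ, E) (extChartAt I x₀) x (D₁ x) :=
      (mdifferentiableAt_extChartAt hxc).hasMFDerivAt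
    have h2 : HasMFDerivAt I 𝓘(ℝ, E) (extChartAt I (c x₀)) (c x) (D₂ (c x)) :=
      (mdifferentiableAt_extChartAt hyc).hasMFDerivAt
    have h3 := h2.comp x (hc.mdifferentiable (by simp) x).hasMFDerivAt
    have hxS : extChartAt I x₀ x ∈ S := by
      rw [hSU]
      exact mem_image_of_mem _ hx
    have h4 : HasMFDerivWithinAt 𝓘(ℝ, E) 𝓘(ℝ, E) f S (extChartAt I x₀ x) (J x) :=
      ((hfS.differentiableOn (by simp) _ hxS).hasFDerivWithinAt).hasMFDerivWithinAt
    have h5 := h4.comp (s := U) x h1.hasMFDerivWithinAt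
      (fun z hz => by rw [mem_preimage, hSU]; exact mem_image_of_mem _ hz)
    have h6 := h5.hasMFDerivAt (hUo.mem_nhds hx)
    have h7 : f ∘ extChartAt I x₀ =ᶠ[𝓝 x] extChartAt I (c x₀) ∘ c := by
      filter_upwards [hUo.mem_nhds hx] with z hz
      simp only [hf, Function.comp_apply, (extChartAt I x₀).left_inv hz.2]
    exact hasMFDerivAt_unique h6 (h3.congr_of_eventuallyEq h7)
  have hD₁i : ∀ x ∈ U, (D₁ x).IsInvertible := fun x hx =>
    isInvertible_mfderiv_extChartAt' (by rw [← extChartAt_source I]; exact hx.2)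
  have hD₂i : ∀ x ∈ U, (D₂ (c x)).IsInvertible := fun x hx =>
    isInvertible_mfderiv_extChartAt' (by rw [← extChartAt_source I]; exact hx.1)
  have hb' := hc.continuous.continuousAt.eventually hb
  -- Near `x₀` the chart derivatives `D₁` and `D₂` carry the orientations of `X` and `Y` to the
  -- constants `a` and `b`. By the chain rule, `c` preserves orientations at `x` exactly when `J x`
  -- carries `a` to `b`, an open condition on `J x`.
  have key : ∀ᶠ x in 𝓝 x₀, (LinPreserves (J x).toLinearMap a b ↔
      LinPreserves (mfderiv I I c x : E →L[ℝ] E).toLinearMap (oX.at' x) (oY.at' (c x))) := by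
    filter_upwards [ha, hb', hUo.mem_nhds hx₀] with x hxa hxb hx
    obtain ⟨e₁, he₁⟩ := hD₁i x hx
    obtain ⟨e₂, he₂⟩ := hD₂i x hx
    have hch := hchain x hx
    rw [← he₁, ← he₂] at hch
    change LinPreserves (D₁ x).toLinearMap _ _ at hxa
    change LinPreserves (D₂ (c x)).toLinearMap _ _ at hxb
    rw [← he₁] at hxa
    rw [← he₂] at hxb
    have i₁ : LinPreserves (e₁.symm : E →L[ℝ] E).toLinearMap a (oX.at' x) :=
      hxa.inv (by ext; simp)
    have i₂ : LinPreserves (e₂.symm : E →L[ℝ] E).toLinearMap b (oY.at' (c x)) :=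
      hxb.inv (by ext; simp)
    constructor
    · intro hJx
      have := i₂.comp (hJx.comp hxa)
      have e : (e₂.symm : E →L[ℝ] E).toLinearMap ∘ₗ ((J x).toLinearMap ∘ₗ
          (e₁ : E →L[ℝ] E).toLinearMap) = (mfderiv I I c x : E →L[ℝ] E).toLinearMap := by
        ext v
        have := congrArg (fun L : E →L[ℝ] E => e₂.symm (L v)) hch
        exact this.trans (e₂.symm_apply_apply _)
      rwa [e] at this
    · intro hcx
      have := (hxb.comp hcx).comp i₁
      have e : ((e₂ : E →L[ℝ] E).toLinearMap ∘ₗ (mfderiv I I c x : E →L[ℝ] E).toLinearMap) ∘ₗ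
          (e₁.symm : E →L[ℝ] E).toLinearMap = (J x).toLinearMap := by
        ext v
        have := congrArg (fun L : E →L[ℝ] E => L (e₁.symm v)) hch
        exact this.symm.trans (congrArg (J x) (e₁.apply_symm_apply v))
      rwa [e] at this
  have hJ₀ : LinPreserves (J x₀).toLinearMap a b := key.self_of_nhds.2 h
  have := (hJc.continuousAt (hUo.mem_nhds hx₀)).eventually
    ((isOpen_linPreserves hk a b).mem_nhds hJ₀)
  filter_upwards [key, this] with x h1 h2
  exact h1.1 h2

end OrientationTopology

end HQFT

end

noncomputable section

namespace HQFT

open scoped Manifold ContDiff Topology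

/-! ### Boundary points and inward vectors in the half space. -/

section HalfSpace

open Set Filter

/-- The first coordinate of `ℝ × ℝⁿ`. -/
def firstCoord (n : ℕ) : BdVec n →L[ℝ] ℝ :=
  (EuclideanSpace.proj 0 : EuclideanSpace ℝ (Fin 1) →L[ℝ] ℝ).comp
    (ContinuousLinearMap.fst ℝ (EuclideanSpace ℝ (Fin 1)) (EuclideanSpace ℝ (Fin n)))

/-- The inward unit normal vector of the half space. -/
def normalVec (n : ℕ) : BdVec n := (EuclideanSpace.single 0 1, 0)

variable {n : ℕ}

theorem firstCoord_apply (v : BdVec n) : firstCoord n v = v.1 0 := rfl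

theorem firstCoord_normalVec : firstCoord n (normalVec n) = 1 := by
  simp [firstCoord_apply, normalVec]

theorem norm_normalVec : ‖normalVec n‖ = 1 := by
  simp [normalVec, Prod.norm_def]

theorem mem_range_bdModel {v : BdVec n} : v ∈ range (bdModel n) ↔ 0 ≤ firstCoord n v := by
  rw [ModelWithCorners.range_prod, range_modelWithCornersEuclideanHalfSpace]
  simp [firstCoord_apply]

theorem mem_interior_range_bdModel {v : BdVec n} :
    v ∈ interior (range (bdModel n)) ↔ 0 < firstCoord n v := by
  rw [ModelWithCorners.range_prod, interior_prod_eq,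
    interior_range_modelWithCornersEuclideanHalfSpace]
  simp [firstCoord_apply]

variable {W : Type*} [TopologicalSpace W] [ChartedSpace (BdSpace n) W]

theorem firstCoord_extChartAt_nonneg (q p : W) : 0 ≤ firstCoord n (extChartAt (bdModel n) q p) :=
  mem_range_bdModel.1 (mem_range_self _)

/-- Interior points do not depend on the chart, so every chart around `p` may be used and not only
the preferred one at `p`. -/
theorem isInteriorPoint_iff_firstCoord [IsManifold (bdModel n) ∞ W] {q p : W}
    (hp : p ∈ (chartAt (BdSpace n) q).source) :
    (bdModel n).IsInteriorPoint p ↔ 0 < firstCoord n (extChartAt (bdModel n) q p) := by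
  rw [(bdModel n).isInteriorPoint_iff_of_mem_atlas (n := ∞) (by simp)
    (chart_mem_atlas (BdSpace n) q) hp, ← mem_interior_range_bdModel]
  exact ⟨fun h => OpenPartialHomeomorph.interior_extend_target_subset_interior_range _ h,
    fun h => (chartAt (BdSpace n) q).mem_interior_extend_target
      ((chartAt (BdSpace n) q).map_source hp) h⟩

theorem mem_boundary_iff_firstCoord [IsManifold (bdModel n) ∞ W] {q p : W}
    (hp : p ∈ (chartAt (BdSpace n) q).source) :
    p ∈ (bdModel n).boundary W ↔ firstCoord n (extChartAt (bdModel n) q p) = 0 := by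
  change (bdModel n).IsBoundaryPoint p ↔ _
  rw [ModelWithCorners.isBoundaryPoint_iff_not_isInteriorPoint, isInteriorPoint_iff_firstCoord hp,
    not_lt]
  exact ⟨fun h => le_antisymm h (firstCoord_extChartAt_nonneg q p), fun h => h.le⟩

/-- The derivative at a boundary point of a curve in the half space points into the half space. -/
theorem firstCoord_nonneg_of_hasDerivWithinAt {γ : ℝ → BdVec n} {v : BdVec n}
    (h : HasDerivWithinAt γ v (Icc 0 1) 0) (h0 : firstCoord n (γ 0) = 0)
    (hγ : ∀ t, 0 ≤ firstCoord n (γ t)) : 0 ≤ firstCoord n v := by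
  have h1 : HasFDerivWithinAt (firstCoord n ∘ γ) _ (Icc 0 1) 0 :=
    (firstCoord n).hasFDerivAt.comp_hasFDerivWithinAt (0 : ℝ) h.hasFDerivWithinAt
  have h2 : IsLocalMinOn (firstCoord n ∘ γ) (Icc 0 1) 0 :=
    Filter.Eventually.of_forall fun t => by simpa [h0] using hγ t
  have h3 := h2.hasFDerivWithinAt_nonneg h1 (y := 1)
    (mem_posTangentConeAt_of_segment_subset (by simp [segment_eq_Icc]))
  simpa using h3

/-- A curve starting at a boundary point which points inward in one chart does so in every
chart. -/
theorem exists_hasDerivWithinAt_chart_change [IsManifold (bdModel n) ∞ W] {q q' : W} {γ : ℝ → W}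
    (hq : γ 0 ∈ (chartAt (BdSpace n) q).source) (hq' : γ 0 ∈ (chartAt (BdSpace n) q').source)
    (hb : γ 0 ∈ (bdModel n).boundary W) (hγ : ContinuousWithinAt γ (Icc 0 1) 0) {v : BdVec n}
    (hv : HasDerivWithinAt (extChartAt (bdModel n) q ∘ γ) v (Icc 0 1) 0)
    (hv0 : 0 < firstCoord n v) :
    ∃ v', HasDerivWithinAt (extChartAt (bdModel n) q' ∘ γ) v' (Icc 0 1) 0 ∧
      0 < firstCoord n v' := by
  have : IsManifold (bdModel n) 1 W := .of_le (n := ∞) (by simp)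
  set p := γ 0 with hp
  set e := extChartAt (bdModel n) q with he
  set e' := extChartAt (bdModel n) q' with he'
  have hqs : p ∈ e.source := by rwa [he, extChartAt_source]
  have hqs' : p ∈ e'.source := by rwa [he', extChartAt_source]
  set U := e.source ∩ e'.source with hU
  have hUo : IsOpen U := (isOpen_extChartAt_source q).inter (isOpen_extChartAt_source q')
  set S := e.target ∩ e.symm ⁻¹' U with hS
  have hSU : S = e '' U := (e.image_eq_target_inter_inv_preimage fun x hx => hx.1).symm
  have hSd : UniqueDiffOn ℝ S := hUo.uniqueMDiffOn (I := bdModel n) |>.uniqueDiffOn_target_inter q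
  set τ := e' ∘ e.symm with hτ
  have hτS : ContDiffOn ℝ ∞ τ S :=
    hSU ▸ (contMDiffOn_iff_of_subset_source' (fun x hx => hx.1) (fun x hx => hx.2)).1
      (contMDiff_id.contMDiffOn (s := U) (I := bdModel n) (n := ∞))
  have hpS : e p ∈ S := by
    rw [hSU]
    exact mem_image_of_mem _ ⟨hqs, hqs'⟩
  set A := fderivWithin ℝ τ S (e p) with hA
  have hτA : HasFDerivWithinAt τ A S (e p) :=
    (hτS.differentiableOn (by simp) _ hpS).hasFDerivWithinAt
  have hAinv : A.IsInvertible := by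
    refine isInvertible_fderivWithin_writtenInExtChart (c := id) hq hq' mdifferentiableAt_id ?_
      (hSd _ hpS) inter_subset_left
    rw [mfderiv_id]
    exact ⟨ContinuousLinearEquiv.refl ℝ _, rfl⟩
  have hz : firstCoord n (e p) = 0 := (mem_boundary_iff_firstCoord hq).1 hb
  have hτz : firstCoord n (τ (e p)) = 0 := by
    rw [hτ, Function.comp_apply, e.left_inv hqs]
    exact (mem_boundary_iff_firstCoord hq').1 hb
  have hSn : S ∈ 𝓝[range (bdModel n)] (e p) := by
    have h1 : e.symm ⁻¹' U ∈ 𝓝[range (bdModel n)] (e p) := mem_nhdsWithin_of_mem_nhds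
      (extChartAt_preimage_mem_nhds' hqs (hUo.mem_nhds ⟨hqs, hqs'⟩))
    exact inter_mem (extChartAt_target_mem_nhdsWithin' hqs) h1
  -- The change of charts maps the half space to itself and the boundary point `e p` to a boundary
  -- point, so its first coordinate is minimal there. Hence its derivative `A` takes inward vectors
  -- to vectors with nonnegative first coordinate.
  have hmin : IsLocalMinOn (firstCoord n ∘ τ) (range (bdModel n)) (e p) :=
    Filter.Eventually.of_forall fun z => by
      change firstCoord n (τ (e p)) ≤ _
      rw [hτz]
      exact firstCoord_extChartAt_nonneg q' (e.symm z)
  have hder : HasFDerivWithinAt (firstCoord n ∘ τ) ((firstCoord n).comp A)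
      (range (bdModel n)) (e p) :=
    (firstCoord n).hasFDerivAt.comp_hasFDerivWithinAt (e p) (hτA.mono_of_mem_nhdsWithin hSn)
  have hnonneg : ∀ w, 0 ≤ firstCoord n w → 0 ≤ firstCoord n (A w) := by
    intro w hw
    refine hmin.hasFDerivWithinAt_nonneg hder (y := w) (mem_posTangentConeAt_of_segment_subset ?_)
    refine (bdModel n).convex_range.segment_subset (mem_range_self _) ?_
    rw [mem_range_bdModel, map_add, hz, zero_add]
    exact hw
  -- For `w` tangent to the boundary the inequality applies to both `w` and `-w`. Consequently the
  -- first coordinate of `A w` is a multiple of that of `w`, the factor being its value on the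
  -- normal vector.
  have htan : ∀ w, firstCoord n w = 0 → firstCoord n (A w) = 0 := by
    intro w hw
    refine le_antisymm ?_ (hnonneg w hw.ge)
    have := hnonneg (-w) (by simp [hw])
    simpa using this
  have hform : ∀ w, firstCoord n (A w) = firstCoord n w * firstCoord n (A (normalVec n)) := by
    intro w
    have := htan (w - firstCoord n w • normalVec n) (by simp [firstCoord_normalVec])
    simp only [map_sub, map_smul, smul_eq_mul] at this
    linarith
  -- If the factor vanished, the image of `A` would consist of tangent vectors, contrary to the
  -- surjectivity of `A`.
  have hpos : 0 < firstCoord n (A (normalVec n)) := by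
    refine lt_of_le_of_ne (hnonneg _ (by simp [firstCoord_normalVec])) fun h => ?_
    obtain ⟨w, hw⟩ := hAinv.surjective (normalVec n)
    have := hform w
    rw [hw, ← h, firstCoord_normalVec] at this
    simp at this
  have hUγ : ∀ᶠ t in 𝓝[Icc (0 : ℝ) 1] 0, γ t ∈ U := hγ (hUo.mem_nhds ⟨hqs, hqs'⟩)
  have h0 : (0 : ℝ) ∈ Icc (0 : ℝ) 1 := by simp
  refine ⟨A v, ?_, ?_⟩
  · have h1 : HasDerivWithinAt (τ ∘ (e ∘ γ)) (A v) ((Icc (0 : ℝ) 1) ∩ γ ⁻¹' U) 0 :=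
      HasFDerivWithinAt.comp_hasDerivWithinAt (0 : ℝ) hτA (hv.mono inter_subset_left) fun t ht => by
        rw [hSU]
        exact mem_image_of_mem _ ht.2
    have h2 : HasDerivWithinAt (τ ∘ (e ∘ γ)) (A v) (Icc (0 : ℝ) 1) 0 :=
      h1.mono_of_mem_nhdsWithin (inter_mem self_mem_nhdsWithin hUγ)
    refine h2.congr_of_eventuallyEq_of_mem ?_ h0
    filter_upwards [hUγ] with t ht
    simp only [hτ, Function.comp_apply, e.left_inv ht.1]
  · rw [hform]
    exact mul_pos hv0 hpos

end HalfSpace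

end HQFT

end

noncomputable section

set_option linter.unusedSectionVars false

namespace HQFT

open scoped Manifold ContDiff Topology

/-! ### Extending a boundary inclusion to a map on the cylinder whose curves point inward. -/

section Push

open Set Filter

variable {n : ℕ} {M W : Type*} [TopologicalSpace M] [ChartedSpace (EuclideanSpace ℝ (Fin n)) M]
  [TopologicalSpace W] [ChartedSpace (BdSpace n) W]

/-- The curve `t ↦ c (t, x)`, extended to all real `t`. -/
def cylCurve (c : Itv × M → W) (x : M) (t : ℝ) : W := c (projIcc 0 1 zero_le_one t, x)

theorem projIcc_zero : projIcc (0 : ℝ) 1 zero_le_one 0 = (0 : Itv) :=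
  projIcc_left zero_le_one

theorem cylCurve_zero (c : Itv × M → W) (x : M) : cylCurve c x 0 = c (0, x) := by
  rw [cylCurve, projIcc_zero]

variable (n) in
/-- The curve `t ↦ c (t, x)` points strictly inward at `t = 0`. -/
def IsInward (c : Itv × M → W) (x : M) : Prop :=
  ∃ v, HasDerivWithinAt (extChartAt (bdModel n) (c (0, x)) ∘ cylCurve c x) v (Icc 0 1) 0 ∧
    0 < firstCoord n v

theorem continuous_cylCurve {c : Itv × M → W} (hc : Continuous c) (x : M) :
    Continuous (cylCurve c x) :=
  hc.comp (continuous_projIcc.prodMk continuous_const)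

variable [IsManifold (bdModel n) ∞ W]

/-- A change of charts preserves strictly inward vectors at boundary points. The definition uses the
chart at `c (0, x)`, whereas a push near `q` is computed in the chart at `q`. -/
theorem isInward_iff {c : Itv × M → W} (hc : Continuous c) {x : M} {q : W}
    (hb : c (0, x) ∈ (bdModel n).boundary W) (hq : c (0, x) ∈ (chartAt (BdSpace n) q).source) :
    IsInward n c x ↔ ∃ v, HasDerivWithinAt (extChartAt (bdModel n) q ∘ cylCurve c x) v (Icc 0 1) 0 ∧
      0 < firstCoord n v := by
  rw [← cylCurve_zero c x] at hb hq
  have hself : cylCurve c x 0 ∈ (chartAt (BdSpace n) (c (0, x))).source := by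
    rw [cylCurve_zero]
    exact mem_chart_source _ _
  have hcw := (continuous_cylCurve hc x).continuousWithinAt (s := Icc 0 1) (x := 0)
  constructor
  · rintro ⟨v, hv, hv0⟩
    exact exists_hasDerivWithinAt_chart_change hself hq hb hcw hv hv0
  · rintro ⟨v, hv, hv0⟩
    exact exists_hasDerivWithinAt_chart_change hq hself hb hcw hv hv0

variable [IsManifold (𝓡 n) ∞ M]

theorem contMDiffOn_cylCurve {c : Itv × M → W} (hc : ContMDiff (bdModel n) (bdModel n) ∞ c)
    (x : M) : ContMDiffOn 𝓘(ℝ, ℝ) (bdModel n) ∞ (cylCurve c x) (Icc 0 1) :=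
  hc.comp_contMDiffOn ((contMDiffOn_projIcc).prodMk contMDiffOn_const)

theorem differentiableWithinAt_chart_cylCurve {c : Itv × M → W}
    (hc : ContMDiff (bdModel n) (bdModel n) ∞ c) {x : M} {q : W}
    (hq : c (0, x) ∈ (chartAt (BdSpace n) q).source) :
    DifferentiableWithinAt ℝ (extChartAt (bdModel n) q ∘ cylCurve c x) (Icc 0 1) 0 := by
  have : IsManifold (bdModel n) 1 W := .of_le (n := ∞) (by simp)
  rw [← cylCurve_zero c x] at hq
  have h1 : MDifferentiableAt (bdModel n) 𝓘(ℝ, BdVec n) (extChartAt (bdModel n) q)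
    (cylCurve c x 0) := mdifferentiableAt_extChartAt hq
  have h2 := ((contMDiffOn_cylCurve hc x).mdifferentiableOn (by simp)) 0 (by simp)
  exact (h1.comp_mdifferentiableWithinAt (0 : ℝ) h2).differentiableWithinAt

/-- The bump function is shrunk to half of an admissible radius `R`, and `δ = R / 2`. A point of its
support moved by at most `δ` along the inner normal stays within distance `R` of the centre and in
the half space, hence in the target of the chart. Outside the support nothing moves. -/
theorem exists_bump [T2Space W] (q : W) : ∃ (ρ : W → ℝ) (δ : ℝ), 0 < δ ∧ ContMDiff (bdModel n) 𝓘(ℝ, ℝ) ∞ ρ ∧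
    (∀ w, 0 ≤ ρ w) ∧ 0 < ρ q ∧
    (∃ K ⊆ (chartAt (BdSpace n) q).source, IsClosed K ∧ ∀ w ∉ K, ρ w = 0) ∧
    ∀ w ∈ (chartAt (BdSpace n) q).source, ∀ s ∈ Icc (0 : ℝ) 1,
      extChartAt (bdModel n) q w + (s * (δ * ρ w)) • normalVec n ∈
        (extChartAt (bdModel n) q).target := by
  obtain ⟨f⟩ : Nonempty (SmoothBumpFunction (bdModel n) q) := inferInstance
  have hR := f.rOut_pos
  let ρ : SmoothBumpFunction (bdModel n) q :=
    ⟨⟨f.rOut / 4, f.rOut / 2, by positivity, by linarith⟩,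
      (inter_subset_inter_left _ (Metric.closedBall_subset_closedBall (by linarith))).trans
        f.closedBall_subset⟩
  refine ⟨ρ, f.rOut / 2, by positivity, ρ.contMDiff, fun w => ρ.nonneg, by simp,
    ⟨tsupport ρ, ρ.tsupport_subset_chartAt_source, isClosed_closure, fun w hw =>
      image_eq_zero_of_notMem_tsupport hw⟩, fun w hw s hs => ?_⟩
  by_cases h : ρ w = 0
  · rw [h, mul_zero, mul_zero, zero_smul, add_zero]
    exact (extChartAt (bdModel n) q).map_source (by rwa [extChartAt_source])
  · have h1 : w ∈ Function.support ρ := h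
    rw [ρ.support_eq_inter_preimage] at h1
    have h2 : dist (extChartAt (bdModel n) q w) (extChartAt (bdModel n) q q) < f.rOut / 2 := h1.2
    have h3 : 0 ≤ s * (f.rOut / 2 * ρ w) :=
      mul_nonneg hs.1 (mul_nonneg (by positivity) ρ.nonneg)
    refine f.closedBall_subset ⟨?_, ?_⟩
    · have h4 : s * (f.rOut / 2 * ρ w) ≤ f.rOut / 2 := by
        have := mul_le_mul hs.2 (mul_le_of_le_one_right (by positivity : 0 ≤ f.rOut / 2)
          (ρ.le_one (x := w))) (mul_nonneg (by positivity) ρ.nonneg) zero_le_one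
        simpa using this
      rw [Metric.mem_closedBall]
      refine (dist_triangle _ (extChartAt (bdModel n) q w) _).trans ?_
      rw [dist_self_add_left, norm_smul, norm_normalVec, Real.norm_eq_abs, abs_of_nonneg h3]
      linarith
    · rw [mem_range_bdModel, map_add, map_smul, firstCoord_normalVec]
      have := firstCoord_extChartAt_nonneg (n := n) q w
      simp only [smul_eq_mul, mul_one]
      linarith

/-- Pushing a map `c` on a cylinder inward near the point `q`. -/
theorem exists_push [T2Space W] (q : W) : ∃ V ∈ 𝓝 q, ∀ c : Itv × M → W,
    ContMDiff (bdModel n) (bdModel n) ∞ c → ∃ c' : Itv × M → W,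
      ContMDiff (bdModel n) (bdModel n) ∞ c' ∧ (∀ x, c' (0, x) = c (0, x)) ∧
      ∀ x, c (0, x) ∈ (bdModel n).boundary W →
        (IsInward n c x → IsInward n c' x) ∧ (c (0, x) ∈ V → IsInward n c' x) := by
  classical
  obtain ⟨ρ, δ, hδ, hρ, hρ0, hρq, ⟨K, hK, hKc, hρK⟩, htarget⟩ := exists_bump (n := n) q
  set e := extChartAt (bdModel n) q with he
  have hes : e.source = (chartAt (BdSpace n) q).source := extChartAt_source _ _
  refine ⟨{w | 0 < ρ w} ∩ e.source, inter_mem ((isOpen_lt continuous_const hρ.continuous).mem_nhds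
    hρq) (extChartAt_source_mem_nhds q), fun c hc => ?_⟩
  -- In the chart at `q` the point `c (t, x)` is moved along the inner normal by `t δ ρ`. The factor
  -- `t` keeps `c (0, x)` fixed, and the vanishing of `ρ` off `K` makes the two definitions fit
  -- together smoothly.
  set c' : Itv × M → W := fun p => if c p ∈ e.source then
    e.symm (e (c p) + (p.1.1 * (δ * ρ (c p))) • normalVec n) else c p with hc'
  have hc'0 : ∀ x, c' (0, x) = c (0, x) := by
    intro x
    simp only [hc']
    split_ifs with h
    · simp [e.left_inv h]
    · rfl
  have hoff : ∀ p, c p ∉ K → c' p = c p := by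
    intro p hp
    simp only [hc', hρK _ hp]
    split_ifs with h
    · simp [e.left_inv h]
    · rfl
  have hoff' : ∀ p, c p ∉ e.source → c' =ᶠ[𝓝 p] c := by
    intro p hp
    have h1 : c p ∉ K := fun h => hp (hes ▸ hK h)
    filter_upwards [(hKc.isOpen_compl.preimage hc.continuous).mem_nhds h1] with p' hp'
    exact hoff p' hp'
  have hc's : ContMDiff (bdModel n) (bdModel n) ∞ c' := by
    intro p
    by_cases hp : c p ∈ e.source
    · have hU : IsOpen (c ⁻¹' e.source) := (isOpen_extChartAt_source q).preimage hc.continuous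
      have h1 : ContMDiffOn (bdModel n) 𝓘(ℝ, BdVec n) ∞ (fun p => e (c p)) (c ⁻¹' e.source) :=
        (contMDiffOn_extChartAt (x := q)).comp hc.contMDiffOn fun z hz => hes ▸ hz
      have h2 : ContMDiff (bdModel n) 𝓘(ℝ, ℝ) ∞ (fun p : Itv × M => p.1.1 * (δ * ρ (c p))) :=
        (contMDiff_subtypeVal_Icc.comp contMDiff_fst).mul (contMDiff_const.mul (hρ.comp hc))
      have h3 : ContMDiffOn (bdModel n) 𝓘(ℝ, BdVec n) ∞
          (fun p : Itv × M => e (c p) + (p.1.1 * (δ * ρ (c p))) • normalVec n) (c ⁻¹' e.source) :=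
        h1.add (h2.smul contMDiff_const).contMDiffOn
      have h4 := (contMDiffOn_extChartAt_symm (I := bdModel n) (n := ∞) q).comp h3
        fun z hz => htarget (c z) (hes ▸ hz) z.1.1 z.1.2
      refine (h4.contMDiffAt (hU.mem_nhds hp)).congr_of_eventuallyEq ?_
      filter_upwards [hU.mem_nhds hp] with z hz
      simp only [hc']
      rw [if_pos (show c z ∈ e.source from hz)]
      rfl
    · exact hc.contMDiffAt.congr_of_eventuallyEq (hoff' p hp)
  refine ⟨c', hc's, hc'0, fun x hb => ?_⟩
  have hb' : c' (0, x) ∈ (bdModel n).boundary W := by rwa [hc'0]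
  by_cases hx : c (0, x) ∈ e.source
  · have hx1 : c (0, x) ∈ (chartAt (BdSpace n) q).source := hes ▸ hx
    have hx1' : c' (0, x) ∈ (chartAt (BdSpace n) q).source := by rwa [hc'0]
    -- At `t = 0` the push adds `δ ρ (c (0, x))` times the normal vector to the velocity `v`: the
    -- derivative of `t ↦ t δ ρ` at zero involves only the value of `ρ` there.
    have key : ∀ v, HasDerivWithinAt (e ∘ cylCurve c x) v (Icc 0 1) 0 →
        0 < firstCoord n v + δ * ρ (c (0, x)) → IsInward n c' x := by
      intro v hv hpos
      rw [isInward_iff hc's.continuous hb' hx1']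
      refine ⟨v + (δ * ρ (c (0, x))) • normalVec n, ?_, by
        simpa [firstCoord_normalVec] using hpos⟩
      have h1 : DifferentiableWithinAt ℝ (ρ ∘ cylCurve c x) (Icc 0 1) 0 := by
        have h2 := ((contMDiffOn_cylCurve hc x).mdifferentiableOn (by simp)) 0 (by simp)
        exact ((hρ.mdifferentiable (by simp) _).comp_mdifferentiableWithinAt (0 : ℝ)
          h2).differentiableWithinAt
      have h2 : HasDerivWithinAt (fun t : ℝ => t * (δ * ρ (cylCurve c x t)))
          (δ * ρ (c (0, x))) (Icc 0 1) 0 := by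
        have := (hasDerivWithinAt_id (0 : ℝ) (Icc 0 1)).mul (h1.hasDerivWithinAt.const_mul δ)
        simpa [cylCurve_zero, Pi.mul_def] using this
      have h3 := hv.add (h2.smul_const (normalVec n))
      refine h3.congr_of_eventuallyEq_of_mem ?_ (by simp)
      have h4 : ∀ᶠ t in 𝓝[Icc (0 : ℝ) 1] 0, cylCurve c x t ∈ e.source :=
        (continuous_cylCurve hc.continuous x).continuousWithinAt
          ((isOpen_extChartAt_source q).mem_nhds (by rwa [cylCurve_zero]))
      filter_upwards [h4, self_mem_nhdsWithin] with t ht ht'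
      have h5 : cylCurve c' x t = e.symm (e (cylCurve c x t) +
          (t * (δ * ρ (cylCurve c x t))) • normalVec n) := by
        simp only [cylCurve, hc']
        rw [if_pos (show c (projIcc 0 1 zero_le_one t, x) ∈ e.source from ht),
          projIcc_of_mem zero_le_one ht']
      rw [Function.comp_apply, h5, e.right_inv (htarget _ (hes ▸ ht) t ht')]
      rfl
    have hρx : 0 ≤ δ * ρ (c (0, x)) := mul_nonneg hδ.le (hρ0 _)
    constructor
    · intro h
      obtain ⟨v, hv, hv0⟩ := (isInward_iff hc.continuous hb hx1).1 h
      exact key v hv (by positivity)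
    · rintro ⟨h1, -⟩
      -- With no assumption on the velocity, its first coordinate is nonnegative, since the curve
      -- starts on the boundary and stays in the half space. The strictly positive term `δ ρ` then
      -- makes the new velocity strictly inward.
      have hd := (differentiableWithinAt_chart_cylCurve hc hx1).hasDerivWithinAt
      refine key _ hd (add_pos_of_nonneg_of_pos ?_ (mul_pos hδ h1))
      refine firstCoord_nonneg_of_hasDerivWithinAt hd ?_ fun t => firstCoord_extChartAt_nonneg _ _
      rw [Function.comp_apply, cylCurve_zero]
      exact (mem_boundary_iff_firstCoord hx1).1 hb
  -- Outside the domain of the chart, `c'` coincides with `c` near `(0, x)`, and the second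
  -- assertion is void.
  · refine ⟨fun ⟨v, hv, hv0⟩ => ⟨v, ?_, hv0⟩, fun h => absurd h.2 hx⟩
    rw [hc'0]
    refine hv.congr_of_eventuallyEq_of_mem ?_ (by simp)
    have h1 : Tendsto (fun t : ℝ => ((projIcc (0 : ℝ) 1 zero_le_one t, x) : Itv × M))
        (𝓝[Icc (0 : ℝ) 1] 0) (𝓝 (0, x)) := by
      have : Continuous fun t : ℝ => ((projIcc (0 : ℝ) 1 zero_le_one t, x) : Itv × M) :=
        continuous_projIcc.prodMk continuous_const
      have h2 := this.tendsto 0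
      rw [projIcc_zero] at h2
      exact h2.mono_left nhdsWithin_le_nhds
    filter_upwards [h1.eventually (hoff' _ hx)] with t ht
    simp only [Function.comp_apply, cylCurve, ht]

/-- A smooth map `f` into the boundary extends to a map on the cylinder pointing strictly
inward. -/
theorem exists_isInward [CompactSpace M] [T2Space W] {f : M → W} (hf : ContMDiff (𝓡 n) (bdModel n) ∞ f)
    (hb : ∀ x, f x ∈ (bdModel n).boundary W) : ∃ c : Itv × M → W,
      ContMDiff (bdModel n) (bdModel n) ∞ c ∧ (∀ x, c (0, x) = f x) ∧ ∀ x, IsInward n c x := by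
  classical
  choose V hV hpush using fun q : W => exists_push (M := M) (n := n) q
  obtain ⟨s, hs⟩ := (isCompact_range hf.continuous).elim_nhds_subcover V fun q _ => hV q
  -- The pushes are made one after another, starting from the map constant in `t`. Each preserves
  -- the curves that already point inward and corrects those starting in `V q`; finitely many sets
  -- `V q` cover the compact set `f (M)`.
  have key : ∀ s : Finset W, ∃ c : Itv × M → W, ContMDiff (bdModel n) (bdModel n) ∞ c ∧
      (∀ x, c (0, x) = f x) ∧ ∀ x, ∀ q ∈ s, f x ∈ V q → IsInward n c x := by
    intro s
    induction s using Finset.induction_on with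
    | empty => exact ⟨fun p => f p.2, hf.comp contMDiff_snd, fun _ => rfl, by simp⟩
    | insert q s _ ih =>
      obtain ⟨c, hc, hc0, hcs⟩ := ih
      obtain ⟨c', hc', hc'0, hc's⟩ := hpush q c hc
      refine ⟨c', hc', fun x => (hc'0 x).trans (hc0 x), fun x q' hq' hx => ?_⟩
      have h := hc's x (by rw [hc0]; exact hb x)
      rcases Finset.mem_insert.1 hq' with rfl | hq'
      · exact h.2 (by rwa [hc0])
      · exact h.1 (hcs x q' hq' hx)
  obtain ⟨c, hc, hc0, hcs⟩ := key s
  refine ⟨c, hc, hc0, fun x => ?_⟩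
  have := hs.2 (mem_range_self x)
  simp only [mem_iUnion] at this
  obtain ⟨q, hq, hx⟩ := this
  exact hcs x q hq hx

end Push

end HQFT

end

noncomputable section

set_option linter.unusedSectionVars false

namespace HQFT

open scoped Manifold ContDiff Topology

/-! ### An inward extension of an oriented boundary embedding preserves orientations at the
boundary. -/

section Inward

open Set Filter

variable {n : ℕ} {M W : Type*} [TopologicalSpace M] [ChartedSpace (EuclideanSpace ℝ (Fin n)) M]
  [TopologicalSpace W] [ChartedSpace (BdSpace n) W] [IsManifold (bdModel n) ∞ W]
  [IsManifold (𝓡 n) ∞ M]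

/-- The unit tangent vector of `[0, 1]` at `t`. -/
def unitTangent (t : Itv) : EuclideanSpace ℝ (Fin 1) := (1 : TangentSpace (𝓡∂ 1) t)

theorem dt_unitTangent (t : Itv) : dt t (unitTangent t) = 1 := mfderiv_subtypeVal_Icc_one t

theorem dt_smul_unitTangent (t : Itv) (f : EuclideanSpace ℝ (Fin 1)) :
    dt t f • unitTangent t = f := by
  have h0 : unitTangent t ≠ 0 := by
    intro h
    have := dt_unitTangent t
    rw [h, map_zero] at this
    exact zero_ne_one this
  obtain ⟨c, rfl⟩ := exists_smul_eq_of_finrank_eq_one (K := ℝ) (by simp) h0 f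
  rw [map_smul, dt_unitTangent, smul_eq_mul, mul_one]

theorem finrank_bdVec : Module.finrank ℝ (BdVec n) = n + 1 := by
  simp [add_comm]

/-- The velocity of a curve `t ↦ c (t, x)` in a chart. -/
theorem hasDerivWithinAt_cylCurve {c : Itv × M → W} (hc : ContMDiff (bdModel n) (bdModel n) ∞ c)
    {x : M} {q : W} (hq : c (0, x) ∈ (chartAt (BdSpace n) q).source) :
    HasDerivWithinAt (extChartAt (bdModel n) q ∘ cylCurve c x)
      ((mfderiv (bdModel n) 𝓘(ℝ, BdVec n) (extChartAt (bdModel n) q) (c (0, x)) :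
        BdVec n →L[ℝ] BdVec n) ((mfderiv (bdModel n) (bdModel n) c (0, x) :
          BdVec n →L[ℝ] BdVec n) (unitTangent 0, 0))) (Icc 0 1) 0 := by
  have : IsManifold (bdModel n) 1 W := .of_le (n := ∞) (by simp)
  have h1 : HasMFDerivWithinAt 𝓘(ℝ, ℝ) (𝓡∂ 1) (projIcc (0 : ℝ) 1 zero_le_one) (Icc 0 1) 0
      (mfderivWithin 𝓘(ℝ, ℝ) (𝓡∂ 1) (projIcc (0 : ℝ) 1 zero_le_one) (Icc 0 1) 0) :=
    ((contMDiffOn_projIcc (n := 1) 0 (by simp)).mdifferentiableWithinAt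
      one_ne_zero).hasMFDerivWithinAt
  have h2 := h1.prodMk (hasMFDerivWithinAt_const (I := 𝓘(ℝ, ℝ)) (I' := 𝓡 n) x (Icc (0 : ℝ) 1) 0)
  -- The projection of `0` to the interval equals its left endpoint only by a proof, so the
  -- derivatives at `(0, x)` are carried over along this equality before they are composed.
  have hι : ((projIcc (0 : ℝ) 1 zero_le_one 0, x) : Itv × M) = (0, x) := by rw [projIcc_zero]
  have h3 : HasMFDerivAt (bdModel n) (bdModel n) c (projIcc (0 : ℝ) 1 zero_le_one 0, x)
      (mfderiv (bdModel n) (bdModel n) c (0, x) : BdVec n →L[ℝ] BdVec n) := by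
    have h := (hc.mdifferentiable (by simp) (0, x)).hasMFDerivAt
    rw [← hι] at h ⊢
    exact h
  have h4 : HasMFDerivAt (bdModel n) 𝓘(ℝ, BdVec n) (extChartAt (bdModel n) q)
      (c (projIcc (0 : ℝ) 1 zero_le_one 0, x))
      (mfderiv (bdModel n) 𝓘(ℝ, BdVec n) (extChartAt (bdModel n) q) (c (0, x)) :
        BdVec n →L[ℝ] BdVec n) := by
    have h := (mdifferentiableAt_extChartAt (I := bdModel n) hq).hasMFDerivAt
    rw [← hι] at h ⊢
    exact h
  have h5 := (h4.comp_hasMFDerivWithinAt (0 : ℝ) (h3.comp_hasMFDerivWithinAt (0 : ℝ) h2))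
  have h6 := HasFDerivWithinAt.hasDerivWithinAt (𝕜 := ℝ) (F := BdVec n) h5.hasFDerivWithinAt
  refine h6.congr_deriv ?_
  have h7 : ∀ t : Itv, t = 0 → unitTangent t = unitTangent 0 := by
    rintro _ rfl
    rfl
  have h8 : (mfderivWithin 𝓘(ℝ, ℝ) (𝓡∂ 1) (projIcc (0 : ℝ) 1 zero_le_one) (Icc 0 1) 0 :
      ℝ →L[ℝ] EuclideanSpace ℝ (Fin 1)) 1 = unitTangent 0 :=
    (mfderivWithin_projIcc_one (by simp)).trans (h7 _ projIcc_zero)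
  rw [← h8]
  rfl

/-- If `c (0, ·)` is an oriented boundary embedding of `-M` and `c` points inward at `(0, x)`, then
`c` preserves the orientation at `(0, x)`. -/
theorem linPreserves_of_isInward {oM : ManifoldOrientation (𝓡 n) M n}
    {oW : ManifoldOrientation (bdModel n) W (n + 1)} {c : Itv × M → W}
    (hc : ContMDiff (bdModel n) (bdModel n) ∞ c)
    (hf : IsBoundaryEmbedding (-oM) oW fun x => c (0, x)) {x : M} (hx : IsInward n c x) :
    have : IsManifold (𝓡 n) 1 M := .of_le (n := ∞) (by simp)
    LinPreserves (mfderiv (bdModel n) (bdModel n) c (0, x) : BdVec n →L[ℝ] BdVec n).toLinearMap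
      (oM.cylinder.at' (0, x)) (oW.at' (c (0, x))) := by
  intro this
  suffices h : ∀ θ : BdVec n [⋀^Fin (n + 1)]→ₗ[ℝ] ℝ, IsPositive (oW.at' (c (0, x))) θ →
      IsPositive (oM.cylinder.at' (0, x)) (θ.compLinearMap
        (mfderiv (bdModel n) (bdModel n) c (0, x) : BdVec n →L[ℝ] BdVec n).toLinearMap) from h
  intro θ hθ
  set D : BdVec n →L[ℝ] BdVec n := mfderiv (bdModel n) (bdModel n) c (0, x) with hD
  set v : BdVec n := D (unitTangent 0, 0) with hv
  obtain ⟨v₀, hv₀, hpos⟩ := hx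
  have h1 := hasDerivWithinAt_cylCurve hc (mem_chart_source (BdSpace n) (c (0, x)))
  have h2 := (uniqueDiffOn_Icc zero_lt_one (0 : ℝ) (by simp)).eq_deriv (Icc (0 : ℝ) 1) hv₀ h1
  rw [h2] at hpos
  -- The velocity `v` is inward, so `-v` is an outward vector to which the rule defining the
  -- boundary orientation applies.
  have hout : IsOutward (c (0, x)) (-v : BdVec n) := by
    have h3 : ∀ G : BdVec n →L[ℝ] BdVec n, 0 < firstCoord n (G v) → firstCoord n (G (-v)) < 0 := by
      intro G hG
      rw [map_neg, map_neg]
      exact neg_neg_of_pos hG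
    exact h3 _ hpos
  have h4 := hf.orientation x θ hθ (-v) hout
  set Df : EuclideanSpace ℝ (Fin n) →L[ℝ] BdVec n :=
    mfderiv (𝓡 n) (bdModel n) (fun y : M => c (0, y)) x with hDf
  have hDf' : ∀ w, Df w = D (0, w) := by
    intro w
    have h5 := mfderiv_comp (I' := bdModel n) x
      (hc.mdifferentiable (by simp) ((0 : Itv), x))
      ((contMDiff_const (c := (0 : Itv))).prodMk (contMDiff_id (I := 𝓡 n) (M := M) (n := ∞))
        |>.mdifferentiable (by simp) x)
    have h6 : (c ∘ Prod.mk (0 : Itv)) = fun y => c (0, y) := rfl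
    rw [h6] at h5
    rw [hDf, h5]
    have h7 : mfderiv (𝓡 n) (bdModel n) (Prod.mk (0 : Itv) : M → Itv × M) x = _ := mfderiv_prod_right
    rw [h7]
    rfl
  set η := (θ.curryLeft v).compLinearMap Df.toLinearMap with hη
  have h5 : (θ.curryLeft (-v)).compLinearMap Df.toLinearMap = -η := by
    have h6 : θ.curryLeft (-v) = -θ.curryLeft v := map_neg θ.curryLeft v
    rw [h6]
    rfl
  -- Two signs cancel: that of the outward vector `-v` and that of the boundary orientation `-oM`.
  have h6 : IsPositive (oM.at' x) η := by
    have h7 : IsPositive ((-oM).at' x) (-η) := h5 ▸ h4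
    have h8 : IsPositive (E := EuclideanSpace ℝ (Fin n)) (oM.at' x) (- -η) := isPositive_neg.1 h7
    rwa [neg_neg] at h8
  -- The pullback of `θ` is a top form on the product of the line and the tangent space of `M`, so
  -- it equals `dt ∧ η` once its contraction with the unit vector of the interval is `η`.
  have h7 : θ.compLinearMap D.toLinearMap = wedge (dt 0) η := by
    rw [eq_wedge (by simp) (θ.compLinearMap D.toLinearMap) (dt_unitTangent 0)
      (dt_smul_unitTangent 0)]
    congr 1
    ext w
    simp only [hη, AlternatingMap.compLinearMap_apply, AlternatingMap.curryLeft_apply_apply]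
    refine congrArg θ (funext fun i => ?_)
    refine Fin.cases rfl (fun j => ?_) i
    exact (hDf' (w j)).symm
  exact (isPositive_prodOrientation_iff (dt_ne_zero 0)).2 ⟨η, h6, h7⟩

end Inward

end HQFT

end

noncomputable section

set_option linter.unusedSectionVars false

namespace HQFT

open scoped Manifold ContDiff Topology

/-! ### Product maps and product orientations. -/

section ProdMap

variable {E F E' F' : Type*} [AddCommGroup E] [Module ℝ E] [AddCommGroup F] [Module ℝ F]
  [AddCommGroup E'] [Module ℝ E'] [AddCommGroup F'] [Module ℝ F'] {k : ℕ}

theorem wedge_smul_left (c : ℝ) (τ : F →ₗ[ℝ] ℝ) (θ : E [⋀^Fin k]→ₗ[ℝ] ℝ) :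
    wedge (c • τ) θ = wedge τ (c • θ) := by
  ext w
  rw [wedge, wedge, AlternatingMap.alternatizeUncurryFin_apply,
    AlternatingMap.alternatizeUncurryFin_apply]
  refine Finset.sum_congr rfl fun i _ => ?_
  simp
  ring

/-- A product map which multiplies the coordinate of the line by `r > 0` and preserves the
orientations of the other factor preserves the product orientations. -/
theorem LinPreserves.prodMap_of_pos {τ : F →ₗ[ℝ] ℝ} (hτ : τ ≠ 0) {τ' : F' →ₗ[ℝ] ℝ} (hτ' : τ' ≠ 0)
    {r : ℝ} (hr : 0 < r) {B : F' →ₗ[ℝ] F} (hB : τ ∘ₗ B = r • τ') {A : E' →ₗ[ℝ] E}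
    {a : Orientation ℝ E' (Fin k)} {b : Orientation ℝ E (Fin k)} (hA : LinPreserves A a b) :
    LinPreserves (B.prodMap A) (prodOrientation τ' hτ' a) (prodOrientation τ hτ b) := by
  intro Ω hΩ
  rw [isPositive_prodOrientation_iff] at hΩ ⊢
  obtain ⟨θ, hθ, rfl⟩ := hΩ
  exact ⟨_, (hA θ hθ).smul hr, by rw [wedge_comp, hB, wedge_smul_left]⟩

/-- Reversing the line changes the sign of the product orientation, and so does reversing the other
factor. This is why a cylinder on `M` read backwards is a cylinder on `-M`. -/
theorem LinPreserves.prodMap_of_neg {τ : F →ₗ[ℝ] ℝ} (hτ : τ ≠ 0) {τ' : F' →ₗ[ℝ] ℝ} (hτ' : τ' ≠ 0)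
    {r : ℝ} (hr : r < 0) {B : F' →ₗ[ℝ] F} (hB : τ ∘ₗ B = r • τ') {A : E' →ₗ[ℝ] E}
    {a : Orientation ℝ E' (Fin k)} {b : Orientation ℝ E (Fin k)} (hA : LinPreserves A a b) :
    LinPreserves (B.prodMap A) (prodOrientation τ' hτ' a) (prodOrientation τ hτ (-b)) := by
  intro Ω hΩ
  rw [isPositive_prodOrientation_iff] at hΩ ⊢
  obtain ⟨θ, hθ, rfl⟩ := hΩ
  rw [isPositive_neg] at hθ
  refine ⟨_, (hA _ hθ).smul (neg_pos.2 hr), ?_⟩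
  rw [wedge_comp, hB, wedge_smul_left]
  congr 1
  ext w
  simp

end ProdMap

/-! ### Reparametrizations of the interval and of cylinders. -/

section Reparametrization

variable {n : ℕ} {M N : Type*} [TopologicalSpace M] [ChartedSpace (EuclideanSpace ℝ (Fin n)) M]
  [IsManifold (𝓡 n) 1 M] [TopologicalSpace N] [ChartedSpace (EuclideanSpace ℝ (Fin n)) N]
  [IsManifold (𝓡 n) 1 N]

theorem contMDiff_itv {f : Itv → Itv} {F : ℝ → ℝ} (hF : ContDiff ℝ ∞ F)
    (hf : ∀ t, (f t : ℝ) = F t) : ContMDiff (𝓡∂ 1) (𝓡∂ 1) ∞ f := by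
  rw [contMDiff_iff_comp_subtypeVal_Icc]
  have h : Subtype.val ∘ f = F ∘ Subtype.val := funext hf
  rw [h]
  exact ⟨continuous_induced_rng.2 (h ▸ hF.continuous.comp continuous_subtype_val),
    hF.contMDiff.comp (contMDiff_subtypeVal_Icc (x := (0 : ℝ)) (y := 1))⟩

/-- Both sides are derivatives of the same map, since the inclusion of the interval in `ℝ`
intertwines `f` and `F`. This determines the sign of the derivative of `f` without its charts. -/
theorem dt_comp_mfderiv {f : Itv → Itv} {F : ℝ → ℝ} (hF : ContDiff ℝ ∞ F)
    (hf : ∀ t, (f t : ℝ) = F t) (t : Itv) :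
    dt (f t) ∘ₗ (mfderiv (𝓡∂ 1) (𝓡∂ 1) f t :
      EuclideanSpace ℝ (Fin 1) →L[ℝ] EuclideanSpace ℝ (Fin 1)).toLinearMap =
      deriv F t • dt t := by
  have hv : ∀ s : Itv, MDifferentiableAt (𝓡∂ 1) 𝓘(ℝ, ℝ) (Subtype.val : Itv → ℝ) s := fun s =>
    (contMDiff_subtypeVal_Icc (x := (0 : ℝ)) (y := 1) (n := ∞)).mdifferentiable (by simp) s
  have hF' : MDifferentiableAt 𝓘(ℝ, ℝ) 𝓘(ℝ, ℝ) F t :=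
    (hF.differentiable (by simp) _).mdifferentiableAt
  have h1 := mfderiv_comp t (hv (f t)) ((contMDiff_itv hF hf).mdifferentiable (by simp) t)
  have h2 := mfderiv_comp t hF' (hv t)
  have h : Subtype.val ∘ f = F ∘ Subtype.val := funext hf
  rw [h] at h1
  have h3 := h1.symm.trans h2
  have h4 : ∀ v : EuclideanSpace ℝ (Fin 1), dt (f t) ((mfderiv (𝓡∂ 1) (𝓡∂ 1) f t :
      EuclideanSpace ℝ (Fin 1) →L[ℝ] EuclideanSpace ℝ (Fin 1)) v) =
      (mfderiv 𝓘(ℝ, ℝ) 𝓘(ℝ, ℝ) F t : ℝ →L[ℝ] ℝ) (dt t v) := fun v =>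
    congrArg (fun L : EuclideanSpace ℝ (Fin 1) →L[ℝ] ℝ => L v) h3
  ext1 v
  refine (h4 v).trans ?_
  rw [mfderiv_eq_fderiv]
  have h5 : ∀ r : ℝ, (fderiv ℝ F t : ℝ →L[ℝ] ℝ) r = deriv F t * r := by
    intro r
    rw [← fderiv_apply_one_eq_deriv]
    simp [mul_comm]
  exact h5 _

theorem mfderiv_prodMap_itv {f : Itv → Itv} {F : ℝ → ℝ} (hF : ContDiff ℝ ∞ F)
    (hf : ∀ t, (f t : ℝ) = F t) {ψ : M → N} (hψ : ContMDiff (𝓡 n) (𝓡 n) ∞ ψ) (p : Itv × M) :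
    (mfderiv (bdModel n) (bdModel n) (Prod.map f ψ) p : BdVec n →L[ℝ] BdVec n).toLinearMap =
      (mfderiv (𝓡∂ 1) (𝓡∂ 1) f p.1 :
        EuclideanSpace ℝ (Fin 1) →L[ℝ] EuclideanSpace ℝ (Fin 1)).toLinearMap.prodMap
      (mfderiv (𝓡 n) (𝓡 n) ψ p.2 :
        EuclideanSpace ℝ (Fin n) →L[ℝ] EuclideanSpace ℝ (Fin n)).toLinearMap := by
  have h := mfderiv_prodMap (p := p) ((contMDiff_itv hF hf).mdifferentiable (by simp) p.1)
    (hψ.mdifferentiable (by simp) p.2)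
  rw [h]
  rfl

theorem preservesOrientation_prodMap {f : Itv → Itv} {F : ℝ → ℝ} (hF : ContDiff ℝ ∞ F)
    (hf : ∀ t, (f t : ℝ) = F t) (hpos : ∀ t : Itv, 0 < deriv F t) {ψ : M → N}
    (hψ : ContMDiff (𝓡 n) (𝓡 n) ∞ ψ) {oM : ManifoldOrientation (𝓡 n) M n}
    {oN : ManifoldOrientation (𝓡 n) N n} (ho : PreservesOrientation oM oN ψ) :
    PreservesOrientation oM.cylinder oN.cylinder (Prod.map f ψ) := by
  intro p
  rw [mfderiv_prodMap_itv hF hf hψ]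
  exact LinPreserves.prodMap_of_pos (dt_ne_zero _) (dt_ne_zero _) (hpos p.1) (dt_comp_mfderiv hF hf p.1) (ho p.2)

theorem preservesOrientation_prodMap_neg {f : Itv → Itv} {F : ℝ → ℝ} (hF : ContDiff ℝ ∞ F)
    (hf : ∀ t, (f t : ℝ) = F t) (hneg : ∀ t : Itv, deriv F t < 0) {ψ : M → N}
    (hψ : ContMDiff (𝓡 n) (𝓡 n) ∞ ψ) {oM : ManifoldOrientation (𝓡 n) M n}
    {oN : ManifoldOrientation (𝓡 n) N n} (ho : PreservesOrientation oM oN ψ) :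
    PreservesOrientation oM.cylinder (-oN).cylinder (Prod.map f ψ) := by
  intro p
  rw [mfderiv_prodMap_itv hF hf hψ]
  exact LinPreserves.prodMap_of_neg (dt_ne_zero _) (dt_ne_zero _) (hneg p.1) (dt_comp_mfderiv hF hf p.1) (ho p.2)

/-- The affine map `t ↦ a + b t` of the unit interval. -/
def affItv (a b : ℝ) (h0 : 0 ≤ a) (h1 : a ≤ 1) (h2 : 0 ≤ a + b) (h3 : a + b ≤ 1) (t : Itv) : Itv :=
  ⟨a + b * t, by
    obtain ⟨t, ht0, ht1⟩ := t
    constructor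
    · change 0 ≤ a + b * t
      nlinarith
    · change a + b * t ≤ 1
      nlinarith⟩

variable {a b : ℝ} {h0 : 0 ≤ a} {h1 : a ≤ 1} {h2 : 0 ≤ a + b} {h3 : a + b ≤ 1}

theorem contDiff_aff (a b : ℝ) : ContDiff ℝ ∞ fun t : ℝ => a + b * t :=
  contDiff_const.add (contDiff_const.mul contDiff_id)

theorem deriv_aff (a b t : ℝ) : deriv (fun t : ℝ => a + b * t) t = b := by
  simp

theorem contMDiff_affItv : ContMDiff (𝓡∂ 1) (𝓡∂ 1) ∞ (affItv a b h0 h1 h2 h3) :=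
  contMDiff_itv (contDiff_aff a b) fun _ => rfl

theorem injective_affItv (hb : b ≠ 0) : Function.Injective (affItv a b h0 h1 h2 h3) := by
  intro s t h
  have h' : a + b * (s : ℝ) = a + b * t := congrArg Subtype.val h
  exact Subtype.ext (mul_left_cancel₀ hb (add_left_cancel h'))

theorem preservesOrientation_affItv (hb : 0 < b) (oM : ManifoldOrientation (𝓡 n) M n) :
    PreservesOrientation oM.cylinder oM.cylinder (Prod.map (affItv a b h0 h1 h2 h3) id) :=
  preservesOrientation_prodMap (contDiff_aff a b) (fun _ => rfl)
    (fun t => by rw [deriv_aff]; exact hb) contMDiff_id (.id oM)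

theorem preservesOrientation_affItv_neg (hb : b < 0) (oM : ManifoldOrientation (𝓡 n) M n) :
    PreservesOrientation oM.cylinder (-oM).cylinder (Prod.map (affItv a b h0 h1 h2 h3) id) :=
  preservesOrientation_prodMap_neg (contDiff_aff a b) (fun _ => rfl)
    (fun t => by rw [deriv_aff]; exact hb) contMDiff_id (.id oM)

theorem preservesOrientation_affItv_neg' (hb : b < 0) (oM : ManifoldOrientation (𝓡 n) M n) :
    PreservesOrientation (-oM).cylinder oM.cylinder (Prod.map (affItv a b h0 h1 h2 h3) id) := by
  have h := preservesOrientation_affItv_neg (h0 := h0) (h1 := h1) (h2 := h2) (h3 := h3) hb (-oM)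
  rwa [ManifoldOrientation.neg_neg] at h

end Reparametrization

end HQFT

end

noncomputable section

set_option linter.unusedSectionVars false

namespace HQFT

open scoped Manifold ContDiff Topology

/-! ### Openness of smooth maps at interior points. -/

section InverseFunction

open Set Filter

variable {E : Type*} [NormedAddCommGroup E] [NormedSpace ℝ E] [CompleteSpace E] {H : Type*}
  [TopologicalSpace H] {I : ModelWithCorners ℝ E H} {X Y : Type*} [TopologicalSpace X]
  [ChartedSpace H X] [IsManifold I ∞ X] [TopologicalSpace Y] [ChartedSpace H Y] [IsManifold I ∞ Y]

theorem map_symm_nhds_of_isInteriorPoint {x : X} (hx : I.IsInteriorPoint x) :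
    map (extChartAt I x).symm (𝓝 (extChartAt I x x)) = 𝓝 x := by
  rw [← nhdsWithin_eq_nhds.2 (mem_interior_iff_mem_nhds.1 hx)]
  exact map_extChartAt_symm_nhdsWithin_range x

/-- A smooth map with invertible derivative at an interior point is open there. -/
theorem map_nhds_of_isInteriorPoint {c : X → Y} {x : X} (hc : ContMDiffAt I I ∞ c x)
    (hinv : (mfderiv I I c x : E →L[ℝ] E).IsInvertible) (hx : I.IsInteriorPoint x) :
    map c (𝓝 x) = 𝓝 (c x) := by
  -- A surjective derivative takes interior points to interior points. In coordinates, source and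
  -- target are then neighbourhoods in `E`, where the inverse function theorem applies.
  have hy : I.IsInteriorPoint (c x) := by
    refine (hc.mdifferentiableAt (by simp)).isInteriorPoint_of_surjective_mfderiv ?_ hx
    obtain ⟨e, he⟩ := hinv
    have h : Function.Surjective (mfderiv I I c x : E →L[ℝ] E) := he ▸ e.surjective
    exact h
  set z := extChartAt I x x with hz
  set φ := extChartAt I (c x) ∘ c ∘ (extChartAt I x).symm with hφ
  have hr : range I ∈ 𝓝 z := mem_interior_iff_mem_nhds.1 hx
  have hT : (extChartAt I x).target ∈ 𝓝 z := by
    have h := extChartAt_target_mem_nhdsWithin (I := I) x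
    rwa [nhdsWithin_eq_nhds.2 hr] at h
  have h1 : ContDiffAt ℝ ∞ φ z := (contMDiffAt_iff.1 hc).2.contDiffAt hr
  have h2 := isInvertible_fderivWithin_writtenInExtChart (mem_chart_source H x)
    (mem_chart_source H (c x)) (hc.mdifferentiableAt (by simp)) hinv
    (uniqueDiffOn_extChartAt_target x _ (mem_extChartAt_target x)) subset_rfl
  rw [fderivWithin_of_mem_nhds hT] at h2
  obtain ⟨e, he⟩ := h2
  have h3 : HasStrictFDerivAt φ (e : E →L[ℝ] E) z := he ▸ h1.hasStrictFDerivAt (by simp)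
  have h4 := h3.map_nhds_eq_of_equiv
  have hsymm : (extChartAt I x).symm z = x := extChartAt_to_inv x
  have h5 : φ z = extChartAt I (c x) (c x) := by simp only [hφ, Function.comp_apply, hsymm]
  have hcont : Tendsto (c ∘ (extChartAt I x).symm) (𝓝 z) (𝓝 (c x)) := by
    rw [← Filter.tendsto_map'_iff, map_symm_nhds_of_isInteriorPoint hx]
    exact hc.continuousAt
  have h6 : (extChartAt I (c x)).symm ∘ φ =ᶠ[𝓝 z] c ∘ (extChartAt I x).symm := by
    filter_upwards [hcont (extChartAt_source_mem_nhds (I := I) (c x))] with w hw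
    exact (extChartAt I (c x)).left_inv hw
  rw [← map_symm_nhds_of_isInteriorPoint hx, map_map, ← map_congr h6, ← map_map, h4, h5,
    map_symm_nhds_of_isInteriorPoint hy]

end InverseFunction

/-! ### Existence of collars. -/

section Collar

open Set Filter

variable {n : ℕ} {M W : Type*} [TopologicalSpace M] [ChartedSpace (EuclideanSpace ℝ (Fin n)) M]
  [IsManifold (𝓡 n) ∞ M] [TopologicalSpace W] [ChartedSpace (BdSpace n) W]
  [IsManifold (bdModel n) ∞ W] [IsManifold (𝓡 n) 1 M]

/-- `c : [0, 1] × M → W` is an oriented collar of the part `c (0, M)` of the boundary of `W`,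
disjoint from `C`. -/
structure IsCollar (oM : ManifoldOrientation (𝓡 n) M n)
    (oW : ManifoldOrientation (bdModel n) W (n + 1)) (C : Set W) (c : Itv × M → W) : Prop where
  contMDiff : ContMDiff (bdModel n) (bdModel n) ∞ c
  injective : Function.Injective c
  orientation : PreservesOrientation oM.cylinder oW c
  notMem : ∀ p, c p ∉ C

variable {oM : ManifoldOrientation (𝓡 n) M n} {oW : ManifoldOrientation (bdModel n) W (n + 1)}
  {C : Set W}

/-- Take an inward extension of `f`. Along the compact set `{0} × M` it preserves orientations, is
injective and avoids `C`; each property persists on a neighbourhood, which contains some `[0, b] ×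
M`. Rescaling the interval by `b` gives the collar. -/
theorem exists_isCollar [CompactSpace M] [T2Space W] {f : M → W}
    (hf : IsBoundaryEmbedding (-oM) oW f) (hC : IsClosed C) (hfC : ∀ x, f x ∉ C) :
    ∃ c, IsCollar oM oW C c ∧ ∀ x, c (0, x) = f x := by
  obtain ⟨c, hc, hc0, hin⟩ := exists_isInward hf.contMDiff hf.mem_boundary
  have hf' : IsBoundaryEmbedding (-oM) oW fun x => c (0, x) := by
    have h : (fun x => c (0, x)) = f := funext hc0
    rwa [h]
  have hlin : ∀ x, LinPreserves (mfderiv (bdModel n) (bdModel n) c (0, x) :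
      BdVec n →L[ℝ] BdVec n).toLinearMap (oM.cylinder.at' (0, x)) (oW.at' (c (0, x))) :=
    fun x => linPreserves_of_isInward hc hf' (hin x)
  set S : Set (Itv × M) := {0} ×ˢ univ with hS
  have hSc : IsCompact S := isCompact_singleton.prod isCompact_univ
  have h1 : ∀ᶠ p in 𝓝ˢ S, LinPreserves (mfderiv (bdModel n) (bdModel n) c p :
      BdVec n →L[ℝ] BdVec n).toLinearMap (oM.cylinder.at' p) (oW.at' (c p)) := by
    rw [eventually_nhdsSet_iff_forall]
    rintro ⟨t, x⟩ ⟨rfl, -⟩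
    exact eventually_linPreserves_mfderiv finrank_bdVec hc (hlin x)
  have h2 : ∀ᶠ p in 𝓝ˢ S, c p ∉ C := by
    rw [eventually_nhdsSet_iff_forall]
    rintro ⟨t, x⟩ ⟨rfl, -⟩
    refine hc.continuous.continuousAt.eventually (hC.isOpen_compl.mem_nhds ?_)
    rw [hc0]
    exact hfC x
  -- A map injective on a compact set and locally injective at each of its points is injective on a
  -- neighbourhood of it.
  obtain ⟨T, hT, hTinj⟩ : ∃ T ∈ 𝓝ˢ S, InjOn c T := by
    refine Set.InjOn.exists_mem_nhdsSet ?_ hSc (fun p _ => hc.continuous.continuousAt) ?_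
    · rintro ⟨t, x⟩ ⟨rfl, -⟩ ⟨s, y⟩ ⟨rfl, -⟩ h
      rw [hc0, hc0] at h
      rw [hf.injective h]
    · rintro ⟨t, x⟩ ⟨rfl, -⟩
      exact exists_injOn_of_isInvertible_mfderiv (hc _) ((hlin x).isInvertible finrank_bdVec)
  have h3 := Filter.inter_mem (Filter.inter_mem h1 h2) hT
  -- Tube lemma: `M` is compact, so the neighbourhood contains a product of a neighbourhood of `0`
  -- with all of `M`.
  rw [hS, isCompact_singleton.nhdsSet_prod_eq isCompact_univ, nhdsSet_singleton, nhdsSet_univ, ← principal_univ,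
    mem_prod_principal] at h3
  obtain ⟨ε, hε, hsub⟩ := Metric.mem_nhds_iff.1 h3
  -- Half of `ε` keeps `b t < ε` up to `t = 1`, and the bound by `1` keeps `b t` in the interval.
  set b : ℝ := min (ε / 2) 1 with hb
  have hb0 : 0 < b := lt_min (half_pos hε) one_pos
  have hb1 : b ≤ 1 := min_le_right _ _
  let a := affItv 0 b le_rfl zero_le_one (by linarith) (by linarith)
  have ha : ContMDiff (bdModel n) (bdModel n) ∞ (Prod.map a id : Itv × M → Itv × M) :=
    contMDiff_affItv.prodMap contMDiff_id
  have hmem : ∀ p : Itv × M, Prod.map a id p ∈ _ := fun p =>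
    hsub (a := a p.1) (by
      rw [Metric.mem_ball, Subtype.dist_eq, Real.dist_eq]
      change |0 + b * (p.1 : ℝ) - 0| < ε
      have h0 := p.1.2.1
      have h1 := p.1.2.2
      have h2 : b ≤ ε / 2 := min_le_left _ _
      rw [zero_add, sub_zero, abs_of_nonneg (by positivity)]
      nlinarith) p.2 (mem_univ _)
  refine ⟨c ∘ Prod.map a id, ⟨hc.comp ha, ?_, ?_, ?_⟩, ?_⟩
  · intro p q h
    have h1 := hTinj (hmem p).2 (hmem q).2 h
    exact (injective_affItv hb0.ne').prodMap Function.injective_id h1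
  · intro p
    rw [mfderiv_comp p (hc.mdifferentiable (by simp) _) (ha.mdifferentiable (by simp) _)]
    exact LinPreserves.comp (hmem p).1.1 (preservesOrientation_affItv hb0 oM p)
  · exact fun p => (hmem p).1.2
  · intro x
    have h : Prod.map a id ((0, x) : Itv × M) = (0, x) := by
      refine Prod.ext (Subtype.ext ?_) rfl
      change 0 + b * (0 : ℝ) = 0
      simp
    change c (Prod.map a id (0, x)) = f x
    rw [h, hc0]

theorem IsCollar.isInvertible {c : Itv × M → W} (hc : IsCollar oM oW C c) (p : Itv × M) :
    (mfderiv (bdModel n) (bdModel n) c p : BdVec n →L[ℝ] BdVec n).IsInvertible :=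
  LinPreserves.isInvertible finrank_bdVec (hc.orientation p)

theorem isInteriorPoint_cylinder {p : Itv × M} (h0 : p.1 ≠ 0) (h1 : p.1 ≠ 1) :
    (bdModel n).IsInteriorPoint p := by
  by_contra h
  rw [← ModelWithCorners.isBoundaryPoint_iff_not_isInteriorPoint] at h
  have h2 : p ∈ (bdModel n).boundary (Itv × M) := h
  rw [boundary_cylinder] at h2
  exact h2.elim h0 h1

theorem IsCollar.map_nhds {c : Itv × M → W} (hc : IsCollar oM oW C c) {p : Itv × M}
    (h0 : p.1 ≠ 0) (h1 : p.1 ≠ 1) : map c (𝓝 p) = 𝓝 (c p) :=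
  map_nhds_of_isInteriorPoint (hc.contMDiff p) (hc.isInvertible p) (isInteriorPoint_cylinder h0 h1)

theorem IsCollar.isInteriorPoint {c : Itv × M → W} (hc : IsCollar oM oW C c) {p : Itv × M}
    (h0 : p.1 ≠ 0) (h1 : p.1 ≠ 1) : (bdModel n).IsInteriorPoint (c p) := by
  refine (hc.contMDiff.mdifferentiable (by simp) p).isInteriorPoint_of_surjective_mfderiv ?_
    (isInteriorPoint_cylinder h0 h1)
  obtain ⟨e, he⟩ := hc.isInvertible p
  have h : Function.Surjective (mfderiv (bdModel n) (bdModel n) c p : BdVec n →L[ℝ] BdVec n) :=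
    he ▸ e.surjective
  exact h

end Collar

end HQFT

end

noncomputable section

set_option linter.unusedSectionVars false

namespace HQFT

open scoped Manifold ContDiff Topology

/-! ### The half-open collar is open in `W`. -/

section CollarOpen

open Set Filter

variable {n : ℕ} {M W : Type*} [TopologicalSpace M] [ChartedSpace (EuclideanSpace ℝ (Fin n)) M]
  [IsManifold (𝓡 n) ∞ M] [TopologicalSpace W] [ChartedSpace (BdSpace n) W]
  [IsManifold (bdModel n) ∞ W] [IsManifold (𝓡 n) 1 M]

variable {oM : ManifoldOrientation (𝓡 n) M n} {oW : ManifoldOrientation (bdModel n) W (n + 1)}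
  {C : Set W}

theorem exists_itv_mem {U : Set Itv} (hU : U ∈ 𝓝 (0 : Itv)) : ∃ s ∈ U, s ≠ 0 ∧ s ≠ 1 := by
  obtain ⟨ε, hε, hsub⟩ := Metric.mem_nhds_iff.1 hU
  have h0 : 0 < min (ε / 2) (1 / 2) := lt_min (half_pos hε) (by norm_num)
  have h1 : min (ε / 2) (1 / 2) ≤ 1 / 2 := min_le_right _ _
  have h2 : min (ε / 2) (1 / 2) ≤ ε / 2 := min_le_left _ _
  refine ⟨⟨min (ε / 2) (1 / 2), h0.le, by linarith⟩, hsub ?_, ?_, ?_⟩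
  · rw [Metric.mem_ball, Subtype.dist_eq, Real.dist_eq]
    change |min (ε / 2) (1 / 2) - 0| < ε
    rw [sub_zero, abs_of_pos h0]
    linarith
  · intro h
    exact h0.ne' (congrArg Subtype.val h)
  · intro h
    have h3 : min (ε / 2) (1 / 2) = 1 := congrArg Subtype.val h
    linarith

theorem isOpen_ne_one : IsOpen {p : Itv × M | p.1 ≠ 1} :=
  isOpen_compl_singleton.preimage continuous_fst

theorem isOpen_ne_zero_ne_one : IsOpen {p : Itv × M | p.1 ≠ 0 ∧ p.1 ≠ 1} :=
  (isOpen_compl_singleton.preimage continuous_fst).inter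
    (isOpen_compl_singleton.preimage continuous_fst)

/-- The image of the half-open collar is open. -/
theorem IsCollar.isOpen_image [CompactSpace M] [T2Space W] {c : Itv × M → W}
    (hc : IsCollar oM oW C c) (hC : IsClosed C) (h0 : ∀ x, c (0, x) ∈ (bdModel n).boundary W)
    (hb : (bdModel n).boundary W ⊆ range (fun x => c (0, x)) ∪ C) :
    IsOpen (c '' {p | p.1 ≠ 1}) := by
  have hcont := hc.contMDiff.continuous
  have hV1 : IsOpen (c '' {p | p.1 ≠ 0 ∧ p.1 ≠ 1}) := by
    rw [isOpen_iff_mem_nhds]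
    rintro _ ⟨p, hp, rfl⟩
    rw [← hc.map_nhds hp.1 hp.2]
    exact image_mem_map (isOpen_ne_zero_ne_one.mem_nhds hp)
  rw [isOpen_iff_mem_nhds]
  rintro _ ⟨⟨t, x⟩, hp, rfl⟩
  by_cases ht : t = 0
  swap
  · rw [← hc.map_nhds ht hp]
    exact image_mem_map (isOpen_ne_one.mem_nhds hp)
  subst ht
  set q := c (0, x) with hq
  -- The inverse function theorem gives nothing at the boundary point `q`. The open set `O` around
  -- `q` excludes the far end of the collar and the rest of the boundary.
  set O : Set W := (c '' {p | p.1 = 1} ∪ C)ᶜ with hO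
  have hOo : IsOpen O := by
    refine (IsClosed.union (IsCompact.isClosed ?_) hC).isOpen_compl
    have h : IsClosed {p : Itv × M | p.1 = 1} := isClosed_singleton.preimage continuous_fst
    exact h.isCompact.image hcont
  have hqO : q ∈ O := by
    rintro (⟨p, hp1, hpq⟩ | h)
    · have h1 := hc.injective hpq
      have h2 : p.1 = 1 := hp1
      rw [h1] at h2
      exact zero_ne_one h2
    · exact hc.notMem _ h
  set e := extChartAt (bdModel n) q with he
  have h1 : e.symm ⁻¹' O ∈ 𝓝[range (bdModel n)] (e q) := by
    have h := hOo.mem_nhds hqO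
    rw [← map_extChartAt_symm_nhdsWithin_range (I := bdModel n) q] at h
    exact h
  obtain ⟨r, hr, hball⟩ := Metric.mem_nhdsWithin_iff.1
    (inter_mem (extChartAt_target_mem_nhdsWithin (I := bdModel n) q) h1)
  set B : Set (BdVec n) := Metric.ball (e q) r ∩ {v | 0 < firstCoord n v} with hB
  have hBr : B ⊆ Metric.ball (e q) r ∩ range (bdModel n) := fun v hv =>
    ⟨hv.1, mem_range_bdModel.2 (le_of_lt hv.2)⟩
  have hBc : IsPreconnected B :=
    ((convex_ball _ _).inter ((convex_Ioi (0 : ℝ)).linear_preimage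
      (firstCoord n).toLinearMap)).isPreconnected
  have hQc : IsPreconnected (e.symm '' B) :=
    hBc.image _ ((continuousOn_extChartAt_symm q).mono fun v hv => (hball (hBr hv)).1)
  have hsource : ∀ v ∈ Metric.ball (e q) r ∩ range (bdModel n),
      e.symm v ∈ (chartAt (BdSpace n) q).source ∧ e (e.symm v) = v := fun v hv =>
    ⟨extChartAt_source (I := bdModel n) q ▸ e.map_target (hball hv).1, e.right_inv (hball hv).1⟩
  -- Connectedness: the image of the open half ball `B` lies in `O` and contains no boundary point,
  -- so wherever it meets the collar the parameter is neither `0` nor `1`. It is therefore covered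
  -- by two disjoint open sets, the open collar and the complement of the compact range of `c`. It
  -- meets the first, because `c (s, x)` lies in it for small `s`.
  have hQV : e.symm '' B ⊆ c '' {p | p.1 ≠ 0 ∧ p.1 ≠ 1} := by
    refine hQc.subset_left_of_subset_union hV1 (isCompact_range hcont).isClosed.isOpen_compl
      ?_ ?_ ?_
    · refine Set.disjoint_left.2 ?_
      rintro _ ⟨p, -, rfl⟩ h
      exact h ⟨p, rfl⟩
    · rintro _ ⟨v, hv, rfl⟩
      by_cases hw : e.symm v ∈ range c
      swap
      · exact Or.inr hw
      obtain ⟨p, hp'⟩ := hw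
      have hvO : e.symm v ∈ O := (hball (hBr hv)).2
      refine Or.inl ⟨p, ⟨?_, ?_⟩, hp'⟩
      · intro hp0
        have h2 := h0 p.2
        rw [← hp0, Prod.mk.eta, hp', mem_boundary_iff_firstCoord (hsource v (hBr hv)).1] at h2
        change firstCoord n (e (e.symm v)) = 0 at h2
        rw [(hsource v (hBr hv)).2] at h2
        exact (ne_of_gt hv.2) h2
      · intro hp1
        exact hvO (Or.inl ⟨p, hp1, hp'⟩)
    · have h2 : ContinuousAt (fun s : Itv => c (s, x)) 0 :=
        (hcont.comp (continuous_id.prodMk continuous_const)).continuousAt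
      have h3 : {w | w ∈ (chartAt (BdSpace n) q).source ∧ e w ∈ Metric.ball (e q) r} ∈ 𝓝 q :=
        inter_mem (chart_source_mem_nhds (BdSpace n) q)
          ((continuousAt_extChartAt (I := bdModel n) q) (Metric.ball_mem_nhds _ hr))
      obtain ⟨s, ⟨hs1, hs2⟩, hs0, hs1'⟩ := exists_itv_mem (h2 h3)
      refine ⟨c (s, x), ⟨e (c (s, x)), ⟨hs2, ?_⟩, ?_⟩, ⟨(s, x), ⟨hs0, hs1'⟩, rfl⟩⟩
      · exact (isInteriorPoint_iff_firstCoord hs1).1 (hc.isInteriorPoint (p := (s, x)) hs0 hs1')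
      · refine e.left_inv ?_
        rw [he, extChartAt_source]
        exact hs1
  have hnhds : e.symm '' (Metric.ball (e q) r ∩ range (bdModel n)) ∈ 𝓝 q := by
    rw [← map_extChartAt_symm_nhdsWithin_range (I := bdModel n) q]
    exact image_mem_map (inter_mem (mem_nhdsWithin_of_mem_nhds (Metric.ball_mem_nhds _ hr))
      self_mem_nhdsWithin)
  refine mem_of_superset hnhds ?_
  rintro _ ⟨v, hv, rfl⟩
  have hv0 : 0 ≤ firstCoord n v := mem_range_bdModel.1 hv.2
  rcases hv0.eq_or_lt with hv0 | hv0
  -- The flat face of the half ball consists of boundary points of `W` outside `C`, which belong to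
  -- `c (0, M)` by hypothesis.
  · have h2 : e.symm v ∈ (bdModel n).boundary W := by
      rw [mem_boundary_iff_firstCoord (hsource v hv).1]
      change firstCoord n (e (e.symm v)) = 0
      rw [(hsource v hv).2]
      exact hv0.symm
    rcases hb h2 with ⟨y, hy⟩ | h3
    · exact ⟨(0, y), zero_ne_one, hy⟩
    · exact absurd (Or.inr h3) (hball hv).2
  · exact (image_mono fun p hp => hp.2) (hQV ⟨v, ⟨hv.1, hv0⟩, rfl⟩)

end CollarOpen

/-! ### The profile of the stretching. -/

section Stretch

/-- The profile of a smooth stretching of `[0, 1]` onto `[a, 1]`, equal to the identity on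
`[1/2, 1]`. -/
def stretchProfile (t : ℝ) : ℝ := 1 - Real.smoothTransition (2 * t)

theorem contDiff_stretchProfile : ContDiff ℝ ∞ stretchProfile :=
  contDiff_const.sub (Real.smoothTransition.contDiff.comp (contDiff_const.mul contDiff_id))

theorem stretchProfile_zero : stretchProfile 0 = 1 := by
  simp [stretchProfile]

theorem stretchProfile_of_half_le {t : ℝ} (ht : 1 / 2 ≤ t) : stretchProfile t = 0 := by
  rw [stretchProfile, Real.smoothTransition.one_of_one_le (by linarith), sub_self]

theorem stretchProfile_nonneg (t : ℝ) : 0 ≤ stretchProfile t :=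
  sub_nonneg.2 (Real.smoothTransition.le_one _)

/-- The derivative is `1 + a χ'`, where `χ` is the profile. If `|χ'| ≤ B` on `[0, 1]`, then `a = 1 /
(B + 1)` gives `a B < 1`. -/
theorem exists_stretch : ∃ a : ℝ, 0 < a ∧
    ∀ t ∈ Set.Icc (0 : ℝ) 1, 0 < deriv (fun t => t + a * stretchProfile t) t := by
  have h1 : ContDiff ℝ 1 stretchProfile := contDiff_stretchProfile.of_le (by simp)
  obtain ⟨B, hB⟩ := isCompact_Icc.exists_bound_of_continuousOn (s := Set.Icc (0 : ℝ) 1)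
    (h1.continuous_deriv le_rfl).continuousOn
  have hB0 : 0 ≤ B := (norm_nonneg _).trans (hB 0 (by simp))
  refine ⟨1 / (B + 1), by positivity, fun t ht => ?_⟩
  have h2 : DifferentiableAt ℝ stretchProfile t := h1.differentiable (by simp) t
  rw [((hasDerivAt_id' t).fun_add (h2.hasDerivAt.const_mul (1 / (B + 1)))).deriv]
  have h3 := (abs_le.1 (hB t ht)).1
  have h4 : 1 / (B + 1) * B < 1 := by
    rw [div_mul_eq_mul_div, one_mul, div_lt_one (by linarith)]
    linarith
  have h5 : 0 < 1 / (B + 1) := by positivity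
  nlinarith

end Stretch

end HQFT

end

noncomputable section

set_option linter.unusedSectionVars false

namespace HQFT

open scoped Manifold ContDiff Topology

/-! ### Stretching the interval `[0, 1]` onto `[a, 1]`. -/

section Stretch

open Set

/-- The map `t ↦ t + a χ(t)` is a smooth stretching of `[0, 1]` onto `[a, 1]`. -/
def IsStretchParam (a : ℝ) : Prop :=
  0 < a ∧ ∀ t ∈ Icc (0 : ℝ) 1, 0 < deriv (fun t => t + a * stretchProfile t) t

variable {a : ℝ}

theorem contDiff_stretch (a : ℝ) : ContDiff ℝ ∞ fun t => t + a * stretchProfile t :=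
  contDiff_id.add (contDiff_const.mul contDiff_stretchProfile)

theorem IsStretchParam.strictMonoOn (ha : IsStretchParam a) :
    StrictMonoOn (fun t => t + a * stretchProfile t) (Icc 0 1) :=
  strictMonoOn_of_deriv_pos (convex_Icc 0 1) (contDiff_stretch a).continuous.continuousOn
    fun t ht => ha.2 t (interior_subset ht)

theorem IsStretchParam.le_one (ha : IsStretchParam a) (t : Itv) : t + a * stretchProfile t ≤ 1 := by
  have h := ha.strictMonoOn.monotoneOn t.2 (right_mem_Icc.2 zero_le_one) t.2.2
  simpa [stretchProfile_of_half_le (t := 1) (by norm_num)] using h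

theorem IsStretchParam.a_le_one (ha : IsStretchParam a) : a ≤ 1 := by
  simpa [stretchProfile_zero] using ha.le_one 0

/-- The homotopy from the identity to the stretching of `[0, 1]` onto `[a, 1]`. -/
def stretch (ha : IsStretchParam a) (s t : Itv) : Itv :=
  ⟨t + s * (a * stretchProfile t), by
    have h0 := mul_nonneg ha.1.le (stretchProfile_nonneg t)
    have h1 := ha.le_one t
    have h2 := s.2.1
    have h3 := s.2.2
    have h4 := t.2.1
    constructor
    · positivity
    · nlinarith⟩

variable (ha : IsStretchParam a)

theorem stretch_zero_left (t : Itv) : stretch ha 0 t = t := by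
  refine Subtype.ext ?_
  change (t : ℝ) + 0 * _ = t
  simp

theorem stretch_zero_right (s : Itv) : (stretch ha s 0 : ℝ) = s * a := by
  change (0 : ℝ) + s * (a * stretchProfile (0 : ℝ)) = s * a
  rw [stretchProfile_zero]
  ring

theorem stretch_of_half_le (s : Itv) {t : Itv} (ht : 1 / 2 ≤ (t : ℝ)) : stretch ha s t = t := by
  refine Subtype.ext ?_
  change (t : ℝ) + s * (a * stretchProfile t) = t
  rw [stretchProfile_of_half_le ht]
  simp

theorem coe_stretch_one (t : Itv) : (stretch ha 1 t : ℝ) = t + a * stretchProfile t := by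
  change (t : ℝ) + 1 * (a * stretchProfile t) = _
  rw [one_mul]

theorem continuous_stretch : Continuous fun p : Itv × Itv => stretch ha p.1 p.2 := by
  refine Continuous.subtype_mk ?_ _
  have h := contDiff_stretchProfile.continuous
  fun_prop

theorem injective_stretch : Function.Injective (stretch ha 1) := by
  intro s t h
  have h1 := congrArg Subtype.val h
  rw [coe_stretch_one, coe_stretch_one] at h1
  exact Subtype.ext (ha.strictMonoOn.injOn s.2 t.2 h1)

theorem le_stretch (t : Itv) : a ≤ stretch ha 1 t := by
  rw [coe_stretch_one]
  have h := ha.strictMonoOn.monotoneOn (left_mem_Icc.2 zero_le_one) t.2 t.2.1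
  simpa [stretchProfile_zero] using h

theorem stretch_eq_left {t : Itv} (h : (stretch ha 1 t : ℝ) = a) : t = 0 := by
  refine injective_stretch ha (Subtype.ext ?_)
  rw [h, stretch_zero_right]
  exact (one_mul a).symm

theorem exists_stretch_eq {u : Itv} (hu : a ≤ u) : ∃ t, stretch ha 1 t = u := by
  have h := intermediate_value_Icc (zero_le_one (α := ℝ))
    (contDiff_stretch a).continuous.continuousOn
  have h1 : (u : ℝ) ∈ Icc ((0 : ℝ) + a * stretchProfile 0) (1 + a * stretchProfile 1) := by
    rw [stretchProfile_zero, stretchProfile_of_half_le (t := 1) (by norm_num)]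
    exact ⟨by linarith, by linarith [u.2.2]⟩
  obtain ⟨t, ht, htu⟩ := h h1
  exact ⟨⟨t, ht⟩, Subtype.ext ((coe_stretch_one ha _).trans htu)⟩

/-- The inclusion of `[0, 1]` onto `[0, a]`. -/
def shrink (ha : IsStretchParam a) : Itv → Itv :=
  affItv 0 a le_rfl zero_le_one (by linarith [ha.1]) (by linarith [ha.a_le_one])

theorem coe_shrink (t : Itv) : (shrink ha t : ℝ) = a * t := zero_add _

/-- During the homotopy the endpoint `0` runs through `[0, a]`. The boundary of `W` is thus carried
along the very cylinder that the stretching uncovers, on which the map to `X` will be constant in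
time. -/
theorem shrink_eq_stretch (s : Itv) : shrink ha s = stretch ha s 0 := by
  refine Subtype.ext ?_
  rw [coe_shrink, stretch_zero_right, mul_comm]

end Stretch

/-! ### Stretching a manifold along a collar. -/

section StretchedCollar

open Set Filter

variable {n : ℕ} {M W : Type*} [TopologicalSpace M] [ChartedSpace (EuclideanSpace ℝ (Fin n)) M]
  [IsManifold (𝓡 n) ∞ M] [TopologicalSpace W] [ChartedSpace (BdSpace n) W]
  [IsManifold (bdModel n) ∞ W] [IsManifold (𝓡 n) 1 M]

/-- A decomposition of `W` into a cylinder on the part `f (M)` of its boundary and a copy of `W`,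
disjoint from `C`, and an isotopy of `W` onto this copy. -/
structure StretchedCollar (oM : ManifoldOrientation (𝓡 n) M n)
    (oW : ManifoldOrientation (bdModel n) W (n + 1)) (f : M → W) (C : Set W) where
  left : Itv × M → W
  isotopy : Itv × W → W
  contMDiff_left : ContMDiff (bdModel n) (bdModel n) ∞ left
  injective_left : Function.Injective left
  orientation_left : PreservesOrientation oM.cylinder oW left
  contMDiff_right : ContMDiff (bdModel n) (bdModel n) ∞ fun w => isotopy (1, w)
  injective_right : Function.Injective fun w => isotopy (1, w)
  orientation_right : PreservesOrientation oW oW fun w => isotopy (1, w)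
  continuous_isotopy : Continuous isotopy
  left_zero : ∀ x, left (0, x) = f x
  isotopy_zero : ∀ w, isotopy (0, w) = w
  isotopy_boundary : ∀ s x, isotopy (s, f x) = left (s, x)
  isotopy_of_mem : ∀ s, ∀ w ∈ C, isotopy (s, w) = w
  eq_of_left_eq : ∀ p w, left p = isotopy (1, w) → p.1 = 1 ∧ w = f p.2
  cover : ∀ w, w ∈ range left ∨ w ∈ range fun w => isotopy (1, w)

variable {oM : ManifoldOrientation (𝓡 n) M n} {oW : ManifoldOrientation (bdModel n) W (n + 1)}
  {C : Set W} {a : ℝ} {c : Itv × M → W}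

/-- The isotopy of `W` obtained by stretching a collar. -/
def collarIsotopy (ha : IsStretchParam a) (c : Itv × M → W) (p : Itv × W) : W :=
  Function.extend c (fun q => c (stretch ha p.1 q.1, q.2)) id p.2

variable (ha : IsStretchParam a)

theorem collarIsotopy_apply (hc : Function.Injective c) (s : Itv) (q : Itv × M) :
    collarIsotopy ha c (s, c q) = c (stretch ha s q.1, q.2) :=
  hc.extend_apply _ _ _

theorem collarIsotopy_of_notMem (s : Itv) {w : W} (hw : w ∉ range c) :
    collarIsotopy ha c (s, w) = w :=
  Function.extend_apply' _ _ _ hw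

theorem collarIsotopy_of_notMem_image (hc : Function.Injective c) (s : Itv) {w : W}
    (hw : w ∉ c '' {q | (q.1 : ℝ) ≤ 1 / 2}) : collarIsotopy ha c (s, w) = w := by
  by_cases h : w ∈ range c
  · obtain ⟨q, rfl⟩ := h
    rw [collarIsotopy_apply ha hc, stretch_of_half_le]
    exact le_of_lt (not_le.1 fun h => hw ⟨q, h, rfl⟩)
  · exact collarIsotopy_of_notMem ha s h

theorem isClosed_image_half [CompactSpace M] [T2Space W] (hc : Continuous c) :
    IsClosed (c '' {q | (q.1 : ℝ) ≤ 1 / 2}) := by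
  have h : IsClosed {q : Itv × M | (q.1 : ℝ) ≤ 1 / 2} :=
    isClosed_le (continuous_subtype_val.comp continuous_fst) continuous_const
  exact (h.isCompact.image hc).isClosed

/-- The image of `[0, 1) × M` and the complement of the image of `[0, 1/2] × M` cover `W`. For a
collar with open half-open image both are open; on the first the isotopy is computed in the collar,
and on the second it is the identity. Continuity and smoothness are checked on each. -/
theorem mem_image_half_or (w : W) :
    w ∈ c '' {p | p.1 ≠ 1} ∨ w ∉ c '' {q | (q.1 : ℝ) ≤ 1 / 2} := by
  by_cases h : w ∈ c '' {q | (q.1 : ℝ) ≤ 1 / 2}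
  · obtain ⟨q, hq, rfl⟩ := h
    refine Or.inl ⟨q, fun h1 => ?_, rfl⟩
    have hq' : (q.1 : ℝ) ≤ 1 / 2 := hq
    rw [h1] at hq'
    norm_num at hq'
  · exact Or.inr h

/-- A local inverse of a collar. -/
theorem IsCollar.exists_inverse [CompactSpace M] [T2Space W] (hc : IsCollar oM oW C c)
    (ho : IsOpen (c '' {p | p.1 ≠ 1})) (p₀ : Itv × M) : ∃ g : W → Itv × M,
      (∀ p, g (c p) = p) ∧ ContMDiffOn (bdModel n) (bdModel n) ∞ g (c '' {p | p.1 ≠ 1}) := by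
  -- The point `p₀` only serves as the value of the inverse outside the range of `c`.
  have hg : ∀ p, Function.extend c id (fun _ => p₀) (c p) = p := fun p =>
    hc.injective.extend_apply _ _ _
  refine ⟨Function.extend c id fun _ => p₀, hg, ?_⟩
  have hcg : ∀ y ∈ c '' {p | p.1 ≠ 1}, c (Function.extend c id (fun _ => p₀) y) = y := by
    rintro _ ⟨p, -, rfl⟩
    rw [hg]
  refine contMDiffOn_of_rightInverse isOpen_ne_one ho hc.contMDiff.contMDiffOn ?_ ?_ hcg
    fun p _ => hc.isInvertible p
  · rintro _ ⟨p, hp, rfl⟩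
    rw [hg]
    exact hp
  -- An injective continuous map from a compact space to a Hausdorff space is a closed embedding, so
  -- its inverse is continuous.
  · have hi := (hc.contMDiff.continuous.isClosedEmbedding hc.injective).isInducing
    rw [hi.continuousOn_iff]
    exact continuousOn_id.congr hcg

theorem continuous_collarIsotopy [CompactSpace M] [T2Space W] (hc : IsCollar oM oW C c)
    (ho : IsOpen (c '' {p | p.1 ≠ 1})) : Continuous (collarIsotopy ha c) := by
  rw [continuous_iff_continuousAt]
  rintro ⟨s, w⟩
  rcases mem_image_half_or (c := c) w with hw | hw
  · obtain ⟨p₀, -⟩ := id hw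
    obtain ⟨g, hgc, hg⟩ := hc.exists_inverse ho p₀
    have h1 : ContinuousAt (fun p : Itv × W => g p.2) (s, w) :=
      ((hg.continuousOn.continuousAt (ho.mem_nhds hw))).comp continuousAt_snd
    have h2 : ContinuousAt (fun p : Itv × W => c (stretch ha p.1 (g p.2).1, (g p.2).2)) (s, w) := by
      have h3 : ContinuousAt (fun p : Itv × W => stretch ha p.1 (g p.2).1) (s, w) :=
        (continuous_stretch ha).continuousAt.comp
          (f := fun p : Itv × W => (p.1, (g p.2).1)) (continuousAt_fst.prodMk h1.fst)
      exact hc.contMDiff.continuous.continuousAt.comp (h3.prodMk h1.snd)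
    refine h2.congr ?_
    filter_upwards [continuousAt_snd (ho.mem_nhds hw)] with p hp
    obtain ⟨q, -, hq⟩ : p.2 ∈ c '' {p | p.1 ≠ 1} := hp
    have h3 := collarIsotopy_apply ha hc.injective p.1 q
    rw [hq] at h3
    change _ = collarIsotopy ha c (p.1, p.2)
    rw [h3, ← hq, hgc]
  · refine continuousAt_snd.congr ?_
    filter_upwards [continuousAt_snd
      ((isClosed_image_half hc.contMDiff.continuous).isOpen_compl.mem_nhds hw)] with p hp
    exact (collarIsotopy_of_notMem_image ha hc.injective p.1 hp).symm

theorem contMDiff_stretch : ContMDiff (bdModel n) (bdModel n) ∞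
    (Prod.map (stretch ha 1) id : Itv × M → Itv × M) :=
  (contMDiff_itv (contDiff_stretch a) (coe_stretch_one ha)).prodMap contMDiff_id

theorem contMDiff_collarIsotopy [CompactSpace M] [T2Space W] (hc : IsCollar oM oW C c)
    (ho : IsOpen (c '' {p | p.1 ≠ 1})) :
    ContMDiff (bdModel n) (bdModel n) ∞ fun w => collarIsotopy ha c (1, w) := by
  intro w
  rcases mem_image_half_or (c := c) w with hw | hw
  · obtain ⟨p₀, -⟩ := id hw
    obtain ⟨g, hgc, hg⟩ := hc.exists_inverse ho p₀
    have h1 := (hc.contMDiff.comp (contMDiff_stretch (n := n) (M := M) ha)).contMDiffAt.comp w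
      (hg.contMDiffAt (ho.mem_nhds hw))
    refine h1.congr_of_eventuallyEq ?_
    filter_upwards [ho.mem_nhds hw] with w' hw'
    obtain ⟨q, -, rfl⟩ := hw'
    rw [collarIsotopy_apply ha hc.injective]
    simp only [Function.comp_apply, hgc]
    rfl
  · refine (contMDiff_id (n := ∞) w).congr_of_eventuallyEq ?_
    filter_upwards [(isClosed_image_half hc.contMDiff.continuous).isOpen_compl.mem_nhds hw]
      with w' hw'
    exact collarIsotopy_of_notMem_image ha hc.injective 1 hw'

/-- On the collar, the final map of the isotopy composed with `c` is `c` composed with the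
stretching, which preserves orientations; cancelling the invertible derivative of `c` gives the
claim. Outside the closed range of `c` the map is locally the identity. -/
theorem orientation_collarIsotopy [CompactSpace M] [T2Space W] (hc : IsCollar oM oW C c)
    (ho : IsOpen (c '' {p | p.1 ≠ 1})) :
    PreservesOrientation oW oW fun w => collarIsotopy ha c (1, w) := by
  intro w
  have hR := contMDiff_collarIsotopy ha hc ho
  by_cases hw : w ∈ range c
  · obtain ⟨p, rfl⟩ := hw
    have hs := contMDiff_stretch (n := n) (M := M) ha
    have e : (fun w => collarIsotopy ha c (1, w)) ∘ c = c ∘ Prod.map (stretch ha 1) id :=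
      funext fun q => collarIsotopy_apply ha hc.injective 1 q
    have h1 : LinPreserves (mfderiv (bdModel n) (bdModel n) (c ∘ Prod.map (stretch ha 1) id) p :
        BdVec n →L[ℝ] BdVec n).toLinearMap (oM.cylinder.at' p)
        (oW.at' (c (Prod.map (stretch ha 1) id p))) :=
      PreservesOrientation.comp hc.orientation (preservesOrientation_prodMap (contDiff_stretch a)
        (coe_stretch_one ha) (fun t => ha.2 t t.2) contMDiff_id (.id oM)) hc.contMDiff hs p
    rw [← e, mfderiv_comp p (hR.mdifferentiable (by simp) _)
      (hc.contMDiff.mdifferentiable (by simp) _)] at h1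
    obtain ⟨E, hE⟩ : ∃ E : BdVec n ≃L[ℝ] BdVec n, (E : BdVec n →L[ℝ] BdVec n) =
      mfderiv (bdModel n) (bdModel n) c p := hc.isInvertible p
    have h2 : LinPreserves (E : BdVec n →L[ℝ] BdVec n).toLinearMap (oM.cylinder.at' p)
      (oW.at' (c p)) := hE ▸ hc.orientation p
    have h3 : ∀ A : BdVec n →L[ℝ] BdVec n,
        LinPreserves (A.comp (mfderiv (bdModel n) (bdModel n) c p :
          BdVec n →L[ℝ] BdVec n)).toLinearMap (oM.cylinder.at' p)
          (oW.at' (collarIsotopy ha c (1, c p))) →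
        LinPreserves A.toLinearMap (oW.at' (c p)) (oW.at' (collarIsotopy ha c (1, c p))) := by
      intro A hA
      rw [← hE] at hA
      have h4 := h2.cancel (B := (E.symm : BdVec n →L[ℝ] BdVec n).toLinearMap)
        (LinearMap.ext fun v => E.apply_symm_apply v) hA
      have h5 : (A.comp (E : BdVec n →L[ℝ] BdVec n)).toLinearMap ∘ₗ
          (E.symm : BdVec n →L[ℝ] BdVec n).toLinearMap = A.toLinearMap :=
        LinearMap.ext fun v => congrArg A (E.apply_symm_apply v)
      exact (congrArg (fun L : BdVec n →ₗ[ℝ] BdVec n => LinPreserves (E := BdVec n) (F := BdVec n) L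
        (oW.at' (c p)) (oW.at' (collarIsotopy ha c (1, c p)))) h5).mp h4
    refine h3 _ ?_
    have h6 : collarIsotopy ha c (1, c p) = c (Prod.map (stretch ha 1) id p) := congrFun e p
    rw [h6]
    exact h1
  · have h1 : (fun w => collarIsotopy ha c (1, w)) =ᶠ[𝓝 w] id := by
      filter_upwards [(isCompact_range hc.contMDiff.continuous).isClosed.isOpen_compl.mem_nhds hw]
        with w' hw'
      exact collarIsotopy_of_notMem ha 1 hw'
    rw [h1.mfderiv_eq, mfderiv_id]
    have h2 := LinPreserves.id (oW.at' w)
    have h3 : w = collarIsotopy ha c (1, w) := (collarIsotopy_of_notMem ha 1 hw).symm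
    have key : ∀ w', w = w' → LinPreserves (E := BdVec n) (F := BdVec n) LinearMap.id (oW.at' w) (oW.at' w') := by
      rintro _ rfl
      exact h2
    exact key _ h3

/-- The decomposition of `W` given by a collar. -/
def IsCollar.stretchedCollar [CompactSpace M] [T2Space W] (hc : IsCollar oM oW C c)
    (ho : IsOpen (c '' {p | p.1 ≠ 1})) {f : M → W} (hf : ∀ x, c (0, x) = f x) :
    StretchedCollar oM oW f C where
  left := c ∘ Prod.map (shrink ha) id
  isotopy := collarIsotopy ha c
  contMDiff_left := hc.contMDiff.comp (contMDiff_affItv.prodMap contMDiff_id)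
  injective_left := hc.injective.comp
    ((injective_affItv ha.1.ne').prodMap Function.injective_id)
  orientation_left := hc.orientation.comp (preservesOrientation_affItv ha.1 oM) hc.contMDiff
    (contMDiff_affItv.prodMap contMDiff_id)
  contMDiff_right := contMDiff_collarIsotopy ha hc ho
  injective_right := by
    intro w w' h
    change collarIsotopy ha c (1, w) = collarIsotopy ha c (1, w') at h
    by_cases hw : w ∈ range c <;> by_cases hw' : w' ∈ range c
    · obtain ⟨p, rfl⟩ := hw
      obtain ⟨q, rfl⟩ := hw'
      rw [collarIsotopy_apply ha hc.injective, collarIsotopy_apply ha hc.injective] at h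
      have h1 := hc.injective h
      exact congrArg c (Prod.ext (injective_stretch ha (Prod.ext_iff.1 h1).1) (Prod.ext_iff.1 h1).2)
    · obtain ⟨p, rfl⟩ := hw
      rw [collarIsotopy_apply ha hc.injective, collarIsotopy_of_notMem ha _ hw'] at h
      exact absurd ⟨_, h⟩ hw'
    · obtain ⟨p, rfl⟩ := hw'
      rw [collarIsotopy_apply ha hc.injective, collarIsotopy_of_notMem ha _ hw] at h
      exact absurd ⟨_, h.symm⟩ hw
    · rwa [collarIsotopy_of_notMem ha _ hw, collarIsotopy_of_notMem ha _ hw'] at h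
  orientation_right := orientation_collarIsotopy ha hc ho
  continuous_isotopy := continuous_collarIsotopy ha hc ho
  left_zero := by
    intro x
    rw [← hf]
    refine congrArg c (Prod.ext (Subtype.ext ?_) rfl)
    exact (coe_shrink ha 0).trans (mul_zero a)
  isotopy_zero := by
    intro w
    by_cases hw : w ∈ range c
    · obtain ⟨p, rfl⟩ := hw
      rw [collarIsotopy_apply ha hc.injective, stretch_zero_left]
    · exact collarIsotopy_of_notMem ha _ hw
  isotopy_boundary := by
    intro s x
    rw [← hf, collarIsotopy_apply ha hc.injective]
    exact congrArg c (Prod.ext (shrink_eq_stretch ha s).symm rfl)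
  isotopy_of_mem := by
    intro s w hw
    refine collarIsotopy_of_notMem ha s ?_
    rintro ⟨p, rfl⟩
    exact hc.notMem p hw
  eq_of_left_eq := by
    intro p w h
    by_cases hw : w ∈ range c
    · obtain ⟨q, rfl⟩ := hw
      rw [collarIsotopy_apply ha hc.injective] at h
      have h1 := hc.injective h
      have h2 : (shrink ha p.1 : ℝ) = stretch ha 1 q.1 :=
        congrArg (fun r : Itv × M => (r.1 : ℝ)) h1
      have h3 := le_stretch ha q.1
      rw [coe_shrink] at h2
      have h4 := p.1.2.2
      -- The cylinder occupies heights at most `a` in the collar and the copy of `W` heights at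
      -- least `a`; equality forces `a t = a`, the common face.
      have h5 : (p.1 : ℝ) = 1 := by nlinarith [ha.1]
      have h6 : q.1 = 0 := stretch_eq_left ha (by rw [← h2, h5, mul_one])
      refine ⟨Subtype.ext h5, ?_⟩
      have h7 : q = (0, p.2) := Prod.ext h6 (congrArg Prod.snd h1).symm
      rw [h7, hf]
    · rw [collarIsotopy_of_notMem ha _ hw] at h
      exact absurd ⟨_, h⟩ hw
  cover := by
    intro w
    by_cases hw : w ∈ range c
    · obtain ⟨⟨t, x⟩, rfl⟩ := hw
      -- Below height `a` a point comes from the cylinder, above it from the stretched collar.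
      rcases le_total (t : ℝ) a with h | h
      · refine Or.inl ⟨(⟨t / a, div_nonneg t.2.1 ha.1.le, (div_le_one ha.1).2 h⟩, x), ?_⟩
        refine congrArg c (Prod.ext (Subtype.ext ?_) rfl)
        refine (coe_shrink ha _).trans ?_
        exact mul_div_cancel₀ _ ha.1.ne'
      · obtain ⟨s, hs⟩ := exists_stretch_eq ha h
        exact Or.inr ⟨c (s, x), (collarIsotopy_apply ha hc.injective 1 _).trans (by rw [hs])⟩
    · exact Or.inr ⟨w, collarIsotopy_of_notMem ha 1 hw⟩

theorem nonempty_stretchedCollar [CompactSpace M] [T2Space W] {f : M → W}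
    (hf : IsBoundaryEmbedding (-oM) oW f) (hC : IsClosed C) (hfC : ∀ x, f x ∉ C)
    (hb : (bdModel n).boundary W ⊆ range f ∪ C) : Nonempty (StretchedCollar oM oW f C) := by
  obtain ⟨c, hc, hcf⟩ := exists_isCollar hf hC hfC
  obtain ⟨a, ha⟩ := exists_stretch
  have h : (fun x => c (0, x)) = f := funext hcf
  refine ⟨hc.stretchedCollar ha (hc.isOpen_image hC ?_ ?_) hcf⟩
  · intro x
    rw [hcf]
    exact hf.mem_boundary x
  · rwa [h]

end StretchedCollar

end HQFT

end

noncomputable section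

set_option linter.unusedSectionVars false

namespace HQFT

open scoped Manifold ContDiff Topology

/-! ### A cobordism with its incoming boundary bent around is a composite with the unit. -/

section Bend

open Set

variable {n : ℕ} {X : Type v} [TopologicalSpace X] {pt : X}

namespace XCobordism

variable {M N : XManifold.{u} n X pt}

/-- Change of the map to `X`. -/
def withMap (W : XCobordism M N) (F : C(W.carrier, X)) (hin : ∀ x, F (W.inMap x) = M.charMap x)
    (hout : ∀ y, F (W.outMap y) = N.charMap y) : XCobordism M N :=
  { W with charMap := F, charMap_inMap := hin, charMap_outMap := hout }

/-- Homotopic maps to `X` define diffeomorphic `X`-cobordisms. -/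
def withMapDiffeo (W : XCobordism M N) {F : C(W.carrier, X)}
    {hin : ∀ x, F (W.inMap x) = M.charMap x} {hout : ∀ y, F (W.outMap y) = N.charMap y}
    (h : F.HomotopicRel W.charMap ((bdModel n).boundary W.carrier)) :
    (W.withMap F hin hout).Diffeo W where
  toDiffeo := Diffeomorph.refl (bdModel n) W.carrier ∞
  orientation := PreservesOrientation.id W.orientation
  inDiffeo := XDiffeo.refl M
  outDiffeo := XDiffeo.refl N
  comm_in _ := rfl
  comm_out _ := rfl
  homotopic := h

/-- The `X`-cobordism `W : M → N`, viewed as an `X`-cobordism `∅ → N ⨿ M^*`. -/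
def bend (W : XCobordism M N) : XCobordism (XManifold.empty n X pt) (N.sum M.dual) where
  carrier := W.carrier
  orientation := W.orientation
  inMap := fun x => isEmptyElim x
  outMap := Sum.elim W.outMap W.inMap
  inMap_embedding := .of_isEmpty _
  outMap_embedding := W.outMap_embedding.sumElim (oN := -M.orientation) W.inMap_embedding
    fun x y h => W.inMap_ne_outMap y x h.symm
  inMap_ne_outMap := fun x => isEmptyElim x
  boundary_subset := fun p hp => by
    rcases W.boundary_subset hp with ⟨x, rfl⟩ | ⟨y, rfl⟩
    exacts [Or.inr ⟨Sum.inr x, rfl⟩, Or.inr ⟨Sum.inl y, rfl⟩]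
  charMap := W.charMap
  charMap_inMap := fun x => isEmptyElim x
  charMap_outMap := by
    rintro (y | x)
    exacts [W.charMap_outMap y, W.charMap_inMap x]

/-- A decomposition of `W` into a cylinder on `M` and a copy of `W`. -/
abbrev InCollar (W : XCobordism M N) :=
  StretchedCollar M.orientation W.orientation W.inMap (range W.outMap)

theorem nonempty_inCollar (W : XCobordism M N) : Nonempty W.InCollar := by
  refine nonempty_stretchedCollar W.inMap_embedding
    (isCompact_range W.outMap_embedding.contMDiff.continuous).isClosed ?_ W.boundary_subset
  rintro x ⟨y, hy⟩
  exact W.inMap_ne_outMap x y hy.symm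

variable {W : XCobordism M N}

/-- The map `W → X` given by `g` on the cylinder and by `F` on the copy of `W`. -/
theorem exists_collarMap (S : W.InCollar) : ∃ F : C(W.carrier, X),
    (∀ p, F (S.left p) = M.charMap p.2) ∧ ∀ w, F (S.isotopy (1, w)) = W.charMap w := by
  let q : C((Itv × M.carrier) ⊕ W.carrier, W.carrier) :=
    ⟨Sum.elim S.left fun w => S.isotopy (1, w),
      S.contMDiff_left.continuous.sumElim S.contMDiff_right.continuous⟩
  have hsurj : Function.Surjective q := by
    intro w
    rcases S.cover w with ⟨p, hp⟩ | ⟨w', hw⟩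
    exacts [⟨Sum.inl p, hp⟩, ⟨Sum.inr w', hw⟩]
  -- A continuous surjection from a compact space onto a Hausdorff space is a quotient map. So the
  -- map to `X` may be defined on the two pieces, provided it agrees where they meet.
  have hq : Topology.IsQuotientMap q := q.continuous.isClosedMap.isQuotientMap q.continuous hsurj
  let G : C((Itv × M.carrier) ⊕ W.carrier, X) := XManifold.sumMap (cylinderMap M) W.charMap
  have key : ∀ p w, S.left p = S.isotopy (1, w) → M.charMap p.2 = W.charMap w := by
    intro p w h
    rw [(S.eq_of_left_eq p w h).2, W.charMap_inMap]
  have hG : Function.FactorsThrough G q := by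
    rintro (p | w) (p' | w') h
    · rw [S.injective_left h]
    · exact key p w' h
    · exact (key p' w h.symm).symm
    · rw [S.injective_right h]
  refine ⟨hq.lift G hG, fun p => ?_, fun w => ?_⟩
  · exact ContinuousMap.congr_fun (hq.lift_comp G hG) (Sum.inl p)
  · exact ContinuousMap.congr_fun (hq.lift_comp G hG) (Sum.inr w)

/-- Composing `F` with the isotopy is a homotopy from `F` to the original map. It is constant on the
incoming boundary, which travels along the cylinder where `F` equals `g`, and on the outgoing
boundary, which does not move. -/
theorem homotopicRel_collarMap (S : W.InCollar) {F : C(W.carrier, X)}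
    (hl : ∀ p, F (S.left p) = M.charMap p.2) (hr : ∀ w, F (S.isotopy (1, w)) = W.charMap w) :
    F.HomotopicRel W.charMap ((bdModel n).boundary W.carrier) := by
  refine ⟨⟨⟨⟨fun p => F (S.isotopy p), F.continuous.comp S.continuous_isotopy⟩, ?_, ?_⟩, ?_⟩⟩
  · intro w
    exact congrArg F (S.isotopy_zero w)
  · exact hr
  · intro s w hw
    rcases W.boundary_subset hw with ⟨x, rfl⟩ | hw
    · change F (S.isotopy (s, W.inMap x)) = F (W.inMap x)
      rw [S.isotopy_boundary, hl, ← S.left_zero, hl]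
    · exact congrArg F (S.isotopy_of_mem s w hw)

/-- The upper half of a cylinder. -/
def upperHalf : Itv → Itv :=
  affItv (1 / 2) (1 / 2) (by norm_num) (by norm_num) (by norm_num) (by norm_num)

/-- The lower half of a cylinder, reversed. -/
def lowerHalf : Itv → Itv :=
  affItv (1 / 2) (-1 / 2) (by norm_num) (by norm_num) (by norm_num) (by norm_num)

theorem coe_upperHalf (t : Itv) : (upperHalf t : ℝ) = 1 / 2 + 1 / 2 * t := rfl

theorem coe_lowerHalf (t : Itv) : (lowerHalf t : ℝ) = 1 / 2 + -1 / 2 * t := rfl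

theorem lowerHalf_ne_one (t : Itv) : lowerHalf t ≠ 1 := by
  intro h
  have h1 : (1 / 2 + -1 / 2 * t : ℝ) = 1 := congrArg Subtype.val h
  linarith [t.2.1]

theorem upperHalf_eq_one {t : Itv} : upperHalf t = 1 ↔ t = 1 := by
  rw [Subtype.ext_iff, Subtype.ext_iff, coe_upperHalf]
  change (_ : ℝ) = 1 ↔ (t : ℝ) = 1
  constructor <;> intro h <;> linarith

theorem upperHalf_eq_lowerHalf {t s : Itv} : upperHalf t = lowerHalf s ↔ t = 0 ∧ s = 0 := by
  rw [Subtype.ext_iff, Subtype.ext_iff, Subtype.ext_iff, coe_upperHalf, coe_lowerHalf]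
  change (_ : ℝ) = _ ↔ (t : ℝ) = 0 ∧ (s : ℝ) = 0
  have h1 := t.2.1
  have h2 := s.2.1
  constructor
  · intro h
    constructor <;> linarith
  · rintro ⟨h, h'⟩
    rw [h, h']
    norm_num

theorem exists_half_eq (t : Itv) : (∃ s, upperHalf s = t) ∨ ∃ s, lowerHalf s = t := by
  have h1 := t.2.1
  have h2 := t.2.2
  rcases le_total (1 / 2) (t : ℝ) with h | h
  · refine Or.inl ⟨⟨2 * t - 1, by linarith, by linarith⟩, Subtype.ext ?_⟩
    rw [coe_upperHalf]
    ring
  · refine Or.inr ⟨⟨1 - 2 * t, by linarith, by linarith⟩, Subtype.ext ?_⟩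
    rw [coe_lowerHalf]
    ring

theorem lowerHalf_one : lowerHalf 1 = 0 := by
  refine Subtype.ext ?_
  rw [coe_lowerHalf]
  norm_num

theorem contMDiff_left_lowerHalf (S : W.InCollar) : ContMDiff (bdModel n) (bdModel n) ∞
    fun p : Itv × M.carrier => S.left (Prod.map lowerHalf id p) :=
  S.contMDiff_left.comp (contMDiff_affItv.prodMap contMDiff_id)

theorem injective_left_lowerHalf (S : W.InCollar) :
    Function.Injective fun p : Itv × M.carrier => S.left (Prod.map lowerHalf id p) :=
  S.injective_left.comp ((injective_affItv (by norm_num)).prodMap Function.injective_id)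

/-- The `X`-cobordism `bend W` is the composite of the unit of `M` and of `W ⨿ [0, 1] × M^*`. -/
def bendGluing (S : W.InCollar) {F : C(W.carrier, X)}
    (hl : ∀ p, F (S.left p) = M.charMap p.2) (hr : ∀ w, F (S.isotopy (1, w)) = W.charMap w)
    (hin : ∀ x, F (W.bend.inMap x) = (XManifold.empty n X pt).charMap x)
    (hout : ∀ y, F (W.bend.outMap y) = (N.sum M.dual).charMap y) :
    (unit M).Gluing (XDiffeo.refl (M.sum M.dual)) (W.sum (cylinder M.dual))
      (W.bend.withMap F hin hout) where
  -- The cylinder in `W` is cut at height `1/2`. The upper half is the unit: its end at height `1`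
  -- meets the copy of `W`, and its end at `1/2` meets the lower half. The lower half runs downward,
  -- which reverses the orientation, and is thus the cylinder on `M^*` ending on the boundary of
  -- `W`.
  left := S.left ∘ Prod.map upperHalf id
  right := Sum.elim (fun w => S.isotopy (1, w))
    fun p : Itv × M.carrier => S.left (Prod.map lowerHalf id p)
  contMDiff_left := S.contMDiff_left.comp (contMDiff_affItv.prodMap contMDiff_id)
  contMDiff_right := by
    have h := S.contMDiff_right.sumElim (contMDiff_left_lowerHalf S)
    exact h
  injective_left := S.injective_left.comp
    ((injective_affItv (by norm_num)).prodMap Function.injective_id)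
  injective_right := S.injective_right.sumElim (injective_left_lowerHalf S)
    fun w p h => lowerHalf_ne_one _ (S.eq_of_left_eq _ _ h.symm).1
  orientation_left := S.orientation_left.comp
    (preservesOrientation_affItv (by norm_num) M.orientation) S.contMDiff_left
    (contMDiff_affItv.prodMap contMDiff_id)
  orientation_right := by
    have h1 : PreservesOrientation (-M.orientation).cylinder W.orientation
        fun p : Itv × M.carrier => S.left (Prod.map lowerHalf id p) :=
      S.orientation_left.comp (preservesOrientation_affItv_neg' (by norm_num) M.orientation)
        S.contMDiff_left (contMDiff_affItv.prodMap contMDiff_id)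
    have h2 := PreservesOrientation.of_inl_inr
      (S.contMDiff_right.sumElim (contMDiff_left_lowerHalf S)) S.orientation_right h1
    exact h2
  cover := by
    intro w
    rcases S.cover w with ⟨⟨t, x⟩, rfl⟩ | ⟨w', rfl⟩
    · rcases exists_half_eq t with ⟨s, rfl⟩ | ⟨s, rfl⟩
      · exact Or.inl ⟨(s, x), rfl⟩
      · exact Or.inr ⟨Sum.inr (s, x), rfl⟩
    · exact Or.inr ⟨Sum.inl w', rfl⟩
  left_eq_right_iff := by
    rintro ⟨t, x⟩ (w | ⟨s, y⟩)
    · constructor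
      · intro h
        have h1 := S.eq_of_left_eq _ _ h
        refine ⟨Sum.inl x, Prod.ext (upperHalf_eq_one.1 h1.1) rfl, ?_⟩
        exact congrArg Sum.inl h1.2
      · rintro ⟨z | z, h1, h2⟩
        · have h3 : w = W.inMap z := Sum.inl_injective h2
          have h4 : ((t, x) : Itv × M.carrier) = (1, z) := h1
          rw [h3, h4]
          change S.left (upperHalf 1, z) = S.isotopy (1, W.inMap z)
          rw [S.isotopy_boundary, upperHalf_eq_one.2 rfl]
        · cases h2
    · constructor
      · intro h
        have h1 := Prod.ext_iff.1 (S.injective_left h)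
        have h2 := upperHalf_eq_lowerHalf.1 h1.1
        refine ⟨Sum.inr x, Prod.ext h2.1 rfl, ?_⟩
        exact congrArg Sum.inr (Prod.ext h2.2 h1.2.symm)
      · rintro ⟨z | z, h1, h2⟩
        · cases h2
        · have h3 : ((s, y) : Itv × M.carrier) = (0, z) := Sum.inr_injective h2
          have h4 : ((t, x) : Itv × M.carrier) = (0, z) := h1
          have e1 := Prod.mk.inj h3
          have e2 := Prod.mk.inj h4
          exact congrArg S.left (Prod.ext (upperHalf_eq_lowerHalf.2 ⟨e2.1, e1.1⟩)
            (e2.2.trans e1.2.symm))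
  left_inMap x := isEmptyElim x
  right_outMap := by
    rintro (y | x)
    · exact S.isotopy_of_mem 1 _ ⟨y, rfl⟩
    · exact (congrArg (fun t => S.left (t, x)) lowerHalf_one).trans (S.left_zero x)
  charMap_left p := hl _
  charMap_right := by
    rintro (w | p)
    exacts [hr w, hl _]

end XCobordism

open CategoryTheory MonoidalCategory

namespace HCobord

variable {M N P M' N' : XManifold.{u} n X pt}

theorem cob_diffeo {W : XCobordism M N} {V : XCobordism M' N'} (Ψ : W.Diffeo V) :
    cob W ≫ diffeo Ψ.outDiffeo = diffeo Ψ.inDiffeo ≫ cob V :=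
  Quotient.sound (FormalRel.cob_diffeo Ψ)

theorem cob_gluing {W : XCobordism M N} {ψ : XDiffeo N N'} {V : XCobordism N' P}
    {U : XCobordism M P} (G : W.Gluing ψ V U) : cob U = cob W ≫ diffeo ψ ≫ cob V :=
  Quotient.sound (FormalRel.gluing G)

theorem cob_cylinder (M : XManifold.{u} n X pt) :
    cob (XCobordism.cylinder M) = 𝟙 (M : HCobord.{u} n X pt) :=
  Quotient.sound (FormalRel.cylinder M)

theorem cob_tensor (W : XCobordism M N) (V : XCobordism M' N') :
    tensor (cob W) (cob V) = cob (W.sum V) :=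
  Quotient.sound (FormalRel.cob_tensor W V)

theorem cob_withMap (W : XCobordism M N) {F : C(W.carrier, X)}
    (hin : ∀ x, F (W.inMap x) = M.charMap x) (hout : ∀ y, F (W.outMap y) = N.charMap y)
    (h : F.HomotopicRel W.charMap ((bdModel n).boundary W.carrier)) :
    cob (W.withMap F hin hout) = cob W := by
  have h1 := cob_diffeo (W.withMapDiffeo (hin := hin) (hout := hout) h)
  have h2 : cob (W.withMap F hin hout) ≫ 𝟙 (N : HCobord.{u} n X pt) =
    𝟙 (M : HCobord.{u} n X pt) ≫ cob W := h1
  rwa [Category.comp_id, Category.id_comp] at h2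

/-- The bent `W`, with a collar of `M` split into halves, is the gluing of the unit of `M` with `W ⨿
(I × M^*)`. Its map to `X` must first be replaced by the homotopic one which is `g` on the collar.
-/
theorem cob_bend (W : XCobordism M N) : cob W.bend = cob (XCobordism.unit M) ≫
    tensor (cob W) (𝟙 (M.dual : HCobord.{u} n X pt)) := by
  obtain ⟨S⟩ := W.nonempty_inCollar
  obtain ⟨F, hl, hr⟩ := XCobordism.exists_collarMap S
  have hh := XCobordism.homotopicRel_collarMap S hl hr
  -- A homotopy relative to the boundary does not change the values on the boundary.
  have hout : ∀ y, F (W.bend.outMap y) = (N.sum M.dual).charMap y := by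
    obtain ⟨H⟩ := hh
    rintro (y | x)
    · refine Eq.trans ?_ (W.charMap_outMap y)
      exact H.fst_eq_snd (W.outMap_embedding.mem_boundary y)
    · refine Eq.trans ?_ (W.charMap_inMap x)
      exact H.fst_eq_snd (W.inMap_embedding.mem_boundary x)
  rw [← cob_cylinder, cob_tensor, ← cob_withMap W.bend (F := F) (fun x => isEmptyElim x) hout hh,
    cob_gluing (XCobordism.bendGluing S hl hr _ hout), diffeo_refl, Category.id_comp]

end HCobord

end Bend

end HQFT

end

noncomputable section

set_option linter.unusedSectionVars false

namespace HQFT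

open scoped Manifold ContDiff Topology

/-! ### Changing the identification of the boundary. -/

section Reindex

open Set

variable {n : ℕ} {X : Type v} [TopologicalSpace X] {pt : X}

theorem IsBoundaryEmbedding.comp_diffeo {M M' W : Type*}
    [TopologicalSpace M] [ChartedSpace (EuclideanSpace ℝ (Fin n)) M]
    [TopologicalSpace M'] [ChartedSpace (EuclideanSpace ℝ (Fin n)) M']
    [TopologicalSpace W] [ChartedSpace (BdSpace n) W]
    {oM : ManifoldOrientation (𝓡 n) M n} {oM' : ManifoldOrientation (𝓡 n) M' n}
    {oW : ManifoldOrientation (bdModel n) W (n + 1)} {f : M → W}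
    (hf : IsBoundaryEmbedding oM oW f) (φ : M' ≃ₘ^∞⟮𝓡 n, 𝓡 n⟯ M)
    (hφ : PreservesOrientation oM' oM φ) : IsBoundaryEmbedding oM' oW (f ∘ φ) where
  contMDiff := hf.contMDiff.comp φ.contMDiff
  injective := hf.injective.comp φ.injective
  mem_boundary x := hf.mem_boundary _
  orientation x θ hθ e he := by
    rw [mfderiv_comp x (hf.contMDiff.mdifferentiable (by simp) _)
      (φ.contMDiff.mdifferentiable (by simp) _)]
    exact hφ x _ (hf.orientation (φ x) θ hθ e he)

namespace XCobordism

variable {M N P M' N' : XManifold.{u} n X pt}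

/-- Change of the identifications of the boundary. -/
def reindex (W : XCobordism M N) (φ : XDiffeo M' M) (ψ : XDiffeo N' N) : XCobordism M' N' where
  carrier := W.carrier
  orientation := W.orientation
  inMap := W.inMap ∘ φ.toDiffeo
  outMap := W.outMap ∘ ψ.toDiffeo
  inMap_embedding := W.inMap_embedding.comp_diffeo φ.toDiffeo φ.orientation.neg
  outMap_embedding := W.outMap_embedding.comp_diffeo ψ.toDiffeo ψ.orientation
  inMap_ne_outMap x y := W.inMap_ne_outMap _ _
  boundary_subset := by
    have h1 : range φ.toDiffeo = univ := φ.toDiffeo.surjective.range_eq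
    have h2 : range ψ.toDiffeo = univ := ψ.toDiffeo.surjective.range_eq
    rw [range_comp, range_comp, h1, h2, image_univ, image_univ]
    exact W.boundary_subset
  charMap := W.charMap
  charMap_inMap x := (W.charMap_inMap _).trans (φ.charMap x)
  charMap_outMap x := (W.charMap_outMap _).trans (ψ.charMap x)

/-- An `X`-diffeomorphism strictly compatible with the maps to `X`. -/
def diffeoOfEq {W : XCobordism M N} {V : XCobordism M' N'}
    (Φ : W.carrier ≃ₘ^∞⟮bdModel n, bdModel n⟯ V.carrier)
    (ho : PreservesOrientation W.orientation V.orientation Φ) (φ : XDiffeo M M') (ψ : XDiffeo N N')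
    (hin : ∀ x, Φ (W.inMap x) = V.inMap (φ.toDiffeo x))
    (hout : ∀ y, Φ (W.outMap y) = V.outMap (ψ.toDiffeo y))
    (hX : ∀ w, W.charMap w = V.charMap (Φ w)) : W.Diffeo V where
  toDiffeo := Φ
  orientation := ho
  inDiffeo := φ
  outDiffeo := ψ
  comm_in := hin
  comm_out := hout
  homotopic := by
    have h : W.charMap = V.charMap.comp ⟨Φ, Φ.continuous⟩ := ContinuousMap.ext hX
    rw [← h]
    exact ContinuousMap.HomotopicRel.refl _

/-- The identity map, as an `X`-diffeomorphism onto the same `X`-cobordism with other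
identifications of the boundary. -/
def reindexDiffeo (W : XCobordism M N) (φ : XDiffeo M' M) (ψ : XDiffeo N' N) :
    (W.reindex φ ψ).Diffeo W :=
  diffeoOfEq (W := W.reindex φ ψ) (V := W) (Diffeomorph.refl (bdModel n) W.carrier ∞)
    (PreservesOrientation.id W.orientation) φ ψ (fun _ => rfl) (fun _ => rfl) fun _ => rfl

end XCobordism

end Reindex

/-! ### Affine pieces of a cylinder. -/

section Pieces

variable {n : ℕ} {M : Type*} [TopologicalSpace M] [ChartedSpace (EuclideanSpace ℝ (Fin n)) M]
  [IsManifold (𝓡 n) 1 M] {a b : ℝ}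

/-- The affine map `(t, x) ↦ (a + b t, x)` of a cylinder. -/
def piece (M : Type*) (a b : ℝ) (h : 0 ≤ a ∧ a ≤ 1 ∧ 0 ≤ a + b ∧ a + b ≤ 1) :
    Itv × M → Itv × M :=
  Prod.map (affItv a b h.1 h.2.1 h.2.2.1 h.2.2.2) id

variable {h : 0 ≤ a ∧ a ≤ 1 ∧ 0 ≤ a + b ∧ a + b ≤ 1}

theorem contMDiff_piece : ContMDiff (bdModel n) (bdModel n) ∞ (piece M a b h) :=
  contMDiff_affItv.prodMap contMDiff_id

theorem injective_piece (hb : b ≠ 0) : Function.Injective (piece M a b h) :=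
  (injective_affItv hb).prodMap Function.injective_id

theorem piece_eq_iff {a' b' : ℝ} {h' : 0 ≤ a' ∧ a' ≤ 1 ∧ 0 ≤ a' + b' ∧ a' + b' ≤ 1}
    {p q : Itv × M} : piece M a b h p = piece M a' b' h' q ↔
      a + b * p.1 = a' + b' * q.1 ∧ p.2 = q.2 := by
  rw [Prod.ext_iff, Subtype.ext_iff]
  rfl

theorem piece_eq {p q : Itv × M} (h1 : a + b * p.1 = q.1) (h2 : p.2 = q.2) :
    piece M a b h p = q :=
  Prod.ext (Subtype.ext h1) h2

theorem piece_surj (hb : b ≠ 0) {q : Itv × M} (h0 : 0 ≤ ((q.1 : ℝ) - a) / b)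
    (h1 : ((q.1 : ℝ) - a) / b ≤ 1) : ∃ p, piece M a b h p = q :=
  ⟨(⟨_, h0, h1⟩, q.2), piece_eq (by
    change a + b * (((q.1 : ℝ) - a) / b) = q.1
    rw [mul_div_cancel₀ _ hb]
    ring) rfl⟩

theorem preservesOrientation_piece (hb : 0 < b) (oM : ManifoldOrientation (𝓡 n) M n) :
    PreservesOrientation oM.cylinder oM.cylinder (piece M a b h) :=
  preservesOrientation_affItv hb oM

theorem preservesOrientation_piece_neg (hb : b < 0) (oM : ManifoldOrientation (𝓡 n) M n) :
    PreservesOrientation oM.cylinder (-oM).cylinder (piece M a b h) :=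
  preservesOrientation_affItv_neg hb oM

end Pieces

/-! ### The cylinder as a zigzag of four cylinders. -/

section Triangles

open CategoryTheory MonoidalCategory

variable {n : ℕ} {X : Type v} [TopologicalSpace X] {pt : X}

namespace XCobordism

/-- The composite of `[0, 1] × M` bent twice is the cylinder, cut into four pieces. -/
def triangleGluing (M : XManifold.{u} n X pt) :
    ((unit M).sum (cylinder M)).Gluing (XDiffeo.assoc M M.dual M) ((cylinder M).sum (counit M))
      ((cylinder M).reindex (XDiffeo.emptySum M) (XDiffeo.sumEmpty M)) where
  -- From bottom to top, the quarters are the cylinder of the first factor, the counit, the unit,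
  -- and the cylinder of the second factor. All four run upward, since all are oriented as cylinders
  -- on `M`.
  left := Sum.elim (piece M.carrier (1 / 2) (1 / 4) (by norm_num))
    (piece M.carrier 0 (1 / 4) (by norm_num))
  right := Sum.elim (piece M.carrier (3 / 4) (1 / 4) (by norm_num))
    (piece M.carrier (1 / 4) (1 / 4) (by norm_num))
  contMDiff_left := (contMDiff_piece (h := by norm_num)).sumElim (contMDiff_piece (h := by norm_num))
  contMDiff_right := (contMDiff_piece (h := by norm_num)).sumElim (contMDiff_piece (h := by norm_num))
  injective_left := (injective_piece (h := by norm_num) (by norm_num)).sumElim (injective_piece (h := by norm_num) (by norm_num)) (by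
    rintro ⟨⟨t, ht⟩, x⟩ ⟨⟨s, hs⟩, y⟩ h
    have h1 := ((piece_eq_iff (h := by norm_num) (h' := by norm_num)).1 h).1
    simp only at h1
    linarith [ht.1, ht.2, hs.1, hs.2])
  injective_right := (injective_piece (h := by norm_num) (by norm_num)).sumElim (injective_piece (h := by norm_num) (by norm_num)) (by
    rintro ⟨⟨t, ht⟩, x⟩ ⟨⟨s, hs⟩, y⟩ h
    have h1 := ((piece_eq_iff (h := by norm_num) (h' := by norm_num)).1 h).1
    simp only at h1
    linarith [ht.1, ht.2, hs.1, hs.2])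
  orientation_left := .of_inl_inr ((contMDiff_piece (h := by norm_num)).sumElim (contMDiff_piece (h := by norm_num)))
    (preservesOrientation_piece (h := by norm_num) (by norm_num) M.orientation)
    (preservesOrientation_piece (h := by norm_num) (by norm_num) M.orientation)
  orientation_right := .of_inl_inr ((contMDiff_piece (h := by norm_num)).sumElim (contMDiff_piece (h := by norm_num)))
    (preservesOrientation_piece (h := by norm_num) (by norm_num) M.orientation)
    (preservesOrientation_piece (h := by norm_num) (by norm_num) M.orientation)
  cover := by
    rintro ⟨⟨t, ht⟩, x⟩
    rcases le_total t (1 / 2) with h | h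
    · rcases le_total t (1 / 4) with h' | h'
      · obtain ⟨p, hp⟩ := piece_surj (M := M.carrier) (a := 0) (b := 1 / 4) (h := by norm_num)
          (q := (⟨t, ht⟩, x)) (by norm_num) (by linarith [ht.1]) (by linarith)
        exact Or.inl ⟨Sum.inr p, hp⟩
      · obtain ⟨p, hp⟩ := piece_surj (M := M.carrier) (a := 1 / 4) (b := 1 / 4) (h := by norm_num)
          (q := (⟨t, ht⟩, x)) (by norm_num) (by linarith) (by linarith)
        exact Or.inr ⟨Sum.inr p, hp⟩
    · rcases le_total t (3 / 4) with h' | h'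
      · obtain ⟨p, hp⟩ := piece_surj (M := M.carrier) (a := 1 / 2) (b := 1 / 4) (h := by norm_num)
          (q := (⟨t, ht⟩, x)) (by norm_num) (by linarith) (by linarith)
        exact Or.inl ⟨Sum.inl p, hp⟩
      · obtain ⟨p, hp⟩ := piece_surj (M := M.carrier) (a := 3 / 4) (b := 1 / 4) (h := by norm_num)
          (q := (⟨t, ht⟩, x)) (by norm_num) (by linarith) (by linarith [ht.2])
        exact Or.inr ⟨Sum.inl p, hp⟩
  left_eq_right_iff := by
    intro w v
    constructor
    · rcases w with ⟨⟨t, ht⟩, x⟩ | ⟨⟨t, ht⟩, x⟩ <;> rcases v with ⟨⟨s, hs⟩, y⟩ | ⟨⟨s, hs⟩, y⟩ <;>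
        intro h <;> obtain ⟨h1, h2⟩ := (piece_eq_iff (h := by norm_num) (h' := by norm_num)).1 h <;>
        simp only at h1 h2 <;> subst h2
      · have e1 : t = 1 := by linarith [ht.1, ht.2, hs.1, hs.2]
        have e2 : s = 0 := by linarith [ht.1, ht.2, hs.1, hs.2]
        subst e1 e2
        exact ⟨Sum.inl (Sum.inl x), rfl, rfl⟩
      · have e1 : t = 0 := by linarith [ht.1, ht.2, hs.1, hs.2]
        have e2 : s = 1 := by linarith [ht.1, ht.2, hs.1, hs.2]
        subst e1 e2
        exact ⟨Sum.inl (Sum.inr x), rfl, rfl⟩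
      -- The bottom quarter and the top quarter do not meet, so no identification is needed here;
      -- the three other pairs share one face each.
      · linarith [ht.1, ht.2, hs.1, hs.2]
      · have e1 : t = 1 := by linarith [ht.1, ht.2, hs.1, hs.2]
        have e2 : s = 0 := by linarith [ht.1, ht.2, hs.1, hs.2]
        subst e1 e2
        exact ⟨Sum.inr x, rfl, rfl⟩
    · rintro ⟨(x | x) | x, rfl, rfl⟩
      · exact (piece_eq_iff (h := by norm_num) (h' := by norm_num)).2 ⟨by
          change (1 / 2 : ℝ) + 1 / 4 * (1 : ℝ) = 3 / 4 + 1 / 4 * (0 : ℝ)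
          norm_num, rfl⟩
      · exact (piece_eq_iff (h := by norm_num) (h' := by norm_num)).2 ⟨by
          change (1 / 2 : ℝ) + 1 / 4 * (0 : ℝ) = 1 / 4 + 1 / 4 * (1 : ℝ)
          norm_num, rfl⟩
      · exact (piece_eq_iff (h := by norm_num) (h' := by norm_num)).2 ⟨by
          change (0 : ℝ) + 1 / 4 * (1 : ℝ) = 1 / 4 + 1 / 4 * (0 : ℝ)
          norm_num, rfl⟩
  left_inMap := by
    rintro (x | x)
    · exact isEmptyElim x
    · exact piece_eq (h := by norm_num) (by change (0 : ℝ) + 1 / 4 * (0 : ℝ) = 0; norm_num) rfl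
  right_outMap := by
    rintro (x | x)
    · exact piece_eq (h := by norm_num) (by change (3 / 4 : ℝ) + 1 / 4 * (1 : ℝ) = 1; norm_num) rfl
    · exact isEmptyElim x
  charMap_left := by rintro (p | p) <;> rfl
  charMap_right := by rintro (p | p) <;> rfl

/-- The composite of `[0, 1] × M` bent twice in the other way is the cylinder on `M^*`, cut into
four pieces. -/
def triangleDualGluing (M : XManifold.{u} n X pt) :
    ((cylinder M.dual).sum (unit M)).Gluing (XDiffeo.assoc M.dual M M.dual).symm
      ((counit M).sum (cylinder M.dual))
      ((cylinder M.dual).reindex (XDiffeo.sumEmpty M.dual) (XDiffeo.emptySum M.dual)) where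
  -- From bottom to top, the quarters are the first cylinder, the counit, the unit and the second
  -- cylinder. The unit and counit are oriented as cylinders on `M` inside a cylinder on `-M`, and
  -- so they run downward.
  left := Sum.elim (piece M.carrier 0 (1 / 4) (by norm_num))
    (piece M.carrier (3 / 4) (-1 / 4) (by norm_num))
  right := Sum.elim (piece M.carrier (1 / 2) (-1 / 4) (by norm_num))
    (piece M.carrier (3 / 4) (1 / 4) (by norm_num))
  contMDiff_left := by
    have h : ContMDiff (bdModel n) (bdModel n) ∞ (Sum.elim
        (piece M.carrier 0 (1 / 4) (by norm_num)) (piece M.carrier (3 / 4) (-1 / 4) (by norm_num))) :=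
      (contMDiff_piece (h := by norm_num)).sumElim (contMDiff_piece (h := by norm_num))
    exact h
  contMDiff_right := by
    have h : ContMDiff (bdModel n) (bdModel n) ∞ (Sum.elim
        (piece M.carrier (1 / 2) (-1 / 4) (by norm_num)) (piece M.carrier (3 / 4) (1 / 4) (by norm_num))) :=
      (contMDiff_piece (h := by norm_num)).sumElim (contMDiff_piece (h := by norm_num))
    exact h
  injective_left := (injective_piece (h := by norm_num) (by norm_num)).sumElim (injective_piece (h := by norm_num) (by norm_num)) (by
    rintro ⟨⟨t, ht⟩, x⟩ ⟨⟨s, hs⟩, y⟩ h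
    have h1 := ((piece_eq_iff (h := by norm_num) (h' := by norm_num)).1 h).1
    simp only at h1
    linarith [ht.1, ht.2, hs.1, hs.2])
  injective_right := (injective_piece (h := by norm_num) (by norm_num)).sumElim (injective_piece (h := by norm_num) (by norm_num)) (by
    rintro ⟨⟨t, ht⟩, x⟩ ⟨⟨s, hs⟩, y⟩ h
    have h1 := ((piece_eq_iff (h := by norm_num) (h' := by norm_num)).1 h).1
    simp only at h1
    linarith [ht.1, ht.2, hs.1, hs.2])
  orientation_left := by
    have h := PreservesOrientation.of_inl_inr
      (f := Sum.elim (piece M.carrier 0 (1 / 4) (by norm_num))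
        (piece M.carrier (3 / 4) (-1 / 4) (by norm_num)))
      ((contMDiff_piece (h := by norm_num)).sumElim (contMDiff_piece (h := by norm_num)))
      (preservesOrientation_piece (h := by norm_num) (by norm_num) (-M.orientation))
      (preservesOrientation_piece_neg (h := by norm_num) (by norm_num) M.orientation)
    exact h
  orientation_right := by
    have h := PreservesOrientation.of_inl_inr
      (f := Sum.elim (piece M.carrier (1 / 2) (-1 / 4) (by norm_num))
        (piece M.carrier (3 / 4) (1 / 4) (by norm_num)))
      ((contMDiff_piece (h := by norm_num)).sumElim (contMDiff_piece (h := by norm_num)))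
      (preservesOrientation_piece_neg (h := by norm_num) (by norm_num) M.orientation)
      (preservesOrientation_piece (h := by norm_num) (by norm_num) (-M.orientation))
    exact h
  cover := by
    rintro ⟨⟨t, ht⟩, x⟩
    rcases le_total t (1 / 2) with h | h
    · rcases le_total t (1 / 4) with h' | h'
      · obtain ⟨p, hp⟩ := piece_surj (M := M.carrier) (a := 0) (b := 1 / 4) (h := by norm_num)
          (q := (⟨t, ht⟩, x)) (by norm_num) (by linarith [ht.1]) (by linarith)
        exact Or.inl ⟨Sum.inl p, hp⟩
      · obtain ⟨p, hp⟩ := piece_surj (M := M.carrier) (a := 1 / 2) (b := -1 / 4) (h := by norm_num)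
          (q := (⟨t, ht⟩, x)) (by norm_num) (by linarith) (by linarith)
        exact Or.inr ⟨Sum.inl p, hp⟩
    · rcases le_total t (3 / 4) with h' | h'
      · obtain ⟨p, hp⟩ := piece_surj (M := M.carrier) (a := 3 / 4) (b := -1 / 4) (h := by norm_num)
          (q := (⟨t, ht⟩, x)) (by norm_num) (by linarith) (by linarith)
        exact Or.inl ⟨Sum.inr p, hp⟩
      · obtain ⟨p, hp⟩ := piece_surj (M := M.carrier) (a := 3 / 4) (b := 1 / 4) (h := by norm_num)
          (q := (⟨t, ht⟩, x)) (by norm_num) (by linarith) (by linarith [ht.2])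
        exact Or.inr ⟨Sum.inr p, hp⟩
  left_eq_right_iff := by
    intro w v
    constructor
    · rcases w with ⟨⟨t, ht⟩, x⟩ | ⟨⟨t, ht⟩, x⟩ <;> rcases v with ⟨⟨s, hs⟩, y⟩ | ⟨⟨s, hs⟩, y⟩ <;>
        intro h <;> obtain ⟨h1, h2⟩ := (piece_eq_iff (h := by norm_num) (h' := by norm_num)).1 h <;>
        simp only at h1 h2 <;> subst h2
      · have e1 : t = 1 := by linarith [ht.1, ht.2, hs.1, hs.2]
        have e2 : s = 1 := by linarith [ht.1, ht.2, hs.1, hs.2]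
        subst e1 e2
        exact ⟨Sum.inl x, rfl, rfl⟩
      -- Again the bottom and the top quarter are disjoint.
      · linarith [ht.1, ht.2, hs.1, hs.2]
      · have e1 : t = 1 := by linarith [ht.1, ht.2, hs.1, hs.2]
        have e2 : s = 0 := by linarith [ht.1, ht.2, hs.1, hs.2]
        subst e1 e2
        exact ⟨Sum.inr (Sum.inl x), rfl, rfl⟩
      · have e1 : t = 0 := by linarith [ht.1, ht.2, hs.1, hs.2]
        have e2 : s = 0 := by linarith [ht.1, ht.2, hs.1, hs.2]
        subst e1 e2
        exact ⟨Sum.inr (Sum.inr x), rfl, rfl⟩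
    · rintro ⟨x | (x | x), rfl, rfl⟩
      · exact (piece_eq_iff (h := by norm_num) (h' := by norm_num)).2 ⟨by
          change (0 : ℝ) + 1 / 4 * (1 : ℝ) = 1 / 2 + -1 / 4 * (1 : ℝ)
          norm_num, rfl⟩
      · exact (piece_eq_iff (h := by norm_num) (h' := by norm_num)).2 ⟨by
          change (3 / 4 : ℝ) + -1 / 4 * (1 : ℝ) = 1 / 2 + -1 / 4 * (0 : ℝ)
          norm_num, rfl⟩
      · exact (piece_eq_iff (h := by norm_num) (h' := by norm_num)).2 ⟨by
          change (3 / 4 : ℝ) + -1 / 4 * (0 : ℝ) = 3 / 4 + 1 / 4 * (0 : ℝ)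
          norm_num, rfl⟩
  left_inMap := by
    rintro (x | x)
    · exact piece_eq (h := by norm_num) (by change (0 : ℝ) + 1 / 4 * (0 : ℝ) = 0; norm_num) rfl
    · exact isEmptyElim x
  right_outMap := by
    rintro (x | x)
    · exact isEmptyElim x
    · exact piece_eq (h := by norm_num) (by change (3 / 4 : ℝ) + 1 / 4 * (1 : ℝ) = 1; norm_num) rfl
  charMap_left := by rintro (p | p) <;> rfl
  charMap_right := by rintro (p | p) <;> rfl

end XCobordism

end Triangles

end HQFT

end

noncomputable section

set_option linter.unusedSectionVars false

namespace HQFT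


open CategoryTheory MonoidalCategory

/-! ### Dual morphisms in a monoidal category with duals. -/

namespace DualityData

variable {C : Type*} [Category C] [MonoidalCategory C] {D : DualityData C}

/-- By the interchange law `g` can be moved past `ε_a`, and the triangular identity for `a^*`
removes what is left. So a morphism out of `a^*` is determined by the copairing it produces from
`η_a`; every computation of a canonical isomorphism or of a dual morphism below rests on this. -/
theorem IsDuality.compareDuals_eq (hD : D.IsDuality) {a y : C} (g : D.dual a ⟶ y) :
    compareDuals (D.ε a) (D.η a ≫ a ◁ g) = g := by
  have h : D.dual a ◁ a ◁ g ≫ (α_ (D.dual a) a y).inv ≫ D.ε a ▷ y ≫ (λ_ y).hom =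
      (α_ (D.dual a) a (D.dual a)).inv ≫ D.ε a ▷ D.dual a ≫ (λ_ (D.dual a)).hom ≫ g := by
    rw [← leftUnitor_naturality, ← whisker_exchange_assoc, tensor_whiskerLeft]
    simp
  rw [compareDuals, whiskerLeft_comp, Category.assoc, h]
  have h2 := congrArg (· ≫ g) (hD.triangle_dual a)
  simpa only [Category.assoc, Category.id_comp] using h2

/-- The dual of a morphism is characterized by its compatibility with the units. -/
theorem IsDuality.dualMap_eq (hD : D.IsDuality) {a b : C} {f : a ⟶ b} {g : D.dual b ⟶ D.dual a}
    (h : D.η a ≫ f ▷ D.dual a = D.η b ≫ b ◁ g) : D.dualMap f = g := by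
  -- For the copairing `η_a (f ⊗ 1)` the comparison morphism is `f^*` by definition.
  rw [← hD.compareDuals_eq g, ← h, compareDuals, dualMap, whiskerLeft_comp, Category.assoc]

end DualityData

/-! ### Units and counits of a tensor product as permuted tensor products. -/

section CoherenceLemmas

variable {C : Type*} [Category C] [MonoidalCategory C] [SymmetricCategory C]

/-- The nested insertion of `η_b` inside `η_a` becomes `η_a ⊗ η_b` followed by a permutation,
because the braiding is natural and trivial on the unit object. In this form it is a disjoint union
of two cylinders followed by a diffeomorphism. -/
theorem tensorη_eq {D : DualityData C} (a b : C) : D.tensorη a b =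
    (ρ_ (𝟙_ C)).inv ≫ (D.η a ⊗ₘ D.η b) ≫ (α_ a (D.dual a) (b ⊗ D.dual b)).hom ≫
      a ◁ (β_ (D.dual a) (b ⊗ D.dual b)).hom ≫ a ◁ (α_ b (D.dual b) (D.dual a)).hom ≫
        a ◁ (b ◁ (β_ (D.dual b) (D.dual a)).hom) ≫ (α_ a b (D.dual a ⊗ D.dual b)).inv := by
  have h1 : (λ_ (D.dual a)).inv ≫ D.η b ▷ D.dual a =
      (ρ_ (D.dual a)).inv ≫ D.dual a ◁ D.η b ≫ (β_ (D.dual a) (b ⊗ D.dual b)).hom := by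
    rw [BraidedCategory.braiding_naturality_right, ← Category.assoc]
    simp
  have h2 : D.η a ≫ a ◁ (ρ_ (D.dual a)).inv ≫ a ◁ D.dual a ◁ D.η b =
      (ρ_ (𝟙_ C)).inv ≫ (D.η a ⊗ₘ D.η b) ≫ (α_ a (D.dual a) (b ⊗ D.dual b)).hom := by
    rw [MonoidalCategory.tensorHom_def, tensor_whiskerLeft]
    simp
  rw [DualityData.tensorη, ← whiskerLeft_comp_assoc, h1, whiskerLeft_comp, whiskerLeft_comp]
  have h3 := congrArg (· ≫ a ◁ (β_ (D.dual a) (b ⊗ D.dual b)).hom ≫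
    a ◁ (α_ b (D.dual b) (D.dual a)).hom ≫ a ◁ (b ◁ (β_ (D.dual b) (D.dual a)).hom) ≫
      (α_ a b (D.dual a ⊗ D.dual b)).inv) h2
  simpa only [Category.assoc] using h3

/-- Mirror image of `tensorη_eq`: `ε_a` is moved to the right of `b` by naturality of the braiding,
which leaves `ε_b ⊗ ε_a` after a permutation. -/
theorem tensorε_eq {D : DualityData C} (a b : C) : D.tensorε a b =
    (β_ (D.dual a) (D.dual b)).hom ▷ (a ⊗ b) ≫ (α_ (D.dual b) (D.dual a) (a ⊗ b)).hom ≫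
    D.dual b ◁ (α_ (D.dual a) a b).inv ≫ D.dual b ◁ (β_ (D.dual a ⊗ a) b).hom ≫
      (α_ (D.dual b) b (D.dual a ⊗ a)).inv ≫ (D.ε b ⊗ₘ D.ε a) ≫ (ρ_ (𝟙_ C)).hom := by
  have h1 : D.ε a ▷ b ≫ (λ_ b).hom = (β_ (D.dual a ⊗ a) b).hom ≫ b ◁ D.ε a ≫ (ρ_ b).hom := by
    rw [← BraidedCategory.braiding_naturality_left_assoc]
    simp
  rw [DualityData.tensorε, ← whiskerLeft_comp_assoc (D.dual b) (D.ε a ▷ b), h1,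
    MonoidalCategory.tensorHom_def']
  simp

end CoherenceLemmas

end HQFT

end

noncomputable section

set_option linter.unusedSectionVars false

namespace HQFT

/-! ### Diffeomorphisms between cylinders. -/

section CylinderDiffeos

open scoped Manifold ContDiff Topology

variable {n : ℕ}

section

variable {M N : Type*} [TopologicalSpace M] [ChartedSpace (EuclideanSpace ℝ (Fin n)) M]
  [TopologicalSpace N] [ChartedSpace (EuclideanSpace ℝ (Fin n)) N]

/-- The reflection `t ↦ 1 - t` of the unit interval. -/
def reflectItv : Itv → Itv :=
  affItv 1 (-1) (by norm_num) (by norm_num) (by norm_num) (by norm_num)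

theorem coe_reflectItv (t : Itv) : (reflectItv t : ℝ) = 1 - t := by
  change (1 : ℝ) + -1 * t = 1 - t
  ring

theorem reflectItv_reflectItv (t : Itv) : reflectItv (reflectItv t) = t := by
  refine Subtype.ext ?_
  rw [coe_reflectItv, coe_reflectItv]
  ring

theorem reflectItv_zero : reflectItv 0 = 1 :=
  Subtype.ext ((coe_reflectItv 0).trans (sub_zero 1))

theorem reflectItv_one : reflectItv 1 = 0 :=
  Subtype.ext ((coe_reflectItv 1).trans (sub_self 1))

variable (n M) in
/-- The reflection of a cylinder. -/
def reflectCylinder : (Itv × M) ≃ₘ^∞⟮bdModel n, bdModel n⟯ (Itv × M) where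
  toFun := Prod.map reflectItv id
  invFun := Prod.map reflectItv id
  left_inv p := Prod.ext (reflectItv_reflectItv p.1) rfl
  right_inv p := Prod.ext (reflectItv_reflectItv p.1) rfl
  contMDiff_toFun := contMDiff_affItv.prodMap contMDiff_id
  contMDiff_invFun := contMDiff_affItv.prodMap contMDiff_id

/-- The product of the interval and a diffeomorphism. -/
def cylinderCongr (ψ : M ≃ₘ^∞⟮𝓡 n, 𝓡 n⟯ N) :
    (Itv × M) ≃ₘ^∞⟮bdModel n, bdModel n⟯ (Itv × N) where
  toFun := Prod.map id ψ
  invFun := Prod.map id ψ.symm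
  left_inv p := Prod.ext rfl (ψ.symm_apply_apply p.2)
  right_inv p := Prod.ext rfl (ψ.apply_symm_apply p.2)
  contMDiff_toFun := contMDiff_id.prodMap ψ.contMDiff
  contMDiff_invFun := contMDiff_id.prodMap ψ.symm.contMDiff

variable (n M N) in
/-- The cylinder of a disjoint union. -/
def cylinderSum : ((Itv × M) ⊕ (Itv × N)) ≃ₘ^∞⟮bdModel n, bdModel n⟯ (Itv × (M ⊕ N)) where
  toEquiv := (Equiv.prodSumDistrib Itv M N).symm
  contMDiff_toFun := by
    have h : ContMDiff (bdModel n) (bdModel n) ∞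
        (Sum.elim (Prod.map id Sum.inl) (Prod.map id Sum.inr) :
          (Itv × M) ⊕ (Itv × N) → Itv × (M ⊕ N)) :=
      (contMDiff_id.prodMap ContMDiff.inl).sumElim (contMDiff_id.prodMap ContMDiff.inr)
    refine h.congr ?_
    rintro (p | p) <;> rfl
  contMDiff_invFun := by
    rintro ⟨t, x | x⟩
    -- Near a point of the first summand the inverse is given by a globally defined smooth map; its
    -- constant value `x` on the other summand is arbitrary.
    · have h : ContMDiff (bdModel n) (bdModel n) ∞
          (Sum.inl ∘ Prod.map id (Sum.elim id fun _ => x) :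
            Itv × (M ⊕ N) → (Itv × M) ⊕ (Itv × N)) :=
        ContMDiff.inl.comp (contMDiff_id.prodMap (contMDiff_id.sumElim contMDiff_const))
      refine (h _).congr_of_eventuallyEq ?_
      filter_upwards [(isOpen_range_inl.preimage continuous_snd).mem_nhds ⟨x, rfl⟩]
      rintro ⟨s, y | y⟩ hy
      · rfl
      · obtain ⟨z, hz⟩ := hy
        cases hz
    · have h : ContMDiff (bdModel n) (bdModel n) ∞
          (Sum.inr ∘ Prod.map id (Sum.elim (fun _ => x) id) :
            Itv × (M ⊕ N) → (Itv × M) ⊕ (Itv × N)) :=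
        ContMDiff.inr.comp (contMDiff_id.prodMap (contMDiff_const.sumElim contMDiff_id))
      refine (h _).congr_of_eventuallyEq ?_
      filter_upwards [(isOpen_range_inr.preimage continuous_snd).mem_nhds ⟨x, rfl⟩]
      rintro ⟨s, y | y⟩ hy
      · obtain ⟨z, hz⟩ := hy
        cases hz
      · rfl

variable [IsManifold (𝓡 n) 1 M] [IsManifold (𝓡 n) 1 N]

theorem preservesOrientation_prodMap_id {ψ : M → N} (hψ : ContMDiff (𝓡 n) (𝓡 n) ∞ ψ)
    {oM : ManifoldOrientation (𝓡 n) M n} {oN : ManifoldOrientation (𝓡 n) N n}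
    (ho : PreservesOrientation oM oN ψ) :
    PreservesOrientation oM.cylinder oN.cylinder (Prod.map id ψ : Itv × M → Itv × N) :=
  preservesOrientation_prodMap contDiff_id (fun _ => rfl) (fun t => by simp) hψ ho

theorem preservesOrientation_cylinderSum (oM : ManifoldOrientation (𝓡 n) M n)
    (oN : ManifoldOrientation (𝓡 n) N n) : PreservesOrientation (oM.cylinder.sum oN.cylinder)
      (oM.sum oN).cylinder (cylinderSum n M N) :=
  .of_inl_inr (cylinderSum n M N).contMDiff
    (preservesOrientation_prodMap_id ContMDiff.inl (.inl oM oN))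
    (preservesOrientation_prodMap_id ContMDiff.inr (.inr oM oN))

end

variable {X : Type v} [TopologicalSpace X] {pt : X}

/-- Change of the orientation of an `X`-manifold. -/
def XManifold.withOrientation (M : XManifold.{u} n X pt)
    (o : ManifoldOrientation (𝓡 n) M.carrier n) : XManifold.{u} n X pt :=
  { M with orientation := o }

namespace XDiffeo

/-- The identity map, between equal orientations. -/
def ofOrientationEq (M : XManifold.{u} n X pt) {o : ManifoldOrientation (𝓡 n) M.carrier n}
    (h : o = M.orientation) : XDiffeo (M.withOrientation o) M where
  toDiffeo := Diffeomorph.refl (𝓡 n) M.carrier ∞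
  orientation := h ▸ PreservesOrientation.id o
  basePoints := fun _ hb => hb
  charMap := fun _ => rfl

/-- The identity `M^** → M`. -/
def dualDual (M : XManifold.{u} n X pt) : XDiffeo M.dual.dual M :=
  ofOrientationEq M (ManifoldOrientation.neg_neg M.orientation)

/-- The identity `(M ⨿ N)^* → M^* ⨿ N^*`. -/
def dualSum (M N : XManifold.{u} n X pt) : XDiffeo (M.sum N).dual (M.dual.sum N.dual) :=
  ofOrientationEq (M.dual.sum N.dual) (ManifoldOrientation.neg_sum M.orientation N.orientation)

variable (n X pt) in
/-- The identity `∅^* → ∅`. -/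
def dualEmpty : XDiffeo (XManifold.empty.{u} n X pt).dual (XManifold.empty n X pt) :=
  ofOrientationEq (XManifold.empty n X pt) (ManifoldOrientation.eq_of_isEmpty _ _)

/-- The permutation `(M ⨿ M^*) ⨿ (N ⨿ N^*) → (M ⨿ N) ⨿ (M^* ⨿ N^*)`. -/
def permUnit (M N : XManifold.{u} n X pt) :
    XDiffeo ((M.sum M.dual).sum (N.sum N.dual)) ((M.sum N).sum (M.dual.sum N.dual)) :=
  (assoc M M.dual (N.sum N.dual)).trans <|
    ((refl M).sum (swap M.dual (N.sum N.dual))).trans <|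
    ((refl M).sum (assoc N N.dual M.dual)).trans <|
    ((refl M).sum ((refl N).sum (swap N.dual M.dual))).trans
      (assoc M N (M.dual.sum N.dual)).symm

/-- The permutation `(M^* ⨿ N^*) ⨿ (M ⨿ N) → (N^* ⨿ N) ⨿ (M^* ⨿ M)`. -/
def permCounit (M N : XManifold.{u} n X pt) :
    XDiffeo ((M.dual.sum N.dual).sum (M.sum N)) ((N.dual.sum N).sum (M.dual.sum M)) :=
  ((swap M.dual N.dual).sum (refl (M.sum N))).trans <|
    (assoc N.dual M.dual (M.sum N)).trans <|
    ((refl N.dual).sum (assoc M.dual M N).symm).trans <|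
    ((refl N.dual).sum (swap (M.dual.sum M) N)).trans (assoc N.dual N (M.dual.sum M)).symm

end XDiffeo

namespace XCobordism

variable {M N : XManifold.{u} n X pt}

variable (M) in
/-- The unit of `M^*` is the unit of `M`, reflected. -/
def unitDualDiffeo : (unit M).Diffeo (unit M.dual) :=
  diffeoOfEq (W := unit M) (V := unit M.dual) (reflectCylinder n M.carrier)
    (preservesOrientation_affItv_neg (by norm_num) M.orientation) (XDiffeo.refl _)
    ((XDiffeo.swap M M.dual).trans ((XDiffeo.refl M.dual).sum (XDiffeo.dualDual M).symm))
    (fun x => isEmptyElim x)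
    (by
      rintro (x | x)
      exacts [Prod.ext reflectItv_one rfl, Prod.ext reflectItv_zero rfl])
    fun _ => rfl

/-- The unit is natural for `X`-diffeomorphisms. -/
def unitCongr (ψ : XDiffeo M N) : (unit M).Diffeo (unit N) :=
  diffeoOfEq (W := unit M) (V := unit N) (cylinderCongr ψ.toDiffeo)
    (preservesOrientation_prodMap_id ψ.toDiffeo.contMDiff ψ.orientation) (XDiffeo.refl _)
    (ψ.sum ψ.neg) (fun x => isEmptyElim x) (by rintro (x | x) <;> rfl)
    fun p => (ψ.charMap p.2).symm

variable (M N) in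
/-- The unit of a disjoint union. -/
def unitSumDiffeo : ((unit M).sum (unit N)).Diffeo (unit (M.sum N)) :=
  diffeoOfEq (W := (unit M).sum (unit N)) (V := unit (M.sum N))
    (cylinderSum n M.carrier N.carrier)
    (preservesOrientation_cylinderSum M.orientation N.orientation)
    (XDiffeo.sumEmpty (XManifold.empty n X pt))
    ((XDiffeo.permUnit M N).trans ((XDiffeo.refl (M.sum N)).sum (XDiffeo.dualSum M N).symm))
    (by rintro (x | x) <;> exact isEmptyElim x)
    (by rintro ((x | x) | (x | x)) <;> rfl)
    (by rintro (x | x) <;> rfl)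

variable (M N) in
/-- The counit of a disjoint union. -/
def counitSumDiffeo : ((counit N).sum (counit M)).Diffeo (counit (M.sum N)) :=
  diffeoOfEq (W := (counit N).sum (counit M)) (V := counit (M.sum N))
    ((Diffeomorph.sumComm (bdModel n) (Itv × N.carrier) ∞ (Itv × M.carrier)).trans
      (cylinderSum n M.carrier N.carrier))
    ((preservesOrientation_cylinderSum M.orientation N.orientation).comp
      (.of_inl_inr (Diffeomorph.contMDiff _)
        (PreservesOrientation.inr M.orientation.cylinder N.orientation.cylinder)
        (PreservesOrientation.inl M.orientation.cylinder N.orientation.cylinder))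
      (Diffeomorph.contMDiff _) (Diffeomorph.contMDiff _))
    ((XDiffeo.permCounit M N).symm.trans
      ((XDiffeo.dualSum M N).symm.sum (XDiffeo.refl (M.sum N))))
    (XDiffeo.sumEmpty (XManifold.empty n X pt))
    (by rintro ((x | x) | (x | x)) <;> rfl)
    (by rintro (x | x) <;> exact isEmptyElim x)
    (by rintro (x | x) <;> rfl)

variable (M) in
/-- The reverse of the counit of `M` is the unit of `M`. -/
def unitReverseDiffeo : (unit M).Diffeo (counit M).reverse :=
  diffeoOfEq (W := unit M) (V := (counit M).reverse)
    (Diffeomorph.refl (bdModel n) (Itv × M.carrier) ∞)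
    (PreservesOrientation.id M.orientation.cylinder) (XDiffeo.dualEmpty n X pt).symm
    (((XDiffeo.dualDual M).symm.sum (XDiffeo.refl M.dual)).trans (XDiffeo.dualSum M.dual M).symm)
    (fun x => isEmptyElim x) (by rintro (x | x) <;> rfl) fun _ => rfl

variable (n X pt) in
/-- The cylinder on the empty manifold is its unit. -/
def cylinderEmptyDiffeo : (cylinder (XManifold.empty.{u} n X pt)).Diffeo (unit (XManifold.empty n X pt)) :=
  diffeoOfEq (W := cylinder (XManifold.empty.{u} n X pt)) (V := unit (XManifold.empty.{u} n X pt))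
    (Diffeomorph.refl (bdModel n) (Itv × (XManifold.empty.{u} n X pt).carrier) ∞)
    (PreservesOrientation.id (XManifold.empty.{u} n X pt).orientation.cylinder) (XDiffeo.refl _)
    ((XDiffeo.sumEmpty (XManifold.empty n X pt)).symm.trans
      ((XDiffeo.refl _).sum (XDiffeo.dualEmpty n X pt).symm))
    (fun x => isEmptyElim x) (fun x => isEmptyElim x) fun _ => rfl

/-- The bent `X`-cobordism of the reverse of `W`. -/
def bendReverseDiffeo (W : XCobordism M N) : W.bend.Diffeo W.reverse.bend :=
  diffeoOfEq (W := W.bend) (V := W.reverse.bend) (Diffeomorph.refl (bdModel n) W.carrier ∞)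
    (PreservesOrientation.id W.orientation) (XDiffeo.refl _)
    ((XDiffeo.swap N M.dual).trans ((XDiffeo.refl M.dual).sum (XDiffeo.dualDual N).symm))
    (fun x => isEmptyElim x) (by rintro (x | x) <;> rfl) fun _ => rfl

end XCobordism

end CylinderDiffeos

end HQFT

end

noncomputable section

set_option linter.unusedSectionVars false

namespace HQFT

open CategoryTheory MonoidalCategory

variable {n : ℕ} {X : Type v} [TopologicalSpace X] {pt : X}

/-! ### Duality and strictness in the category of homotopy cobordisms. -/

namespace HCobord

variable {M N P M' N' : XManifold.{u} n X pt}

/-- When the orientation is a free variable, the equality can be substituted and both sides become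
the identity. Applied to `M^**`, `(M ⨿ N)^*` and `∅^*`, it reduces strictness to statements about
identity diffeomorphisms. -/
theorem eqToHom_withOrientation
    {o : ManifoldOrientation (modelWithCornersSelf ℝ (EuclideanSpace ℝ (Fin n))) M.carrier n}
    (h : o = M.orientation) (e : (M.withOrientation o : HCobord.{u} n X pt) = M) :
    eqToHom e = diffeo (XDiffeo.ofOrientationEq M h) := by
  subst h
  rfl

theorem eqToHom_withOrientation_symm
    {o : ManifoldOrientation (modelWithCornersSelf ℝ (EuclideanSpace ℝ (Fin n))) M.carrier n}
    (h : o = M.orientation) (e : (M : HCobord.{u} n X pt) = M.withOrientation o) :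
    eqToHom e = diffeo (XDiffeo.ofOrientationEq M h).symm := by
  subst h
  rfl

theorem diffeo_congr {ψ φ : XDiffeo M N} (h : ∀ x, ψ.toDiffeo x = φ.toDiffeo x) :
    diffeo ψ = diffeo φ :=
  congrArg diffeo (XDiffeo.ext h)

theorem diffeo_symm_comp_diffeo (ψ : XDiffeo M N) :
    diffeo ψ.symm ≫ diffeo ψ = 𝟙 (N : HCobord.{u} n X pt) :=
  (diffeoIso ψ).inv_hom_id

theorem diffeo_comp_diffeo_symm (ψ : XDiffeo M N) :
    diffeo ψ ≫ diffeo ψ.symm = 𝟙 (M : HCobord.{u} n X pt) :=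
  (diffeoIso ψ).hom_inv_id

theorem whiskerLeft_diffeo (M : XManifold.{u} n X pt) (ψ : XDiffeo N P) :
    (M : HCobord.{u} n X pt) ◁ diffeo ψ = diffeo ((XDiffeo.refl M).sum ψ) :=
  diffeo_tensor (XDiffeo.refl M) ψ

theorem diffeo_whiskerRight (ψ : XDiffeo N P) (M : XManifold.{u} n X pt) :
    diffeo ψ ▷ (M : HCobord.{u} n X pt) = diffeo (ψ.sum (XDiffeo.refl M)) :=
  diffeo_tensor ψ (XDiffeo.refl M)

theorem whiskerLeft_cob (M : XManifold.{u} n X pt) (W : XCobordism N P) :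
    (M : HCobord.{u} n X pt) ◁ cob W = cob ((XCobordism.cylinder M).sum W) := by
  rw [← cob_tensor, cob_cylinder]
  rfl

theorem cob_whiskerRight (W : XCobordism N P) (M : XManifold.{u} n X pt) :
    cob W ▷ (M : HCobord.{u} n X pt) = cob (W.sum (XCobordism.cylinder M)) := by
  rw [← cob_tensor, cob_cylinder]
  rfl

theorem cob_reindex (W : XCobordism M N) (φ : XDiffeo M' M) (ψ : XDiffeo N' N) :
    cob (W.reindex φ ψ) ≫ diffeo ψ = diffeo φ ≫ cob W :=
  cob_diffeo (W.reindexDiffeo φ ψ)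

/-- Each composite is, by relation 2, a reindexed cylinder cut into four pieces. Relation 1 turns
the reindexing into unit isomorphisms, and relation 3 turns the cylinder into an identity. -/
theorem isDuality : (cylinderDuality.{u} n X pt).IsDuality where
  triangle M := by
    change diffeo (XDiffeo.emptySum M).symm ≫ cob (XCobordism.unit M) ▷ M ≫
      diffeo (XDiffeo.assoc M (XManifold.dual M) M) ≫ M ◁ cob (XCobordism.counit M) ≫
        diffeo (XDiffeo.sumEmpty M) = 𝟙 M
    rw [cob_whiskerRight, whiskerLeft_cob]
    have h := cob_gluing (XCobordism.triangleGluing M)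
    have h1 := cob_reindex (XCobordism.cylinder M) (XDiffeo.emptySum M) (XDiffeo.sumEmpty M)
    rw [h, cob_cylinder] at h1
    have h2 := congrArg (diffeo (XDiffeo.emptySum M).symm ≫ ·) h1
    simp only [Category.assoc, Category.comp_id] at h2
    exact h2.trans (diffeo_symm_comp_diffeo _)
  triangle_dual M := by
    change diffeo (XDiffeo.sumEmpty (XManifold.dual M)).symm ≫
      (XManifold.dual M) ◁ cob (XCobordism.unit M) ≫
      diffeo (XDiffeo.assoc (XManifold.dual M) M (XManifold.dual M)).symm ≫
        cob (XCobordism.counit M) ▷ (XManifold.dual M) ≫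
        diffeo (XDiffeo.emptySum (XManifold.dual M)) = 𝟙 (XManifold.dual M)
    rw [cob_whiskerRight, whiskerLeft_cob]
    have h := cob_gluing (XCobordism.triangleDualGluing M)
    have h1 := cob_reindex (XCobordism.cylinder (XManifold.dual M))
      (XDiffeo.sumEmpty (XManifold.dual M)) (XDiffeo.emptySum (XManifold.dual M))
    rw [h, cob_cylinder] at h1
    have h2 := congrArg (diffeo (XDiffeo.sumEmpty (XManifold.dual M)).symm ≫ ·) h1
    simp only [Category.assoc, Category.comp_id] at h2
    exact h2.trans (diffeo_symm_comp_diffeo _)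

/-- The reflection of the interval carries the cylinder on `M` to the cylinder on `-M` and exchanges
the two ends. -/
theorem unit_dual (M : XManifold.{u} n X pt) : cob (XCobordism.unit M.dual) =
    cob (XCobordism.unit M) ≫ diffeo (XDiffeo.swap M M.dual) ≫
      (M.dual : HCobord.{u} n X pt) ◁ diffeo (XDiffeo.dualDual M).symm := by
  have h : cob (XCobordism.unit M) ≫ diffeo _ = 𝟙 _ ≫ cob (XCobordism.unit M.dual) :=
    cob_diffeo (XCobordism.unitDualDiffeo M)
  rw [Category.id_comp] at h
  rw [whiskerLeft_diffeo, diffeo_comp, ← h]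
  rfl

/-- The product of the interval with `ψ` is an `X`-diffeomorphism between the units of `M` and `N`,
acting by `ψ` on one end and by `ψ₋` on the other. Moving `ψ₋` to the other side gives the equation
that characterizes the dual of `ψ`. -/
theorem dualMap_diffeo (ψ : XDiffeo M N) :
    (cylinderDuality.{u} n X pt).dualMap (diffeo ψ) = diffeo ψ.neg.symm := by
  refine isDuality.dualMap_eq ?_
  change cob (XCobordism.unit M) ≫ diffeo ψ ▷ M.dual =
    cob (XCobordism.unit N) ≫ (N : HCobord.{u} n X pt) ◁ diffeo ψ.neg.symm
  have h : cob (XCobordism.unit M) ≫ diffeo (ψ.sum ψ.neg) = 𝟙 _ ≫ cob (XCobordism.unit N) :=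
    cob_diffeo (XCobordism.unitCongr ψ)
  rw [Category.id_comp] at h
  rw [← h, Category.assoc, whiskerLeft_diffeo, diffeo_whiskerRight, diffeo_comp]
  congr 1
  refine diffeo_congr ?_
  rintro (x | x)
  · rfl
  · exact congrArg Sum.inr (ψ.toDiffeo.symm_apply_apply x).symm

/-- Both sides of the characterizing equation are `W` bent into a cobordism from `∅` to `N ⨿ M^*`.
For the left side this is `cob_bend`; for the right side it is `cob_bend` for the reversed
cobordism, whose outgoing boundary is the same up to the symmetry and the identification of `N^**`
with `N`. -/
theorem dualMap_cob (W : XCobordism M N) :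
    (cylinderDuality.{u} n X pt).dualMap (cob W) = cob W.reverse := by
  refine isDuality.dualMap_eq ?_
  change cob (XCobordism.unit M) ≫ tensor (cob W) (𝟙 (M.dual : HCobord.{u} n X pt)) =
    cob (XCobordism.unit N) ≫ (N : HCobord.{u} n X pt) ◁ cob W.reverse
  rw [← cob_bend]
  have h1 : cob W.bend ≫ diffeo ((XDiffeo.swap N M.dual).trans
      ((XDiffeo.refl M.dual).sum (XDiffeo.dualDual N).symm)) = 𝟙 _ ≫ cob W.reverse.bend :=
    cob_diffeo W.bendReverseDiffeo
  have h2 : cob W.reverse.bend = cob (XCobordism.unit N.dual) ≫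
      cob W.reverse ▷ (N.dual.dual : HCobord.{u} n X pt) := cob_bend W.reverse
  -- The unit of `N^*` is replaced by the swapped unit of `N`. The identification of `N` with `N^**`
  -- then passes by interchange to the end, and next the symmetry does so by naturality.
  rw [Category.id_comp, h2, unit_dual, Category.assoc, Category.assoc, whisker_exchange,
    ← diffeo_comp, ← whiskerLeft_diffeo] at h1
  have h3 : diffeo (XDiffeo.swap N N.dual) ≫ cob W.reverse ▷ (N : HCobord.{u} n X pt) =
      (N : HCobord.{u} n X pt) ◁ cob W.reverse ≫ diffeo (XDiffeo.swap N M.dual) :=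
    (BraidedCategory.braiding_naturality_right (N : HCobord.{u} n X pt) (cob W.reverse)).symm
  rw [reassoc_of% h3] at h1
  -- The swap and the identification now end both sides and, being an isomorphism, can be cancelled.
  have h4 : IsIso (diffeo (XDiffeo.swap N M.dual) ≫
      (M.dual : HCobord.{u} n X pt) ◁ diffeo (XDiffeo.dualDual N).symm) := by
    rw [whiskerLeft_diffeo, diffeo_comp]
    exact (diffeoIso _).isIso_hom
  rw [← cancel_mono (diffeo (XDiffeo.swap N M.dual) ≫
    (M.dual : HCobord.{u} n X pt) ◁ diffeo (XDiffeo.dualDual N).symm)]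
  simpa only [Category.assoc] using h1

theorem tensorη_cylinderDuality (M N : XManifold.{u} n X pt) :
    (cylinderDuality.{u} n X pt).tensorη M N = diffeo (XDiffeo.sumEmpty _).symm ≫
      cob ((XCobordism.unit M).sum (XCobordism.unit N)) ≫ diffeo (XDiffeo.permUnit M N) := by
  rw [tensorη_eq, ← cob_tensor]
  change diffeo _ ≫ tensor _ _ ≫ diffeo (XDiffeo.assoc M M.dual (N.sum N.dual)) ≫
    (M : HCobord.{u} n X pt) ◁ diffeo (XDiffeo.swap M.dual (N.sum N.dual)) ≫
    (M : HCobord.{u} n X pt) ◁ diffeo (XDiffeo.assoc N N.dual M.dual) ≫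
    (M : HCobord.{u} n X pt) ◁ ((N : HCobord.{u} n X pt) ◁ diffeo (XDiffeo.swap N.dual M.dual)) ≫
    diffeo (XDiffeo.assoc M N (M.dual.sum N.dual)).symm = _
  simp only [whiskerLeft_diffeo, diffeo_comp]
  rfl

theorem tensorε_cylinderDuality (M N : XManifold.{u} n X pt) :
    (cylinderDuality.{u} n X pt).tensorε M N = diffeo (XDiffeo.permCounit M N) ≫
      cob ((XCobordism.counit N).sum (XCobordism.counit M)) ≫ diffeo (XDiffeo.sumEmpty _) := by
  rw [tensorε_eq, ← cob_tensor]
  change diffeo (XDiffeo.swap M.dual N.dual) ▷ (M.sum N) ≫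
    diffeo (XDiffeo.assoc N.dual M.dual (M.sum N)) ≫
    (N.dual : HCobord.{u} n X pt) ◁ diffeo (XDiffeo.assoc M.dual M N).symm ≫
    (N.dual : HCobord.{u} n X pt) ◁ diffeo (XDiffeo.swap (M.dual.sum M) N) ≫
    diffeo (XDiffeo.assoc N.dual N (M.dual.sum M)).symm ≫ tensor _ _ ≫ diffeo _ = _
  simp only [whiskerLeft_diffeo, diffeo_whiskerRight, ← Category.assoc, diffeo_comp]
  rfl

/-- The cylinder on a disjoint union is the disjoint union of the cylinders, with its four boundary
parts permuted. -/
theorem unit_sum (M N : XManifold.{u} n X pt) : cob (XCobordism.unit (M.sum N)) ≫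
    (M.sum N : HCobord.{u} n X pt) ◁ diffeo (XDiffeo.dualSum M N) =
      (cylinderDuality.{u} n X pt).tensorη M N := by
  have h : cob ((XCobordism.unit M).sum (XCobordism.unit N)) ≫ diffeo ((XDiffeo.permUnit M N).trans
        ((XDiffeo.refl (M.sum N)).sum (XDiffeo.dualSum M N).symm)) =
      diffeo (XDiffeo.sumEmpty _) ≫ cob (XCobordism.unit (M.sum N)) :=
    cob_diffeo (XCobordism.unitSumDiffeo M N)
  have h1 : cob (XCobordism.unit (M.sum N)) = diffeo (XDiffeo.sumEmpty _).symm ≫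
      cob ((XCobordism.unit M).sum (XCobordism.unit N)) ≫ diffeo ((XDiffeo.permUnit M N).trans
        ((XDiffeo.refl (M.sum N)).sum (XDiffeo.dualSum M N).symm)) := by
    rw [h, ← Category.assoc, diffeo_symm_comp_diffeo, Category.id_comp]
  rw [h1, tensorη_cylinderDuality, whiskerLeft_diffeo, Category.assoc, Category.assoc, diffeo_comp]
  congr 2
  refine diffeo_congr ?_
  rintro ((x | x) | (x | x)) <;> rfl

theorem counit_sum (M N : XManifold.{u} n X pt) : cob (XCobordism.counit (M.sum N)) =
    diffeo (XDiffeo.dualSum M N) ▷ (M.sum N : HCobord.{u} n X pt) ≫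
      (cylinderDuality.{u} n X pt).tensorε M N := by
  have h : cob ((XCobordism.counit N).sum (XCobordism.counit M)) ≫ diffeo (XDiffeo.sumEmpty _) =
      diffeo ((XDiffeo.permCounit M N).symm.trans
        ((XDiffeo.dualSum M N).symm.sum (XDiffeo.refl (M.sum N)))) ≫
        cob (XCobordism.counit (M.sum N)) :=
    cob_diffeo (XCobordism.counitSumDiffeo M N)
  rw [tensorε_cylinderDuality, h, diffeo_whiskerRight, ← Category.assoc, ← Category.assoc,
    diffeo_comp, diffeo_comp]
  refine (Category.id_comp _).symm.trans (congrArg (· ≫ _) ?_)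
  rw [← diffeo_refl]
  refine diffeo_congr ?_
  rintro ((x | x) | (x | x)) <;> rfl

/-- The cylinder on `∅` is at once the unit and, by relation 3, an identity; relation 1 compares the
two readings. -/
theorem unit_empty : cob (XCobordism.unit (XManifold.empty.{u} n X pt)) =
    diffeo ((XDiffeo.sumEmpty (XManifold.empty n X pt)).symm.trans
      ((XDiffeo.refl _).sum (XDiffeo.dualEmpty n X pt).symm)) := by
  have h : cob (XCobordism.cylinder (XManifold.empty.{u} n X pt)) ≫ diffeo _ = 𝟙 _ ≫ cob _ :=
    cob_diffeo (XCobordism.cylinderEmptyDiffeo n X pt)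
  rw [cob_cylinder, Category.id_comp, Category.id_comp] at h
  exact h.symm

theorem unit_eq_reverse (M : XManifold.{u} n X pt) : cob (XCobordism.unit M) =
    diffeo (XDiffeo.dualEmpty n X pt).symm ≫ cob (XCobordism.counit M).reverse ≫
      diffeo (((XDiffeo.dualDual M).symm.sum (XDiffeo.refl M.dual)).trans
        (XDiffeo.dualSum M.dual M).symm).symm := by
  have h : cob (XCobordism.unit M) ≫ diffeo (((XDiffeo.dualDual M).symm.sum
        (XDiffeo.refl M.dual)).trans (XDiffeo.dualSum M.dual M).symm) =
      diffeo (XDiffeo.dualEmpty n X pt).symm ≫ cob (XCobordism.counit M).reverse :=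
    cob_diffeo (XCobordism.unitReverseDiffeo M)
  rw [← Category.assoc, ← h, Category.assoc, diffeo_comp_diffeo_symm, Category.comp_id]

theorem orientation_dual_sum_dual (M N : XManifold.{u} n X pt) :
    (M.dual.sum N).dual.orientation = (M.sum N.dual).orientation :=
  (ManifoldOrientation.neg_sum _ _).trans
    (congrArg (fun o => ManifoldOrientation.sum o (-N.orientation))
      (ManifoldOrientation.neg_neg M.orientation))

theorem orientation_dual_dual_sum_dual (M : XManifold.{u} n X pt) :
    (M.dual.dual.sum M.dual).dual.orientation = (M.dual.sum M).orientation :=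
  (orientation_dual_sum_dual M.dual M.dual).trans
    (congrArg (fun o => ManifoldOrientation.sum (-M.orientation) o)
      (ManifoldOrientation.neg_neg M.orientation))

/-- The identity `(M^* ⨿ M)^* → M ⨿ M^*`. -/
def dualDualSum (M : XManifold.{u} n X pt) : XDiffeo (M.dual.sum M).dual (M.sum M.dual) :=
  XDiffeo.ofOrientationEq (M.sum M.dual) (orientation_dual_sum_dual M M)

/-- The identity `(M^** ⨿ M^*)^* → M^* ⨿ M`. -/
def dualDualDualSum (M : XManifold.{u} n X pt) :
    XDiffeo (M.dual.dual.sum M.dual).dual (M.dual.sum M) :=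
  XDiffeo.ofOrientationEq (M.dual.sum M) (orientation_dual_dual_sum_dual M)

/-- By `dualMap_cob` the dual of the counit is the same cylinder with all of its boundary outgoing,
which is the unit. -/
theorem unit_eq_dualMap_counit (M : XManifold.{u} n X pt) : cob (XCobordism.unit M) =
    diffeo (XDiffeo.dualEmpty n X pt).symm ≫
      (cylinderDuality.{u} n X pt).dualMap (cob (XCobordism.counit M)) ≫
        diffeo (dualDualSum M) := by
  rw [dualMap_cob]
  refine (unit_eq_reverse M).trans (congrArg (fun k => diffeo (XDiffeo.dualEmpty n X pt).symm ≫
    cob (XCobordism.counit M).reverse ≫ k) (diffeo_congr ?_))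
  rintro (x | x) <;> rfl

/-- Reflection writes the unit of `M` as that of `M^*` followed by the symmetry, and the unit of
`M^*` is the reversed counit of `M^*`. -/
theorem unit_eq_dualMap_counit_dual (M : XManifold.{u} n X pt) : cob (XCobordism.unit M) =
    diffeo (XDiffeo.dualEmpty n X pt).symm ≫
      (cylinderDuality.{u} n X pt).dualMap (cob (XCobordism.counit M.dual)) ≫
        diffeo (dualDualDualSum M) ≫ diffeo (XDiffeo.swap M.dual M) := by
  have h : cob (XCobordism.unit M) = cob (XCobordism.unit M.dual) ≫
      diffeo (((XDiffeo.refl M.dual).sum (XDiffeo.dualDual M)).trans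
        (XDiffeo.swap M.dual M)) := by
    rw [unit_dual, whiskerLeft_diffeo, Category.assoc, diffeo_comp, diffeo_comp]
    refine (Category.comp_id _).symm.trans (congrArg (_ ≫ ·) ?_)
    rw [← diffeo_refl]
    refine diffeo_congr ?_
    rintro (x | x) <;> rfl
  rw [dualMap_cob, h, unit_eq_reverse, Category.assoc, Category.assoc, diffeo_comp]
  refine congrArg (fun k => diffeo (XDiffeo.dualEmpty n X pt).symm ≫
    cob (XCobordism.counit M.dual).reverse ≫ k) (Eq.trans (diffeo_congr ?_)
      (diffeo_comp (dualDualDualSum M) (XDiffeo.swap M.dual M)).symm)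
  rintro (x | x) <;> rfl

/-- By `compareDuals_eq` it is enough to write the swapped unit of `M` as the unit of `M^*` followed
by the identification of `M^**` with `M`, which is `unit_dual`. The two comparisons after it work
alike, with `unit_sum` and `unit_empty`. -/
theorem compareDuals_dual_dual (M : XManifold.{u} n X pt) :
    compareDuals ((cylinderDuality.{u} n X pt).ε M.dual)
      (cob (XCobordism.unit M) ≫ diffeo (XDiffeo.swap M M.dual)) =
        diffeo (XDiffeo.dualDual M) := by
  refine Eq.trans (congrArg (compareDuals _) ?_)
    (isDuality.compareDuals_eq (diffeo (XDiffeo.dualDual M)))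
  change cob (XCobordism.unit M) ≫ diffeo (XDiffeo.swap M M.dual) =
    cob (XCobordism.unit M.dual) ≫ (M.dual : HCobord.{u} n X pt) ◁ diffeo (XDiffeo.dualDual M)
  rw [unit_dual, Category.assoc, Category.assoc, ← whiskerLeft_comp, diffeo_symm_comp_diffeo,
    whiskerLeft_id]
  exact congrArg (_ ≫ ·) (Category.comp_id _).symm

theorem compareDuals_tensor (M N : XManifold.{u} n X pt) :
    compareDuals ((cylinderDuality.{u} n X pt).ε (M.sum N))
      ((cylinderDuality.{u} n X pt).tensorη M N) = diffeo (XDiffeo.dualSum M N) :=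
  Eq.trans (congrArg (compareDuals _) (unit_sum M N).symm)
    (isDuality.compareDuals_eq (diffeo (XDiffeo.dualSum M N)))

theorem compareDuals_empty :
    compareDuals ((cylinderDuality.{u} n X pt).ε (XManifold.empty n X pt))
      (λ_ (𝟙_ (HCobord.{u} n X pt))).inv = diffeo (XDiffeo.dualEmpty n X pt) := by
  refine Eq.trans (congrArg (compareDuals _) ?_)
    (isDuality.compareDuals_eq (diffeo (XDiffeo.dualEmpty n X pt)))
  change diffeo (XDiffeo.emptySum _).symm = cob (XCobordism.unit (XManifold.empty n X pt)) ≫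
    (XManifold.empty n X pt : HCobord.{u} n X pt) ◁ diffeo (XDiffeo.dualEmpty n X pt)
  rw [unit_empty, whiskerLeft_diffeo, diffeo_comp]
  exact diffeo_congr fun x => isEmptyElim x

theorem isStrict : (cylinderDuality.{u} n X pt).IsStrict where
  toIsDuality := isDuality
  dual_dual M := XManifold.dual_dual M
  dual_tensor M N := XManifold.dual_sum M N
  dual_unit := XManifold.dual_empty
  dual_dual_iso M := (compareDuals_dual_dual M).trans (eqToHom_withOrientation _ _).symm
  dual_tensor_iso M N := (compareDuals_tensor M N).trans (eqToHom_withOrientation _ _).symm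
  dual_unit_iso := compareDuals_empty.trans (eqToHom_withOrientation _ _).symm
  η_eq_dual_ε_dual M := (unit_eq_dualMap_counit_dual M).trans
    (congrArg₂ (fun k l => k ≫ (cylinderDuality.{u} n X pt).dualMap
        (cob (XCobordism.counit (XManifold.dual M))) ≫ l ≫ diffeo (XDiffeo.swap (XManifold.dual M) M))
      (eqToHom_withOrientation_symm _ _).symm (eqToHom_withOrientation _ _).symm)
  η_eq_dual_ε M := (unit_eq_dualMap_counit M).trans
    (congrArg₂ (fun k l => k ≫ (cylinderDuality.{u} n X pt).dualMap
        (cob (XCobordism.counit M)) ≫ l)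
      (eqToHom_withOrientation_symm _ _).symm (eqToHom_withOrientation _ _).symm)
  η_tensor M N := (congrArg (fun k => cob (XCobordism.unit (XManifold.sum M N)) ≫
      (XManifold.sum M N : HCobord.{u} n X pt) ◁ k) (eqToHom_withOrientation
        (M := (XManifold.dual M).sum (XManifold.dual N))
        (ManifoldOrientation.neg_sum _ _) _)).trans
    (unit_sum M N)
  ε_tensor M N := (counit_sum M N).trans
    (congrArg (fun k => k ▷ (XManifold.sum M N : HCobord.{u} n X pt) ≫
      (cylinderDuality.{u} n X pt).tensorε M N) (eqToHom_withOrientation _ _).symm)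

end HCobord

end HQFT

end

theorem mainTheorem9 (n : ℕ) (X : Type v) [TopologicalSpace X] [PathConnectedSpace X] (pt : X) :
    (HQFT.cylinderDuality.{u} n X pt).IsStrict ∧
    (∀ {M N : HQFT.XManifold.{u} n X pt} (W : HQFT.XCobordism M N),
      (HQFT.cylinderDuality.{u} n X pt).dualMap (HQFT.HCobord.cob W) =
        HQFT.HCobord.cob W.reverse) ∧
    (∀ {M N : HQFT.XManifold.{u} n X pt} (ψ : HQFT.XDiffeo M N),
      (HQFT.cylinderDuality.{u} n X pt).dualMap (HQFT.HCobord.diffeo ψ) =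
        HQFT.HCobord.diffeo ψ.neg.symm) :=
  ⟨HQFT.HCobord.isStrict, fun W => HQFT.HCobord.dualMap_cob W,
    fun ψ => HQFT.HCobord.dualMap_diffeo ψ⟩
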